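/- Let $d\ge 1$, let $J=\mathrm{diag}(J_1,\dots,J_d)$ with all $J_i>0$, and let $(M,P)$ be a solution, defined on the whole real line, of the Bogoyavlenskij system $$M'=[M,\Omega]-[P,J],\qquad P'=[P,\Omega],$$ where $M=J\Omega+\Omega J$ and $\Omega,P$ are real $d\times d$ matrices with $\Omega^\top=-\Omega$, $P^\top=P$. Put $U=\Omega^2-\Omega'+P$ and $L=-D_x^2+U(x)$, acting on $\mathbb C^d$-valued functions on $\mathbb R$, and let $S=\sqrt J$. For $x\in\mathbb R$ let $\Gamma^{\mathbb C}$ be the set of $(\mu,\lambda)\in\mathbb C^2$ with $$\det\bigl(\mu^2J^2-\mu M(x)-P(x)+\lambda I\bigr)=0,$$ and let $\Gamma$ be its real part, given by $\bar\mu=-\mu$, $\bar\lambda=\lambda$. The following holds for every choice of $x$ in the definition of these curves. 1. The potential $SUS^{-1}$ is symmetric at every point, and the operator $SLS^{-1}=-D_x^2+SUS^{-1}$ with domain $\{f\in H^2(\mathbb R;\mathbb C^d) : -f''+SUS^{-1}f\in L^2\}$ is self-adjoint in $L^2(\mathbb R;\mathbb C^d)$. 2. $L$ is maximally finite-gap: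 for all sufficiently large real $\lambda$ all solutions of $L\psi=\lambda\psi$ are bounded on $\mathbb R$. 3. $\Gamma^{\mathbb C}$ is the spectral curve of $L$: $(\mu,\lambda)\in\Gamma^{\mathbb C}$ if and only if there is a nonzero $\psi$ with $L\psi=\lambda\psi$ and $J^{-1}(D_x+\Omega)\psi=\mu\psi$; and $(\mu,\lambda)\in\Gamma$ if and only if there is a bounded such $\psi$. 4. The spectrum of $L$ is the projection of $\Gamma$ to the $\lambda$-axis. This holds both for the set of $\lambda\in\mathbb C$ for which $L\psi=\lambda\psi$ has a nonzero bounded solution and for the spectrum of the operator $L$ in $L^2(\mathbb R;\mathbb C^d)$. 5. For every $\lambda\in\mathbb C$, the multiplicity of $\lambda$, defined as the dimension of the space of bounded solutions of $L\psi=\lambda\psi$, is the number of points $(\mu,\lambda)\in\Gamma$ over $\lambda$, each counted with the dimension of the kernel of $\mu^2J^2-\mu M(x)-P(x)+\lambda I$. 6. Every real $\lambda$ greater than the largest eigenvalue of $P(x)$ lies in the spectrum (in both senses of 4), in fact in the continuous spectrum of the operator $L$ in $L^2(\mathbb R;\mathbb C^d)$, and has multiplicity $2d$. -/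

import Mathlib

open MeasureTheory

noncomputable section

namespace Bogoyavlenskij

/-- Real `d × d` matrices. -/
abbrev RMat (d : ℕ) : Type := Matrix (Fin d) (Fin d) ℝ

/-- The space `ℂ^d` with its standard Hermitian inner product. -/
abbrev Vec (d : ℕ) : Type := EuclideanSpace ℂ (Fin d)

/-- The Hilbert space `L²(ℝ; ℂ^d)`. -/
abbrev L2 (d : ℕ) : Type := Lp (Vec d) 2 (volume : Measure ℝ)

variable {d : ℕ}

/-- The action of a real matrix on `ℂ^d`. -/
def act (A : RMat d) : Vec d →ₗ[ℂ] Vec d :=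
  Matrix.toEuclideanLin (A.map (fun a : ℝ => (a : ℂ)))

/-- The entrywise derivative of a matrix-valued function. -/
def matDeriv (A : ℝ → RMat d) (x : ℝ) : RMat d :=
  Matrix.of fun i j => deriv (fun y => A y i j) x

/-- A solution, defined on the whole real line, of the system
`M' = [M, Ω] - [P, J]`, `P' = [P, Ω]` with `M = JΩ + ΩJ`, `Ω` skew-symmetric, `P` symmetric,
and `J = diag (J₁, …, J_d)`. -/
structure IsTopSolution (J : Fin d → ℝ) (Ω M P : ℝ → RMat d) : Prop where
  skew : ∀ t, (Ω t).transpose = -Ω t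
  symm : ∀ t, (P t).transpose = P t
  momentum : ∀ t, M t = Matrix.diagonal J * Ω t + Ω t * Matrix.diagonal J
  deriv_M : ∀ t i j, HasDerivAt (fun s => M s i j)
    ((M t * Ω t - Ω t * M t - (P t * Matrix.diagonal J - Matrix.diagonal J * P t)) i j) t
  deriv_P : ∀ t i j, HasDerivAt (fun s => P s i j) ((P t * Ω t - Ω t * P t) i j) t

/-- The potential `U = Ω² - Ω' + P`. -/
def topPotential (Ω P : ℝ → RMat d) (x : ℝ) : RMat d :=
  Ω x ^ 2 - matDeriv Ω x + P x

/-- The square root `S` of `J = diag (J₁, …, J_d)`. -/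
def sqrtJ (J : Fin d → ℝ) : RMat d := Matrix.diagonal fun i => Real.sqrt (J i)

/-- The conjugated potential `S U S⁻¹`, where `S` is the square root of `J`. -/
def conjPotential (J : Fin d → ℝ) (U : ℝ → RMat d) (x : ℝ) : RMat d :=
  sqrtJ J * U x * (sqrtJ J)⁻¹

/-! ### Solutions of the Schrödinger equation -/

/-- The function `ψ : ℝ → ℂ^d` is a (classical) solution of `-ψ'' + U ψ = z ψ`. -/
def IsSolution (U : ℝ → RMat d) (z : ℂ) (ψ : ℝ → Vec d) : Prop :=
  Differentiable ℝ ψ ∧ Differentiable ℝ (deriv ψ) ∧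
    ∀ x, -deriv (deriv ψ) x + act (U x) (ψ x) = z • ψ x

/-- Boundedness on the whole line. -/
def IsBoundedFun (ψ : ℝ → Vec d) : Prop := ∃ C : ℝ, ∀ x, ‖ψ x‖ ≤ C

/-- The complex vector space of all bounded solutions of `-ψ'' + U ψ = z ψ`. -/
def boundedSolutions (U : ℝ → RMat d) (z : ℂ) : Submodule ℂ (ℝ → Vec d) where
  carrier := {ψ | IsSolution U z ψ ∧ IsBoundedFun ψ}
  zero_mem' := by
    have h0 : deriv (0 : ℝ → Vec d) = 0 := by
      funext x
      exact deriv_const x (0 : Vec d)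
    refine ⟨⟨differentiable_const 0, ?_, fun x => ?_⟩, 0, fun x => ?_⟩
    · rw [h0]
      exact differentiable_const 0
    · simp [h0]
    · simp
  add_mem' := by
    rintro ψ φ ⟨⟨h1, h2, h3⟩, C, hC⟩ ⟨⟨k1, k2, k3⟩, D, hD⟩
    have e : deriv (ψ + φ) = deriv ψ + deriv φ := by
      funext x
      exact deriv_add (h1 x) (k1 x)
    refine ⟨⟨h1.add k1, ?_, fun x => ?_⟩, C + D, fun x => ?_⟩
    · rw [e]
      exact h2.add k2
    · rw [e, deriv_add (h2 x) (k2 x), Pi.add_apply, map_add, smul_add, ← h3 x, ← k3 x]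
      abel
    · exact (norm_add_le _ _).trans (add_le_add (hC x) (hD x))
  smul_mem' := by
    rintro c ψ ⟨⟨h1, h2, h3⟩, C, hC⟩
    have e : deriv (c • ψ) = c • deriv ψ := by
      funext x
      exact deriv_const_smul c (h1 x)
    refine ⟨⟨h1.const_smul c, ?_, fun x => ?_⟩, ‖c‖ * C, fun x => ?_⟩
    · rw [e]
      exact h2.const_smul c
    · rw [e, deriv_const_smul c (h2 x), Pi.smul_apply, map_smul, smul_comm z c, ← h3 x,
        smul_add, smul_neg]
    · rw [Pi.smul_apply, norm_smul]
      exact mul_le_mul_of_nonneg_left (hC x) (norm_nonneg c)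

/-- The spectrum of `-D² + U` in the sense of bounded solutions: the set of all complex `z` for
which `-ψ'' + U ψ = z ψ` has a nonzero solution that is bounded on the line. -/
def boundedSpectrum (U : ℝ → RMat d) : Set ℂ :=
  {z | ∃ ψ : ℝ → Vec d, ψ ≠ 0 ∧ IsSolution U z ψ ∧ IsBoundedFun ψ}

/-- The multiplicity of `z`: the number of linearly independent bounded solutions. -/
def spectralMultiplicity (U : ℝ → RMat d) (z : ℂ) : ℕ :=
  Module.finrank ℂ (boundedSolutions U z)

/-- For all sufficiently large real `lam`, every solution of `-ψ'' + U ψ = lam ψ` is bounded. -/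
def IsMaximallyFiniteGap (U : ℝ → RMat d) : Prop :=
  ∃ lam₀ : ℝ, ∀ lam : ℝ, lam₀ < lam →
    ∀ ψ : ℝ → Vec d, IsSolution U (lam : ℂ) ψ → IsBoundedFun ψ

/-- `ψ` is a common eigenfunction: `L ψ = z ψ` for `L = -D² + Ω² - Ω' + P`, and `A ψ = μ ψ` for
the first order operator `A = J⁻¹ (D + Ω)`. -/
def IsJointEigenfunction (J : Fin d → ℝ) (Ω P : ℝ → RMat d) (μ z : ℂ) (ψ : ℝ → Vec d) : Prop :=
  ψ ≠ 0 ∧ IsSolution (topPotential Ω P) z ψ ∧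
    ∀ x, act (Matrix.diagonal J)⁻¹ (deriv ψ x + act (Ω x) (ψ x)) = μ • ψ x

/-! ### The spectral curve -/

/-- The matrix `μ² J² - μ M - P + z I`. -/
def pencil (J : Fin d → ℝ) (M P : RMat d) (μ z : ℂ) : Matrix (Fin d) (Fin d) ℂ :=
  μ ^ 2 • (Matrix.diagonal J ^ 2).map (fun a : ℝ => (a : ℂ))
    - μ • M.map (fun a : ℝ => (a : ℂ)) - P.map (fun a : ℝ => (a : ℂ)) + z • 1

/-- The complex curve `det (μ² J² - μ M - P + z I) = 0` of pairs `(μ, z)`. -/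
def spectralCurve (J : Fin d → ℝ) (M P : RMat d) : Set (ℂ × ℂ) :=
  {p | (pencil J M P p.1 p.2).det = 0}

/-- The part of the curve with `μ` purely imaginary and `z` real. -/
def realCurve (J : Fin d → ℝ) (M P : RMat d) : Set (ℂ × ℂ) :=
  {p ∈ spectralCurve J M P | star p.1 = -p.1 ∧ star p.2 = p.2}

/-! ### The operator in `L²(ℝ; ℂ^d)` -/

/-- The graph of `-D² + U` on the Sobolev space `H²(ℝ; ℂ^d)`: pairs `(f, g)` of elements of `L²`
such that `f` has a continuously differentiable representative `ψ` whose derivative `χ` is an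
indefinite integral of a square-integrable function `h` (so `h = ψ''`), and `g = -h + U ψ`. -/
def schrodingerGraph (U : ℝ → RMat d) : Submodule ℂ (L2 d × L2 d) where
  carrier := {p | ∃ ψ χ h : ℝ → Vec d, (p.1 : ℝ → Vec d) =ᵐ[volume] ψ ∧
    (∀ x, HasDerivAt ψ (χ x) x) ∧ MemLp h 2 volume ∧
    (∀ a b : ℝ, χ b - χ a = ∫ x in a..b, h x) ∧
    (p.2 : ℝ → Vec d) =ᵐ[volume] fun x => -h x + act (U x) (ψ x)}
  zero_mem' := by
    refine ⟨0, 0, 0, Lp.coeFn_zero _ _ _, fun x => hasDerivAt_const x 0, MemLp.zero,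
      fun a b => by simp, ?_⟩
    filter_upwards [Lp.coeFn_zero (Vec d) 2 (volume : Measure ℝ)] with x hx
    simp
  add_mem' := by
    rintro ⟨f, g⟩ ⟨f', g'⟩ ⟨ψ, χ, h, h1, h2, h3, h4, h5⟩ ⟨ψ', χ', h', k1, k2, k3, k4, k5⟩
    refine ⟨ψ + ψ', χ + χ', h + h', ?_, fun x => (h2 x).add (k2 x), h3.add k3, fun a b => ?_, ?_⟩
    · exact (Lp.coeFn_add f f').trans (h1.add k1)
    · have i1 : IntervalIntegrable h volume a b :=
        intervalIntegrable_iff.2 <|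
          ((h3.locallyIntegrable (by norm_num)).integrableOn_isCompact isCompact_uIcc).mono_set
            Set.uIoc_subset_uIcc
      have i2 : IntervalIntegrable h' volume a b :=
        intervalIntegrable_iff.2 <|
          ((k3.locallyIntegrable (by norm_num)).integrableOn_isCompact isCompact_uIcc).mono_set
            Set.uIoc_subset_uIcc
      have e := intervalIntegral.integral_add i1 i2
      simp only [Pi.add_apply]
      rw [e, ← h4, ← k4]
      abel
    · filter_upwards [Lp.coeFn_add g g', h5, k5] with x e1 e2 e3
      simp only [Prod.mk_add_mk] at e1 e2 e3 ⊢
      rw [e1, Pi.add_apply, e2, e3, Pi.add_apply, Pi.add_apply, map_add]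
      abel
  smul_mem' := by
    rintro c ⟨f, g⟩ ⟨ψ, χ, h, h1, h2, h3, h4, h5⟩
    refine ⟨c • ψ, c • χ, c • h, ?_, fun x => (h2 x).const_smul c, h3.const_smul c,
      fun a b => ?_, ?_⟩
    · exact (Lp.coeFn_smul c f).trans (h1.const_smul c)
    · have e := intervalIntegral.integral_smul (a := a) (b := b) (μ := volume) c h
      simp only [Pi.smul_apply]
      rw [e, ← h4, smul_sub]
    · filter_upwards [Lp.coeFn_smul c g, h5] with x e1 e2
      simp only [Prod.smul_mk] at e1 e2 ⊢
      rw [e1, Pi.smul_apply, e2, Pi.smul_apply, Pi.smul_apply, map_smul, smul_add, smul_neg]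

/-- The graph is that of a function, so the operator below is well defined. -/
theorem schrodingerGraph_single_valued (U : ℝ → RMat d) (p : L2 d × L2 d)
    (hp : p ∈ schrodingerGraph U) (h0 : p.1 = 0) : p.2 = 0 := by
  obtain ⟨f, g⟩ := p
  obtain ⟨ψ, χ, h, h1, h2, h3, h4, h5⟩ := hp
  simp only at h0 h1 h5 ⊢
  subst h0
  have hψc : Continuous ψ := continuous_iff_continuousAt.2 fun x => (h2 x).continuousAt
  have hψ : ψ = 0 := by
    refine (Continuous.ae_eq_iff_eq volume hψc continuous_zero).1 ?_
    exact h1.symm.trans (Lp.coeFn_zero _ _ _)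
  subst hψ
  have hχ : ∀ x, χ x = 0 := fun x => (h2 x).unique (hasDerivAt_const x 0)
  have hint : ∀ b : ℝ, ∫ x in (0 : ℝ)..b, h x = 0 := fun b => by
    rw [← h4, hχ, hχ, sub_zero]
  have hh : h =ᵐ[volume] 0 := by
    filter_upwards [LocallyIntegrable.ae_hasDerivAt_integral
      (h3.locallyIntegrable (by norm_num))] with x hx
    have hx0 := hx 0
    simp only [hint] at hx0
    exact hx0.unique (hasDerivAt_const x 0)
  refine (Lp.eq_zero_iff_ae_eq_zero).2 ?_
  filter_upwards [h5, hh] with x e1 e2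
  rw [e1, e2]
  simp

/-- The operator `-D² + U` in `L²(ℝ; ℂ^d)` with domain the functions `ψ` in `H²(ℝ; ℂ^d)` for which
`-ψ'' + U ψ` is in `L²` (all of `H²` if `U` is continuous and bounded). -/
def schrodinger (U : ℝ → RMat d) : L2 d →ₗ.[ℂ] L2 d := (schrodingerGraph U).toLinearPMap

/-- The spectrum of a partially defined operator: those `z` for which `T - z` does not have a
bounded everywhere defined two-sided inverse. -/
def opSpectrum (T : L2 d →ₗ.[ℂ] L2 d) : Set ℂ :=
  {z | ¬ ∃ R : L2 d →L[ℂ] L2 d,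
    (∀ g : L2 d, ∃ hg : R g ∈ T.domain, T ⟨R g, hg⟩ - z • R g = g) ∧
    ∀ f : T.domain, R (T f - z • (f : L2 d)) = f}

/-- The continuous spectrum: the points `z` of the spectrum for which `T - z` is injective and has
dense range. -/
def contSpectrum (T : L2 d →ₗ.[ℂ] L2 d) : Set ℂ :=
  {z ∈ opSpectrum T | (Function.Injective fun f : T.domain => T f - z • (f : L2 d)) ∧
    DenseRange fun f : T.domain => T f - z • (f : L2 d)}

end Bogoyavlenskij

end

open Bogoyavlenskij

/-!
Along a solution of the system put `C(t)` for the companion matrix of the quadratic pencil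
`μ² J² - μ M(t) - P(t) + z`, acting on `ℂ^d × ℂ^d`. The equation `L ψ = z ψ` is equivalent to the
first order system `Φ' = (J C - Ω) Φ` for `Φ = (ψ, J⁻¹ (D + Ω) ψ)`, and the equations for `M` and
`P` say exactly that `C` maps solutions of this system to solutions (`IsPrimitive.map_companion`,
stated with a source term and for absolutely continuous functions). So `C` is the operator
`A = J⁻¹ (D + Ω)` restricted to the kernel of `L - z`. Its eigenvalues do not depend on `t`, and
its eigenvectors are the joint eigenfunctions; these satisfy `ψ' = (μ J - Ω) ψ`.

*Bounded solutions.* The traces of `P²` and of `M² - 2 J² P` are conserved, hence `M`, `P`, `Ω` and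
`U` are bounded. Since `Ω` is skew, `(‖ψ‖²)' = 2 Re μ ⟪J ψ, ψ⟫` for a joint eigenfunction; so `‖ψ‖`
is constant if `μ` is imaginary, `ψ` is unbounded otherwise, and `ψ` is never square integrable. A
Jordan block of `C` with imaginary eigenvalue gives linear growth (`eq_zero_of_jordan_of_bounded`).
Therefore the bounded solutions form the sum of the eigenspaces of `C` with imaginary eigenvalue,
which gives the spectrum in the sense of bounded solutions and the multiplicities. A point of the
curve with imaginary `μ` has real `z`, because the part `μ² J² - μ M - P` of the
pencil is then Hermitian. If `z` is real and larger than all eigenvalues of `P`, then the quadratic form of the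
pencil has a positive constant term, all eigenvalues of `C` are imaginary and semisimple, and all
solutions are bounded.

*The operator.* The adjoint of `-D² + U` on `H²` is `-D² + Uᵀ` on `H²`
(`adjoint_schrodingerGraph`): an element of the adjoint has a weak second derivative in `L²`, and
`L²` control of a function and its second derivative gives control of the first (`memLp_deriv`).
This yields the self-adjointness of the conjugated operator, and it shows that `L` is closed. As
`J U = Uᵀ J`, the orthogonal complement of the range of `L - z` is `J` times the kernel of
`L - z̄`, and `L` has no eigenfunctions in `L²` (`IsFlow.eq_zero_of_memLp`); so `L - z` is always
injective with dense range. If `z` is not in the projection of the real curve, then a polynomial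
`∏ (C - μₖ)` with all `Re μₖ ≠ 0` annihilates `C(t)` for every `t`. Integrating `(‖u‖²)'` shows
that `u' = (μ J - Ω) u + r` implies `‖u‖ ≤ K ‖r‖` in `L²` if `Re μ ≠ 0`; removing the factors one
by one bounds `L - z` below (`exists_integral_norm_sq_le_of_factors`), and `L - z` has a bounded
inverse. Conversely, over a point of the real curve there is a joint eigenfunction of constant
norm, and its truncations are approximate eigenfunctions (`exists_approximate_eigenfunction`).
-/

namespace Bogoyavlenskij
open Set Filter Topology

/-! ### Linear differential equations on the line -/

section LinearODE

variable {F : Type*} [NormedAddCommGroup F] [NormedSpace ℝ F]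

/-- The contraction behind the existence theorem: with the weight `cosh (2 k (t - t₀))`, the
Volterra operator of a coefficient bounded by `k` has norm at most `1 / 2`. -/
theorem norm_integral_le_cosh {k c : ℝ} {t₀ : ℝ} {r : ℝ → F}
    (hr : ∀ s, ‖r s‖ ≤ k * c * Real.cosh (2 * k * (s - t₀))) (hc : 0 ≤ c) (t : ℝ) :
    ‖∫ s in t₀..t, r s‖ ≤ c / 2 * Real.cosh (2 * k * (t - t₀)) := by
  have hder : ∀ s : ℝ, HasDerivAt (fun s => c / 2 * Real.sinh (2 * k * (s - t₀)))
      (k * c * Real.cosh (2 * k * (s - t₀))) s := by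
    intro s
    have h1 : HasDerivAt (fun s : ℝ => 2 * k * (s - t₀)) (2 * k) s := by
      simpa using ((hasDerivAt_id s).sub_const t₀).const_mul (2 * k)
    exact ((h1.sinh).const_mul (c / 2)).congr_deriv (by ring)
  have hcont : Continuous fun s : ℝ => k * c * Real.cosh (2 * k * (s - t₀)) := by fun_prop
  have hint := intervalIntegral.integral_eq_sub_of_hasDerivAt (fun s _ => hder s)
    (hcont.intervalIntegrable t₀ t)
  refine (intervalIntegral.norm_integral_le_abs_of_norm_le
    (Eventually.of_forall fun s => hr s) (hcont.intervalIntegrable t₀ t)).trans ?_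
  rw [hint]
  simp only [sub_self, mul_zero, Real.sinh_zero, sub_zero]
  rw [abs_mul, abs_of_nonneg (by positivity : (0 : ℝ) ≤ c / 2)]
  refine mul_le_mul_of_nonneg_left ?_ (by positivity)
  rw [Real.abs_sinh, ← Real.cosh_abs]
  exact (Real.sinh_lt_cosh _).le

/-- A linear differential equation with bounded continuous coefficients has a solution on the
whole line for every initial value. -/
theorem exists_linear_ode [CompleteSpace F] (B : ℝ → F →L[ℝ] F) (hB : Continuous B) {K : ℝ}
    (hK : ∀ t, ‖B t‖ ≤ K) (t₀ : ℝ) (v : F) :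
    ∃ u : ℝ → F, u t₀ = v ∧ ∀ t, HasDerivAt u (B t (u t)) t := by
  obtain ⟨k, hk, hKk⟩ : ∃ k : ℝ, 0 < k ∧ ∀ t, ‖B t‖ ≤ k :=
    ⟨|K| + 1, by positivity, fun t => (hK t).trans (by linarith [le_abs_self K])⟩
  set W : ℝ → ℝ := fun t => Real.cosh (2 * k * (t - t₀)) with hW
  have hWc : Continuous W := by fun_prop
  have hW1 : ∀ t, 1 ≤ W t := fun t => Real.one_le_cosh _
  have hW0 : ∀ t, 0 < W t := fun t => Real.cosh_pos _
  have hbound : ∀ (w : BoundedContinuousFunction ℝ F) (s : ℝ),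
      ‖B s (W s • w s)‖ ≤ k * ‖w‖ * W s := by
    intro w s
    calc ‖B s (W s • w s)‖ ≤ ‖B s‖ * ‖W s • w s‖ := (B s).le_opNorm _
      _ ≤ k * (W s * ‖w‖) := by
          rw [norm_smul, Real.norm_of_nonneg (hW0 s).le]
          exact mul_le_mul (hKk s) (mul_le_mul_of_nonneg_left (w.norm_coe_le_norm s) (hW0 s).le)
            (by have := hW0 s; positivity) hk.le
      _ = k * ‖w‖ * W s := by ring
  have hcont : ∀ w : BoundedContinuousFunction ℝ F, Continuous fun s => B s (W s • w s) :=
    fun w => hB.clm_apply (hWc.smul w.continuous)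
  have hprim : ∀ w : BoundedContinuousFunction ℝ F,
      Continuous fun t => ∫ s in t₀..t, B s (W s • w s) :=
    fun w => intervalIntegral.continuous_primitive (fun a b => (hcont w).intervalIntegrable a b) t₀
  let T : BoundedContinuousFunction ℝ F → BoundedContinuousFunction ℝ F := fun w =>
    BoundedContinuousFunction.ofNormedAddCommGroup
      (fun t => (W t)⁻¹ • (v + ∫ s in t₀..t, B s (W s • w s)))
      ((hWc.inv₀ fun t => (hW0 t).ne').smul (continuous_const.add (hprim w)))
      (‖v‖ + ‖w‖ / 2) (by
        intro t
        rw [norm_smul, norm_inv, Real.norm_of_nonneg (hW0 t).le, inv_mul_le_iff₀ (hW0 t)]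
        have h1 := norm_integral_le_cosh (hbound w) (norm_nonneg w) t
        have h2 : ‖v‖ ≤ W t * ‖v‖ := le_mul_of_one_le_left (norm_nonneg v) (hW1 t)
        calc _ ≤ ‖v‖ + ‖∫ s in t₀..t, B s (W s • w s)‖ := norm_add_le _ _
          _ ≤ W t * ‖v‖ + ‖w‖ / 2 * W t := add_le_add h2 h1
          _ = _ := by ring)
  have hT : ContractingWith (1 / 2) T := by
    refine ⟨by rw [← NNReal.coe_lt_coe]; norm_num, LipschitzWith.of_dist_le_mul fun w w' => ?_⟩
    rw [BoundedContinuousFunction.dist_le (by positivity)]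
    intro t
    have e : T w t - T w' t = (W t)⁻¹ • ∫ s in t₀..t, B s (W s • (w - w') s) := by
      simp only [T, BoundedContinuousFunction.coe_ofNormedAddCommGroup]
      rw [← smul_sub, add_sub_add_left_eq_sub, ← intervalIntegral.integral_sub
        ((hcont w).intervalIntegrable _ _) ((hcont w').intervalIntegrable _ _)]
      congr 2
      funext s
      rw [← map_sub, ← smul_sub, BoundedContinuousFunction.sub_apply]
    rw [dist_eq_norm, e, norm_smul, norm_inv, Real.norm_of_nonneg (hW0 t).le,
      inv_mul_le_iff₀ (hW0 t)]
    have h1 := norm_integral_le_cosh (hbound (w - w')) (norm_nonneg _) t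
    rw [dist_eq_norm]
    refine h1.trans (le_of_eq ?_)
    simp only [NNReal.coe_div, NNReal.coe_one, NNReal.coe_ofNat]
    ring
  set w := hT.fixedPoint T
  have hw : T w = w := hT.fixedPoint_isFixedPt
  have hu : ∀ t, W t • w t = v + ∫ s in t₀..t, B s (W s • w s) := by
    intro t
    conv_lhs => rw [← hw]
    simp only [T, BoundedContinuousFunction.coe_ofNormedAddCommGroup]
    rw [smul_smul, mul_inv_cancel₀ (hW0 t).ne', one_smul]
  refine ⟨fun t => W t • w t, (hu t₀).trans (by simp), fun t => ?_⟩
  have h1 := (intervalIntegral.integral_hasDerivAt_right ((hcont w).intervalIntegrable t₀ t)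
    (hcont w).aestronglyMeasurable.stronglyMeasurableAtFilter (hcont w).continuousAt).const_add v
  refine h1.congr_of_eventuallyEq (Eventually.of_forall fun s => hu s)

/-- Solutions of a linear differential equation with bounded coefficients are determined by their
value at one point. -/
theorem linear_ode_unique (B : ℝ → F →L[ℝ] F) {K : ℝ}
    (hK : ∀ t, ‖B t‖ ≤ K) {t₀ : ℝ} {u w : ℝ → F} (hu : ∀ t, HasDerivAt u (B t (u t)) t)
    (hw : ∀ t, HasDerivAt w (B t (w t)) t) (h0 : u t₀ = w t₀) : u = w := by
  refine ODE_solution_unique_univ (v := fun t x => B t x) (s := fun _ => univ) (K := K.toNNReal)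
    (fun t => ?_) (fun t => ⟨hu t, mem_univ _⟩) (fun t => ⟨hw t, mem_univ _⟩) h0
  refine LipschitzWith.lipschitzOnWith (LipschitzWith.of_dist_le_mul fun x y => ?_)
  rw [dist_eq_norm, ← map_sub, dist_eq_norm]
  exact (B t).le_of_opNorm_le ((hK t).trans (Real.le_coe_toNNReal K)) _

end LinearODE

end Bogoyavlenskij

namespace Bogoyavlenskij
open Set Filter Topology

/-! ### Indefinite integrals -/

section Primitives

variable {F G H : Type*} [NormedAddCommGroup F] [NormedSpace ℝ F]
  [NormedAddCommGroup G] [NormedSpace ℝ G] [NormedAddCommGroup H] [NormedSpace ℝ H]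

/-- `u` is an indefinite integral of the locally integrable function `v`; equivalently, `u` is
locally absolutely continuous with derivative `v` almost everywhere. -/
structure IsPrimitive (u v : ℝ → F) : Prop where
  locallyIntegrable : LocallyIntegrable v volume
  sub_eq : ∀ a b : ℝ, u b - u a = ∫ x in a..b, v x

theorem intervalIntegrable_of_locallyIntegrable {F : Type*} [NormedAddCommGroup F] {v : ℝ → F}
    (hv : LocallyIntegrable v volume)
    (a b : ℝ) : IntervalIntegrable v volume a b :=
  intervalIntegrable_iff.2 <|
    (hv.integrableOn_isCompact isCompact_uIcc).mono_set uIoc_subset_uIcc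

namespace IsPrimitive

theorem intervalIntegrable {u v : ℝ → F} (h : IsPrimitive u v) (a b : ℝ) :
    IntervalIntegrable v volume a b :=
  intervalIntegrable_of_locallyIntegrable h.locallyIntegrable a b

theorem eq_add {u v : ℝ → F} (h : IsPrimitive u v) (a : ℝ) :
    u = fun x => u a + ∫ t in a..x, v t := by
  funext x
  rw [← h.sub_eq]
  abel

protected theorem continuous {u v : ℝ → F} (h : IsPrimitive u v) : Continuous u := by
  rw [h.eq_add 0]
  exact continuous_const.add
    (intervalIntegral.continuous_primitive (fun a b => h.intervalIntegrable a b) 0)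

theorem ae_hasDerivAt [CompleteSpace F] {u v : ℝ → F} (h : IsPrimitive u v) :
    ∀ᵐ x, HasDerivAt u (v x) x := by
  filter_upwards [LocallyIntegrable.ae_hasDerivAt_integral h.locallyIntegrable] with x hx
  rw [h.eq_add 0]
  exact (hx 0).const_add _

theorem of_hasDerivAt [CompleteSpace F] {u v : ℝ → F} (h : ∀ x, HasDerivAt u (v x) x)
    (hv : Continuous v) : IsPrimitive u v :=
  ⟨hv.locallyIntegrable, fun a b => (intervalIntegral.integral_eq_sub_of_hasDerivAt
    (fun x _ => h x) (hv.intervalIntegrable a b)).symm⟩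

theorem hasDerivAt [CompleteSpace F] {u v : ℝ → F} (h : IsPrimitive u v) (hv : Continuous v)
    (x : ℝ) : HasDerivAt u (v x) x := by
  rw [h.eq_add 0]
  exact (intervalIntegral.integral_hasDerivAt_right (hv.intervalIntegrable 0 x)
    hv.aestronglyMeasurable.stronglyMeasurableAtFilter hv.continuousAt).const_add _

theorem congr_ae {u v w : ℝ → F} (h : IsPrimitive u v) (e : v =ᵐ[volume] w) :
    IsPrimitive u w :=
  ⟨h.locallyIntegrable.congr e, fun a b => by
    rw [h.sub_eq]
    exact intervalIntegral.integral_congr_ae (e.mono fun x hx _ => hx)⟩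

theorem congr {u u' v v' : ℝ → F} (h : IsPrimitive u v) (hu : ∀ x, u x = u' x)
    (hv : ∀ x, v x = v' x) : IsPrimitive u' v' := by
  rwa [← funext hu, ← funext hv]

theorem add {u v u' v' : ℝ → F} (h : IsPrimitive u v) (h' : IsPrimitive u' v') :
    IsPrimitive (fun x => u x + u' x) (fun x => v x + v' x) :=
  ⟨h.locallyIntegrable.add h'.locallyIntegrable, fun a b => by
    rw [intervalIntegral.integral_add (h.intervalIntegrable a b) (h'.intervalIntegrable a b),
      ← h.sub_eq, ← h'.sub_eq]
    abel⟩

theorem clm_comp [CompleteSpace F] [CompleteSpace G] {u v : ℝ → F} (h : IsPrimitive u v)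
    (A : F →L[ℝ] G) : IsPrimitive (fun x => A (u x)) (fun x => A (v x)) :=
  ⟨fun x => by
    obtain ⟨s, hs, hi⟩ := h.locallyIntegrable x
    exact ⟨s, hs, A.integrable_comp hi⟩, fun a b => by
    rw [A.intervalIntegral_comp_comm (h.intervalIntegrable a b), ← h.sub_eq, map_sub]⟩

theorem sub [CompleteSpace F] {u v u' v' : ℝ → F} (h : IsPrimitive u v)
    (h' : IsPrimitive u' v') : IsPrimitive (fun x => u x - u' x) (fun x => v x - v' x) :=
  (h.add (h'.clm_comp (-ContinuousLinearMap.id ℝ F))).congr (fun x => by simp [sub_eq_add_neg])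
    (fun x => by simp [sub_eq_add_neg])

theorem prodMk [CompleteSpace F] [CompleteSpace G] {u v : ℝ → F} {u' v' : ℝ → G}
    (h : IsPrimitive u v) (h' : IsPrimitive u' v') :
    IsPrimitive (fun x => (u x, u' x)) (fun x => (v x, v' x)) :=
  ((h.clm_comp (ContinuousLinearMap.inl ℝ F G)).add
    (h'.clm_comp (ContinuousLinearMap.inr ℝ F G))).congr (fun x => by simp) (fun x => by simp)

end IsPrimitive

theorem absolutelyContinuousOnInterval_of_dist_le {F : Type*} [NormedAddCommGroup F]
    {f : ℝ → F} {g : ℝ → ℝ} {a b : ℝ}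
    (hg : AbsolutelyContinuousOnInterval g a b)
    (h : ∀ s ∈ uIcc a b, ∀ t ∈ uIcc a b, dist (f s) (f t) ≤ dist (g s) (g t)) :
    AbsolutelyContinuousOnInterval f a b := by
  rw [absolutelyContinuousOnInterval_iff] at hg ⊢
  intro ε hε
  obtain ⟨δ, hδ, H⟩ := hg ε hε
  refine ⟨δ, hδ, fun E hE hs => lt_of_le_of_lt (Finset.sum_le_sum fun i hi => ?_) (H E hE hs)⟩
  exact h _ (hE.1 i hi).1 _ (hE.1 i hi).2

theorem _root_.MeasureTheory.LocallyIntegrable.bilin_left {B : F → G → H}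
    (hB : IsBoundedBilinearMap ℝ fun p : F × G => B p.1 p.2) {u : ℝ → F} {v : ℝ → G}
    (hu : Continuous u) (hv : LocallyIntegrable v volume) :
    LocallyIntegrable (fun x => B (u x) (v x)) volume := by
  rw [locallyIntegrable_iff]
  intro k hk
  obtain ⟨C, hC0, hC⟩ := hB.bound
  obtain ⟨D, hD⟩ := hk.exists_bound_of_continuousOn hu.continuousOn
  have hvk := hv.integrableOn_isCompact hk
  refine Integrable.mono' (g := fun x => C * D * ‖v x‖) (hvk.norm.const_mul _) ?_ ?_
  · exact hB.continuous.comp_aestronglyMeasurable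
      (hu.aestronglyMeasurable.prodMk hvk.aestronglyMeasurable)
  · refine (ae_restrict_iff' hk.measurableSet).2 (Eventually.of_forall fun x hx => ?_)
    refine (hC (u x) (v x)).trans ?_
    gcongr
    exact hD x hx

/-- The product rule for indefinite integrals. The difference of the two sides is absolutely
continuous with vanishing derivative almost everywhere. -/
theorem IsPrimitive.bilin [CompleteSpace F] [CompleteSpace G] [CompleteSpace H] {B : F → G → H}
    (hB : IsBoundedBilinearMap ℝ fun p : F × G => B p.1 p.2)
    {u u' : ℝ → F} {v v' : ℝ → G} (hu : IsPrimitive u u') (hv : IsPrimitive v v') :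
    IsPrimitive (fun x => B (u x) (v x)) (fun x => B (u x) (v' x) + B (u' x) (v x)) := by
  have hB' : IsBoundedBilinearMap ℝ fun p : G × F => B p.2 p.1 :=
    { add_left := fun x₁ x₂ y => hB.add_right y x₁ x₂
      smul_left := fun c x y => hB.smul_right c y x
      add_right := fun x y₁ y₂ => hB.add_left y₁ y₂ x
      smul_right := fun c x y => hB.smul_left c y x
      bound := by
        obtain ⟨C, hC0, hC⟩ := hB.bound
        exact ⟨C, hC0, fun x y => (hC y x).trans (le_of_eq (by ring))⟩ }
  set w : ℝ → H := fun x => B (u x) (v' x) + B (u' x) (v x) with hw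
  have hwi : LocallyIntegrable w volume :=
    (LocallyIntegrable.bilin_left hB hu.continuous hv.locallyIntegrable).add
      (LocallyIntegrable.bilin_left (B := fun y x => B x y) hB' hv.continuous hu.locallyIntegrable)
  refine ⟨hwi, fun a b => ?_⟩
  have hwI := fun s t => intervalIntegrable_of_locallyIntegrable hwi s t
  set f : ℝ → H := fun x => B (u x) (v x) - ∫ t in a..x, w t with hf
  have hder : ∀ᵐ x, HasDerivAt f 0 x := by
    filter_upwards [hu.ae_hasDerivAt, hv.ae_hasDerivAt,
      LocallyIntegrable.ae_hasDerivAt_integral hwi] with x h1 h2 h3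
    have h4 : HasDerivAt (fun x => B (u x) (v x)) (w x) x :=
      HasFDerivAt.comp_hasDerivAt (f := fun x => (u x, v x)) x (hB.hasFDerivAt (u x, v x))
        (h1.prodMk h2)
    exact (h4.sub (h3 a)).congr_deriv (sub_self _)
  obtain ⟨C, hC0, hC⟩ := hB.bound
  obtain ⟨D, hD⟩ := (isCompact_uIcc (a := a) (b := b)).exists_bound_of_continuousOn
    hu.continuous.continuousOn
  obtain ⟨E, hE⟩ := (isCompact_uIcc (a := a) (b := b)).exists_bound_of_continuousOn
    hv.continuous.continuousOn
  have hD0 : 0 ≤ D := (norm_nonneg _).trans (hD a left_mem_uIcc)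
  have hE0 : 0 ≤ E := (norm_nonneg _).trans (hE a left_mem_uIcc)
  set g : ℝ → ℝ := fun x => C * D * ‖v' x‖ + C * E * ‖u' x‖ + ‖w x‖ with hg
  have i1 := fun s t => (hv.intervalIntegrable s t).norm.const_mul (C * D)
  have i2 := fun s t => (hu.intervalIntegrable s t).norm.const_mul (C * E)
  have i3 := fun s t => (hwI s t).norm
  have hgI : ∀ s t, IntervalIntegrable g volume s t :=
    fun s t => ((i1 s t).add (i2 s t)).add (i3 s t)
  have hgAC := (hgI a b).absolutelyContinuousOnInterval_intervalIntegral (c := a) left_mem_uIcc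
  have key : ∀ s ∈ uIcc a b, ∀ t ∈ uIcc a b, s ≤ t → dist (f s) (f t) ≤ ∫ x in s..t, g x := by
    intro s hs t ht hst
    have e1 : B (u t) (v t) - B (u s) (v s) = B (u t) (v t - v s) + B (u t - u s) (v s) := by
      have e2 := hB.map_sub_right (x := u t) (y := v t) (z := v s)
      have e3 := hB.map_sub_left (x := u t) (y := u s) (z := v s)
      simp only at e2 e3
      rw [e2, e3]
      abel
    have e4 : f t - f s = (B (u t) (v t - v s) + B (u t - u s) (v s)) - ∫ x in s..t, w x := by
      rw [← e1, ← intervalIntegral.integral_interval_sub_left (hwI a t) (hwI a s)]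
      simp only [hf]
      abel
    have nv : ‖v t - v s‖ ≤ ∫ x in s..t, ‖v' x‖ := by
      rw [hv.sub_eq]
      exact intervalIntegral.norm_integral_le_integral_norm hst
    have nu : ‖u t - u s‖ ≤ ∫ x in s..t, ‖u' x‖ := by
      rw [hu.sub_eq]
      exact intervalIntegral.norm_integral_le_integral_norm hst
    have nw : ‖∫ x in s..t, w x‖ ≤ ∫ x in s..t, ‖w x‖ :=
      intervalIntegral.norm_integral_le_integral_norm hst
    rw [dist_comm, dist_eq_norm, e4, hg,
      intervalIntegral.integral_add ((i1 s t).add (i2 s t)) (i3 s t),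
      intervalIntegral.integral_add (i1 s t) (i2 s t),
      intervalIntegral.integral_const_mul, intervalIntegral.integral_const_mul]
    have b1 : ‖B (u t) (v t - v s)‖ ≤ C * D * ∫ x in s..t, ‖v' x‖ := by
      refine (hC _ _).trans ?_
      gcongr
      exact hD t ht
    have b2 : ‖B (u t - u s) (v s)‖ ≤ C * E * ∫ x in s..t, ‖u' x‖ := by
      refine (hC _ _).trans ?_
      calc C * ‖u t - u s‖ * ‖v s‖ ≤ C * (∫ x in s..t, ‖u' x‖) * E := by
            gcongr
            · exact mul_nonneg hC0.le ((norm_nonneg _).trans nu)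
            · exact hE s hs
        _ = _ := by ring
    exact (norm_sub_le _ _).trans (add_le_add ((norm_add_le _ _).trans (add_le_add b1 b2)) nw)
  have hfAC : AbsolutelyContinuousOnInterval f a b := by
    refine absolutelyContinuousOnInterval_of_dist_le hgAC fun s hs t ht => ?_
    have e : ∀ s t, dist (∫ x in a..s, g x) (∫ x in a..t, g x) = |∫ x in s..t, g x| := by
      intro s t
      rw [dist_comm, Real.dist_eq, intervalIntegral.integral_interval_sub_left (hgI a t) (hgI a s)]
    rcases le_total s t with hst | hst
    · rw [e]
      exact (key s hs t ht hst).trans (le_abs_self _)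
    · rw [dist_comm, dist_comm (∫ x in a..s, g x), e]
      exact (key t ht s hs hst).trans (le_abs_self _)
  obtain ⟨c, hc⟩ := hfAC.const_of_ae_hasDerivAt_zero (hder.mono fun x hx _ => hx)
  have h1 := hc a left_mem_uIcc
  have h2 := hc b right_mem_uIcc
  simp only [hf, intervalIntegral.integral_same, sub_zero] at h1 h2
  rw [h1, ← h2]
  abel

/-- If an indefinite integral and its derivative are both integrable over the line, then it
vanishes at both ends, so the derivative has integral zero. -/
theorem IsPrimitive.integral_eq_zero [CompleteSpace F] {u v : ℝ → F} (h : IsPrimitive u v)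
    (hu : Integrable u volume) (hv : Integrable v volume) : ∫ x, v x = 0 := by
  have htop : Tendsto u atTop (𝓝 (u 0 + ∫ x in Ioi 0, v x)) := by
    have h1 := intervalIntegral_tendsto_integral_Ioi 0 hv.integrableOn tendsto_id
    rw [h.eq_add 0]
    simpa using h1.const_add (u 0)
  have hbot : Tendsto u atBot (𝓝 (u 0 - ∫ x in Iic 0, v x)) := by
    have h1 := intervalIntegral_tendsto_integral_Iic 0 hv.integrableOn tendsto_id
    have e : u = fun x => u 0 - ∫ t in x..0, v t := by
      funext x
      rw [← h.sub_eq]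
      abel
    rw [e]
    simpa using h1.const_sub (u 0 - ∫ t in (0 : ℝ)..0, v t)
  have e1 : u 0 + ∫ x in Ioi 0, v x = 0 := by
    refine IntegrableAtFilter.eq_zero_of_tendsto ⟨univ, univ_mem, hu.integrableOn⟩
      (fun s hs => ?_) htop
    obtain ⟨b, hb⟩ := mem_atTop_sets.1 hs
    rw [← top_le_iff, ← Real.volume_Ici (a := b)]
    exact measure_mono hb
  have e2 : u 0 - ∫ x in Iic 0, v x = 0 := by
    refine IntegrableAtFilter.eq_zero_of_tendsto ⟨univ, univ_mem, hu.integrableOn⟩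
      (fun s hs => ?_) hbot
    obtain ⟨b, hb⟩ := mem_atBot_sets.1 hs
    rw [← top_le_iff, ← Real.volume_Iic (a := b)]
    exact measure_mono hb
  rw [← intervalIntegral.integral_Iic_add_Ioi hv.integrableOn hv.integrableOn (b := 0),
    ← sub_eq_zero.1 e2, add_comm, ← e1]
  abel

/-- A function is controlled on unit intervals together with its first derivative by the function
itself and its second derivative. -/
theorem norm_deriv_le [CompleteSpace F] {ψ χ h : ℝ → F} (hψ : ∀ x, HasDerivAt ψ (χ x) x)
    (hχ : IsPrimitive χ h) (x : ℝ) :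
    ‖χ x‖ ≤ ‖ψ (x + 1)‖ + ‖ψ x‖ + ∫ t in x..x + 1, ‖h t‖ := by
  have h0 : IsPrimitive ψ χ := IsPrimitive.of_hasDerivAt hψ hχ.continuous
  have e : χ x = ψ (x + 1) - ψ x - ∫ t in x..x + 1, (χ t - χ x) := by
    rw [intervalIntegral.integral_sub (h0.intervalIntegrable _ _) (by simp), ← h0.sub_eq]
    simp
  have b : ‖∫ t in x..x + 1, (χ t - χ x)‖ ≤ ∫ t in x..x + 1, ‖h t‖ := by
    have := intervalIntegral.norm_integral_le_of_norm_le_const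
      (f := fun t => χ t - χ x) (a := x) (b := x + 1) (C := ∫ t in x..x + 1, ‖h t‖) ?_
    · simpa using this
    · intro t ht
      rw [uIoc_of_le (by linarith)] at ht
      rw [hχ.sub_eq]
      refine (intervalIntegral.norm_integral_le_integral_norm ht.1.le).trans ?_
      exact intervalIntegral.integral_mono_interval le_rfl ht.1.le ht.2
        (Eventually.of_forall fun s => norm_nonneg _) (hχ.intervalIntegrable _ _).norm
  rw [e]
  exact (norm_sub_le _ _).trans (add_le_add (norm_sub_le _ _) b)

theorem norm_deriv_le_of_bounded [CompleteSpace F] {ψ χ h : ℝ → F}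
    (hψ : ∀ x, HasDerivAt ψ (χ x) x) (hχ : IsPrimitive χ h) {C D : ℝ} (hC : ∀ x, ‖ψ x‖ ≤ C)
    (hD : ∀ x, ‖h x‖ ≤ D) (x : ℝ) : ‖χ x‖ ≤ C + C + D := by
  refine (norm_deriv_le hψ hχ x).trans (add_le_add (add_le_add (hC _) (hC _)) ?_)
  have := intervalIntegral.norm_integral_le_of_norm_le_const
      (f := fun t => ‖h t‖) (a := x) (b := x + 1) (C := D) (fun t _ => by simpa using hD t)
  exact (le_abs_self _).trans (by simpa using this)

end Primitives

end Bogoyavlenskij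

namespace Bogoyavlenskij
open Set Filter Topology
open scoped ContDiff

/-! ### Square integrability of the derivative -/

section SquareIntegrable

theorem integrable_integral_unit_interval {q : ℝ → ℝ} (hq : Integrable q volume) :
    Integrable (fun x => ∫ t in x..x + 1, q t) volume := by
  have hi : Integrable (indicator (Icc (-1 : ℝ) 0) fun _ => (1 : ℝ)) volume :=
    (integrable_indicator_iff measurableSet_Icc).2 (by simp)
  have h := hq.integrable_convolution (ContinuousLinearMap.mul ℝ ℝ) hi
  refine h.congr (Eventually.of_forall fun x => ?_)
  simp only [convolution, ContinuousLinearMap.mul_apply']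
  rw [intervalIntegral.integral_of_le (by linarith), ← integral_Icc_eq_integral_Ioc,
    ← integral_indicator measurableSet_Icc]
  congr 1
  funext t
  have : x - t ∈ Icc (-1 : ℝ) 0 ↔ t ∈ Icc x (x + 1) := by
    simp only [mem_Icc]
    constructor <;> rintro ⟨h1, h2⟩ <;> constructor <;> linarith
  by_cases ht : t ∈ Icc x (x + 1)
  · rw [indicator_of_mem ht, indicator_of_mem (this.2 ht), mul_one]
  · rw [indicator_of_notMem ht, indicator_of_notMem (fun h => ht (this.1 h)), mul_zero]

theorem sq_integral_unit_interval_le {g : ℝ → ℝ} {x : ℝ}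
    (hg : IntervalIntegrable g volume x (x + 1))
    (hg2 : IntervalIntegrable (fun t => g t ^ 2) volume x (x + 1)) :
    (∫ t in x..x + 1, g t) ^ 2 ≤ ∫ t in x..x + 1, g t ^ 2 := by
  set k := ∫ t in x..x + 1, g t with hk
  have h0 : 0 ≤ ∫ t in x..x + 1, (g t - k) ^ 2 :=
    intervalIntegral.integral_nonneg (by linarith) fun t _ => sq_nonneg _
  have e : ∫ t in x..x + 1, (g t - k) ^ 2 = (∫ t in x..x + 1, g t ^ 2) - k ^ 2 := by
    have e1 : ∀ t, (g t - k) ^ 2 = g t ^ 2 - 2 * k * g t + k ^ 2 := fun t => by ring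
    simp_rw [e1]
    rw [intervalIntegral.integral_add (hg2.sub (hg.const_mul _)) (by simp),
      intervalIntegral.integral_sub hg2 (hg.const_mul _), intervalIntegral.integral_const_mul,
      ← hk]
    simp
    ring
  linarith

variable {F : Type*} [NormedAddCommGroup F] [NormedSpace ℝ F]

theorem memLp_integral_unit_interval {F : Type*} [NormedAddCommGroup F] {h : ℝ → F}
    (hh : MemLp h 2 volume) :
    MemLp (fun x => ∫ t in x..x + 1, ‖h t‖) 2 volume := by
  have hl : LocallyIntegrable (fun t => ‖h t‖) volume :=
    (hh.norm.locallyIntegrable (by norm_num))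
  have hq : Integrable (fun t => ‖h t‖ ^ 2) volume := hh.integrable_norm_pow (by norm_num)
  have hc : Continuous fun x => ∫ t in x..x + 1, ‖h t‖ := by
    have h1 := intervalIntegral.continuous_primitive
      (fun a b => intervalIntegrable_of_locallyIntegrable hl a b) 0
    have e : (fun x : ℝ => ∫ t in x..x + 1, ‖h t‖)
        = fun x => (∫ t in (0 : ℝ)..x + 1, ‖h t‖) - ∫ t in (0 : ℝ)..x, ‖h t‖ := by
      funext x
      rw [intervalIntegral.integral_interval_sub_left] <;>
        exact intervalIntegrable_of_locallyIntegrable hl _ _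
    rw [e]
    exact (h1.comp (continuous_add_const 1)).sub h1
  rw [memLp_two_iff_integrable_sq hc.aestronglyMeasurable]
  refine (integrable_integral_unit_interval hq).mono' (hc.pow 2).aestronglyMeasurable
    (Eventually.of_forall fun x => ?_)
  rw [Real.norm_of_nonneg (sq_nonneg _)]
  exact sq_integral_unit_interval_le (intervalIntegrable_of_locallyIntegrable hl _ _)
    (intervalIntegrable_of_locallyIntegrable hq.locallyIntegrable _ _)

/-- If `ψ` and `ψ''` are square integrable, so is `ψ'`. -/
theorem memLp_deriv [CompleteSpace F] {ψ χ h : ℝ → F} (hψ : ∀ x, HasDerivAt ψ (χ x) x)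
    (hχ : IsPrimitive χ h) (mψ : MemLp ψ 2 volume) (mh : MemLp h 2 volume) :
    MemLp χ 2 volume := by
  have m1 : MemLp (fun x => ‖ψ (x + 1)‖) 2 volume :=
    (mψ.comp_measurePreserving (measurePreserving_add_right volume 1)).norm
  refine ((m1.add mψ.norm).add (memLp_integral_unit_interval mh)).of_le
    hχ.continuous.aestronglyMeasurable (Eventually.of_forall fun x => ?_)
  refine (norm_deriv_le hψ hχ x).trans (le_abs_self _)

end SquareIntegrable

/-! ### Weak derivatives -/

section WeakDerivative

variable {F : Type*} [NormedAddCommGroup F] [NormedSpace ℝ F]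

/-- Integration by parts against a compactly supported function. -/
theorem IsPrimitive.integral_deriv_smul [CompleteSpace F] {φ : ℝ → ℝ} (hφ : ContDiff ℝ ∞ φ)
    (hc : HasCompactSupport φ) {v v' : ℝ → F} (hv : IsPrimitive v v') :
    ∫ x, deriv φ x • v x = -∫ x, φ x • v' x := by
  have hφ' : Continuous (deriv φ) := hφ.continuous_deriv (by simp)
  have hp : IsPrimitive φ (deriv φ) := IsPrimitive.of_hasDerivAt
    (fun x => ((hφ.differentiable (by simp)) x).hasDerivAt) hφ'
  have i1 : Integrable (fun x => φ x • v' x) volume :=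
    hv.locallyIntegrable.integrable_smul_left_of_hasCompactSupport hφ.continuous hc
  have i2 : Integrable (fun x => deriv φ x • v x) volume :=
    hv.continuous.locallyIntegrable.integrable_smul_left_of_hasCompactSupport hφ' hc.deriv
  have i3 : Integrable (fun x => φ x • v x) volume :=
    hv.continuous.locallyIntegrable.integrable_smul_left_of_hasCompactSupport hφ.continuous hc
  have h := (hp.bilin (B := fun (c : ℝ) (x : F) => c • x) isBoundedBilinearMap_smul hv)
    |>.integral_eq_zero i3 (i1.add i2)
  rw [integral_add i1 i2] at h
  exact eq_neg_of_add_eq_zero_right h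

/-- A test function with integral zero is the derivative of a test function. -/
theorem exists_test_primitive {w : ℝ → ℝ} (hw : ContDiff ℝ ∞ w) (hc : HasCompactSupport w)
    (h0 : ∫ x, w x = 0) :
    ∃ φ : ℝ → ℝ, ContDiff ℝ ∞ φ ∧ HasCompactSupport φ ∧ deriv φ = w := by
  obtain ⟨r, hr⟩ := hc.isBounded.subset_closedBall 0
  rw [Real.closedBall_eq_Icc, zero_sub, zero_add] at hr
  obtain ⟨R, hR⟩ : ∃ R : ℝ, r < R := exists_gt r
  have hz : ∀ x, x ∉ Ioc (-R) R → w x = 0 := fun x hx =>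
    image_eq_zero_of_notMem_tsupport fun h => hx ⟨by linarith [(hr h).1], by linarith [(hr h).2]⟩
  have hd : ∀ x, HasDerivAt (fun x => ∫ t in (-R)..x, w t) (w x) x := fun x =>
    intervalIntegral.integral_hasDerivAt_right (hw.continuous.intervalIntegrable _ x)
      hw.continuous.aestronglyMeasurable.stronglyMeasurableAtFilter hw.continuous.continuousAt
  have hd' : deriv (fun x => ∫ t in (-R)..x, w t) = w := funext fun x => (hd x).deriv
  refine ⟨fun x => ∫ t in (-R)..x, w t, ?_, ?_, hd'⟩
  · rw [contDiff_infty_iff_deriv, hd']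
    exact ⟨fun x => (hd x).differentiableAt, hw⟩
  · refine HasCompactSupport.intro (isCompact_Icc (a := -R) (b := R)) fun x hx => ?_
    rw [mem_Icc, not_and_or, not_le, not_le] at hx
    rcases hx with hx | hx
    · have e : EqOn w (fun _ => 0) (uIcc (-R) x) := by
        intro t ht
        rw [uIcc_of_ge hx.le] at ht
        exact hz t fun h => absurd h.1 (not_lt.2 ht.2)
      rw [intervalIntegral.integral_congr e, intervalIntegral.integral_zero]
    · rw [intervalIntegral.integral_eq_integral_of_support_subset, h0]
      intro t ht
      by_contra h
      exact ht (hz t fun h' => h ⟨h'.1, h'.2.trans hx.le⟩)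

theorem exists_test_integral_eq_one :
    ∃ ρ : ℝ → ℝ, ContDiff ℝ ∞ ρ ∧ HasCompactSupport ρ ∧ ∫ x, ρ x = 1 := by
  let b : ContDiffBump (0 : ℝ) := ⟨1, 2, one_pos, one_lt_two⟩
  exact ⟨b.normed volume, b.contDiff_normed, b.hasCompactSupport_normed, b.integral_normed⟩

theorem integral_test_smul {η ρ : ℝ → ℝ} {u : ℝ → F} (hu : LocallyIntegrable u volume)
    (hη : Continuous η) (cη : HasCompactSupport η) (hρ : Continuous ρ)
    (cρ : HasCompactSupport ρ) (c : ℝ) :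
    ∫ x, (η x - c * ρ x) • u x = (∫ x, η x • u x) - c • ∫ x, ρ x • u x := by
  have i1 := hu.integrable_smul_left_of_hasCompactSupport hη cη
  have i2 : Integrable (fun x => c • ρ x • u x) volume :=
    (hu.integrable_smul_left_of_hasCompactSupport hρ cρ).smul c
  simp only [sub_smul, mul_smul]
  rw [integral_sub i1 i2, integral_smul]

theorem ae_eq_const_of_weak_deriv_eq_zero [CompleteSpace F] {u : ℝ → F}
    (hu : LocallyIntegrable u volume)
    (h : ∀ φ : ℝ → ℝ, ContDiff ℝ ∞ φ → HasCompactSupport φ → ∫ x, deriv φ x • u x = 0) :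
    ∃ c : F, ∀ᵐ x, u x = c := by
  obtain ⟨ρ, hρ, cρ, iρ⟩ := exists_test_integral_eq_one
  refine ⟨∫ x, ρ x • u x, ae_eq_of_integral_contDiff_smul_eq hu (locallyIntegrable_const _)
    fun η hη cη => ?_⟩
  obtain ⟨φ, hφ, cφ, e⟩ := exists_test_primitive (w := fun x => η x - (∫ x, η x) * ρ x)
    (hη.sub (contDiff_const.mul hρ)) (cη.sub cρ.mul_left) (by
      rw [integral_sub (hη.continuous.integrable_of_hasCompactSupport cη)
        ((hρ.continuous.integrable_of_hasCompactSupport cρ).const_mul _), integral_const_mul, iρ,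
        mul_one, sub_self])
  have h1 := h φ hφ cφ
  rw [e, integral_test_smul hu hη.continuous cη hρ.continuous cρ, sub_eq_zero] at h1
  rw [h1, integral_smul_const]

/-- A function whose second derivative in the sense of distributions is a locally integrable
function `h` agrees almost everywhere with a twice integrated `h`. -/
theorem exists_primitives_of_weak_second_deriv [CompleteSpace F] {y h : ℝ → F}
    (hy : LocallyIntegrable y volume) (hh : LocallyIntegrable h volume)
    (H : ∀ φ : ℝ → ℝ, ContDiff ℝ ∞ φ → HasCompactSupport φ →
      ∫ x, deriv (deriv φ) x • y x = ∫ x, φ x • h x) :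
    ∃ ψ χ : ℝ → F, y =ᵐ[volume] ψ ∧ (∀ x, HasDerivAt ψ (χ x) x) ∧ IsPrimitive χ h := by
  have hχ : IsPrimitive (fun x => ∫ t in (0 : ℝ)..x, h t) h := ⟨hh, fun a b =>
    intervalIntegral.integral_interval_sub_left (intervalIntegrable_of_locallyIntegrable hh _ _)
      (intervalIntegrable_of_locallyIntegrable hh _ _)⟩
  set χ₀ : ℝ → F := fun x => ∫ t in (0 : ℝ)..x, h t
  have hψ : IsPrimitive (fun x => ∫ t in (0 : ℝ)..x, χ₀ t) χ₀ :=
    ⟨hχ.continuous.locallyIntegrable, fun a b => intervalIntegral.integral_interval_sub_left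
      (hχ.continuous.intervalIntegrable _ _) (hχ.continuous.intervalIntegrable _ _)⟩
  set ψ₀ : ℝ → F := fun x => ∫ t in (0 : ℝ)..x, χ₀ t
  have hdd : ∀ {φ : ℝ → ℝ}, ContDiff ℝ ∞ φ → ContDiff ℝ ∞ (deriv φ) :=
    fun hφ => (contDiff_infty_iff_deriv.1 hφ).2
  have hu : LocallyIntegrable (fun x => y x - ψ₀ x) volume :=
    hy.sub hψ.continuous.locallyIntegrable
  have H2 : ∀ φ : ℝ → ℝ, ContDiff ℝ ∞ φ → HasCompactSupport φ →
      ∫ x, deriv (deriv φ) x • (y x - ψ₀ x) = 0 := by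
    intro φ hφ cφ
    have i1 := hy.integrable_smul_left_of_hasCompactSupport (hdd (hdd hφ)).continuous
      cφ.deriv.deriv
    have i2 := (hψ.continuous.locallyIntegrable
      (μ := volume)).integrable_smul_left_of_hasCompactSupport (hdd (hdd hφ)).continuous
      cφ.deriv.deriv
    simp_rw [smul_sub]
    rw [integral_sub i1 i2, H φ hφ cφ, hψ.integral_deriv_smul (hdd hφ) cφ.deriv,
      hχ.integral_deriv_smul hφ cφ]
    simp
  obtain ⟨ρ, hρ, cρ, iρ⟩ := exists_test_integral_eq_one
  set c₁ : F := ∫ x, deriv ρ x • (y x - ψ₀ x)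
  have hlin : IsPrimitive (fun x : ℝ => x • c₁) fun _ => c₁ :=
    IsPrimitive.of_hasDerivAt (fun x => by simpa using (hasDerivAt_id x).smul_const c₁)
      continuous_const
  obtain ⟨c, hc⟩ := ae_eq_const_of_weak_deriv_eq_zero
    (u := fun x => (y x - ψ₀ x) + x • c₁)
    (hu.add hlin.continuous.locallyIntegrable) (by
      intro η hη cη
      obtain ⟨φ, hφ, cφ, e⟩ := exists_test_primitive (w := fun x => η x - (∫ x, η x) * ρ x)
        (hη.sub (contDiff_const.mul hρ)) (cη.sub cρ.mul_left) (by
          rw [integral_sub (hη.continuous.integrable_of_hasCompactSupport cη)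
            ((hρ.continuous.integrable_of_hasCompactSupport cρ).const_mul _), integral_const_mul,
            iρ, mul_one, sub_self])
      have h1 := H2 φ hφ cφ
      have e2 : deriv (deriv φ) = fun x => deriv η x - (∫ x, η x) * deriv ρ x := by
        rw [e]
        funext x
        have d1 := ((hη.differentiable (by simp)) x).hasDerivAt
        have d2 := ((hρ.differentiable (by simp)) x).hasDerivAt
        exact (d1.sub (d2.const_mul _)).deriv
      rw [e2, integral_test_smul hu (hdd hη).continuous cη.deriv (hdd hρ).continuous cρ.deriv,
        sub_eq_zero] at h1
      simp_rw [smul_add]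
      rw [integral_add (hu.integrable_smul_left_of_hasCompactSupport (hdd hη).continuous cη.deriv)
        ((hlin.continuous.locallyIntegrable (μ := volume)).integrable_smul_left_of_hasCompactSupport
          (hdd hη).continuous cη.deriv), h1, hlin.integral_deriv_smul hη cη, integral_smul_const]
      exact add_neg_cancel _)
  refine ⟨fun x => c + ψ₀ x - x • c₁, fun x => χ₀ x - c₁, ?_, fun x => ?_, hχ.locallyIntegrable,
    fun a b => ?_⟩
  · filter_upwards [hc] with x hx
    rw [← hx]
    abel
  · exact ((hψ.hasDerivAt hχ.continuous x).const_add c).sub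
      (by simpa using (hasDerivAt_id x).smul_const c₁)
  · rw [sub_sub_sub_cancel_right]
    exact hχ.sub_eq a b

end WeakDerivative

end Bogoyavlenskij

namespace Bogoyavlenskij
open Filter Topology Matrix

/-! ### Conservation laws and bounds for solutions of the system -/

variable {d : ℕ}

namespace IsTopSolution

variable {J : Fin d → ℝ} {Ω M P : ℝ → RMat d}

theorem momentum_apply (h : IsTopSolution J Ω M P) (t : ℝ) (i j : Fin d) :
    M t i j = (J i + J j) * Ω t i j := by
  rw [h.momentum t, Matrix.add_apply, Matrix.diagonal_mul, Matrix.mul_diagonal]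
  ring

theorem hasDerivAt_velocity (hJ : ∀ i, 0 < J i) (h : IsTopSolution J Ω M P) (t : ℝ)
    (i j : Fin d) : HasDerivAt (fun s => Ω s i j) (matDeriv Ω t i j) t := by
  have hne : J i + J j ≠ 0 := (add_pos (hJ i) (hJ j)).ne'
  have e : (fun s => Ω s i j) = fun s => M s i j / (J i + J j) := by
    funext s
    rw [h.momentum_apply, mul_div_cancel_left₀ _ hne]
  have hd : DifferentiableAt ℝ (fun s => Ω s i j) t := by
    rw [e]
    exact ((h.deriv_M t i j).div_const _).differentiableAt
  exact hd.hasDerivAt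

/-- The derivative of `M = J Ω + Ω J`, in terms of `Ω'`. -/
theorem momentum_deriv (hJ : ∀ i, 0 < J i) (h : IsTopSolution J Ω M P) (t : ℝ) :
    diagonal J * matDeriv Ω t + matDeriv Ω t * diagonal J =
      M t * Ω t - Ω t * M t - (P t * diagonal J - diagonal J * P t) := by
  ext i j
  have h1 := (h.hasDerivAt_velocity hJ t i j).const_mul (J i + J j)
  have e : (fun s => (J i + J j) * Ω s i j) = fun s => M s i j :=
    funext fun s => (h.momentum_apply s i j).symm
  rw [e] at h1
  rw [← h1.unique (h.deriv_M t i j), Matrix.add_apply, Matrix.diagonal_mul, Matrix.mul_diagonal]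
  ring

theorem matDeriv_skew (hJ : ∀ i, 0 < J i) (h : IsTopSolution J Ω M P) (t : ℝ) :
    (matDeriv Ω t)ᵀ = -matDeriv Ω t := by
  ext i j
  have e : (fun s => Ω s j i) = fun s => -Ω s i j :=
    funext fun s => congrFun (congrFun (h.skew s) i) j
  have h1 := h.hasDerivAt_velocity hJ t j i
  rw [e] at h1
  exact h1.unique (h.hasDerivAt_velocity hJ t i j).neg

theorem momentum_skew (h : IsTopSolution J Ω M P) (t : ℝ) : (M t)ᵀ = -M t := by
  rw [h.momentum, transpose_add, transpose_mul, transpose_mul, h.skew, diagonal_transpose]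
  noncomm_ring

/-- The symmetry of `U` with respect to the inner product with weight `J`. -/
theorem diagonal_mul_topPotential (hJ : ∀ i, 0 < J i) (h : IsTopSolution J Ω M P) (t : ℝ) :
    diagonal J * topPotential Ω P t = (topPotential Ω P t)ᵀ * diagonal J := by
  have e := h.momentum_deriv hJ t
  rw [h.momentum t] at e
  rw [topPotential, transpose_add, transpose_sub, transpose_pow, h.skew, h.symm,
    h.matDeriv_skew hJ t]
  rw [← sub_eq_zero] at e ⊢
  rw [← neg_eq_zero, ← e]
  noncomm_ring

theorem conjPotential_transpose (hJ : ∀ i, 0 < J i) (h : IsTopSolution J Ω M P) (t : ℝ) :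
    (conjPotential J (topPotential Ω P) t)ᵀ = conjPotential J (topPotential Ω P) t := by
  have hs : ∀ i, Real.sqrt (J i) ≠ 0 := fun i => (Real.sqrt_pos.2 (hJ i)).ne'
  have hS : IsUnit (sqrtJ J).det := by
    rw [sqrtJ, det_diagonal, isUnit_iff_ne_zero]
    exact Finset.prod_ne_zero_iff.2 fun i _ => hs i
  have hT : (sqrtJ J)ᵀ = sqrtJ J := diagonal_transpose _
  have hSS : sqrtJ J * sqrtJ J = diagonal J := by
    rw [sqrtJ, diagonal_mul_diagonal]
    congr 1
    funext i
    exact Real.mul_self_sqrt (hJ i).le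
  have e := h.diagonal_mul_topPotential hJ t
  rw [← hSS] at e
  rw [conjPotential, transpose_mul, transpose_mul, transpose_nonsing_inv, hT]
  have e2 : (topPotential Ω P t)ᵀ * sqrtJ J
      = sqrtJ J * sqrtJ J * topPotential Ω P t * (sqrtJ J)⁻¹ := by
    rw [e, ← mul_assoc, mul_nonsing_inv_cancel_right _ _ hS]
  rw [e2, ← mul_assoc, ← mul_assoc, ← mul_assoc, nonsing_inv_mul _ hS, one_mul]

theorem continuous_P (h : IsTopSolution J Ω M P) : Continuous P :=
  continuous_matrix fun i j => continuous_iff_continuousAt.2 fun t => (h.deriv_P t i j).continuousAt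

theorem continuous_M (h : IsTopSolution J Ω M P) : Continuous M :=
  continuous_matrix fun i j => continuous_iff_continuousAt.2 fun t => (h.deriv_M t i j).continuousAt

theorem continuous_velocity (hJ : ∀ i, 0 < J i) (h : IsTopSolution J Ω M P) : Continuous Ω :=
  continuous_matrix fun i j =>
    continuous_iff_continuousAt.2 fun t => (h.hasDerivAt_velocity hJ t i j).continuousAt

theorem matDeriv_apply (hJ : ∀ i, 0 < J i) (h : IsTopSolution J Ω M P) (t : ℝ) (i j : Fin d) :
    matDeriv Ω t i j =
      (M t * Ω t - Ω t * M t - (P t * diagonal J - diagonal J * P t)) i j / (J i + J j) := by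
  rw [← h.momentum_deriv hJ t, Matrix.add_apply, Matrix.diagonal_mul, Matrix.mul_diagonal,
    mul_comm _ (J j), ← add_mul, mul_div_cancel_left₀ _ (add_pos (hJ i) (hJ j)).ne']

theorem continuous_matDeriv (hJ : ∀ i, 0 < J i) (h : IsTopSolution J Ω M P) :
    Continuous (matDeriv Ω) := by
  have h1 := h.continuous_velocity hJ
  have h2 := h.continuous_M
  have h3 := h.continuous_P
  refine continuous_matrix fun i j => ?_
  simp_rw [h.matDeriv_apply hJ]
  refine Continuous.div_const (Continuous.matrix_elem ?_ i j) _
  exact ((h2.matrix_mul h1).sub (h1.matrix_mul h2)).sub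
    ((h3.matrix_mul continuous_const).sub (continuous_const.matrix_mul h3))

theorem continuous_topPotential (hJ : ∀ i, 0 < J i) (h : IsTopSolution J Ω M P) :
    Continuous (topPotential Ω P) := by
  have h1 := h.continuous_velocity hJ
  exact (((h1.matrix_mul h1).congr fun t => (sq (Ω t)).symm).sub
    (h.continuous_matDeriv hJ)).add h.continuous_P

theorem sum_mul_eq_trace (A B : RMat d) : ∑ i, ∑ j, A i j * B i j = (Aᵀ * B).trace := by
  rw [Finset.sum_comm]
  rfl

theorem trace_mul_commutator (A B : RMat d) : (A * (A * B - B * A)).trace = 0 := by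
  rw [mul_sub, trace_sub, ← mul_assoc, ← mul_assoc, trace_mul_comm (A * B) A, mul_assoc, sub_self]

theorem hasDerivAt_sum_sq {A : ℝ → RMat d} {A' : RMat d} {t : ℝ}
    (hA : ∀ i j, HasDerivAt (fun s => A s i j) (A' i j) t) :
    HasDerivAt (fun s => ∑ i, ∑ j, A s i j ^ 2) (2 * ((A t)ᵀ * A').trace) t := by
  rw [← sum_mul_eq_trace, Finset.mul_sum]
  simp_rw [Finset.mul_sum]
  refine HasDerivAt.fun_sum fun i _ => HasDerivAt.fun_sum fun j _ => ?_
  exact ((hA i j).pow 2).congr_deriv (by simp; ring)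

/-- The trace of `P²` is conserved, because `P` evolves by commutators. -/
theorem sum_sq_P_eq (h : IsTopSolution J Ω M P) (t : ℝ) :
    ∑ i, ∑ j, P t i j ^ 2 = ∑ i, ∑ j, P 0 i j ^ 2 := by
  have hd : ∀ t, HasDerivAt (fun s => ∑ i, ∑ j, P s i j ^ 2) 0 t := fun t => by
    refine (hasDerivAt_sum_sq (h.deriv_P t)).congr_deriv ?_
    rw [h.symm, trace_mul_commutator, mul_zero]
  exact is_const_of_deriv_eq_zero (fun t => (hd t).differentiableAt) (fun t => (hd t).deriv) t 0

/-- The trace of `M² - 2 J² P` is conserved; as `M` is skew, `-tr M²` is the sum of the squares of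
its entries. -/
theorem sum_sq_M_eq (h : IsTopSolution J Ω M P) (t : ℝ) :
    ∑ i, ∑ j, M t i j ^ 2 + 2 * ∑ i, J i ^ 2 * P t i i =
      ∑ i, ∑ j, M 0 i j ^ 2 + 2 * ∑ i, J i ^ 2 * P 0 i i := by
  have hd : ∀ t, HasDerivAt
      (fun s => ∑ i, ∑ j, M s i j ^ 2 + 2 * ∑ i, J i ^ 2 * P s i i) 0 t := fun t => by
    have h1 := hasDerivAt_sum_sq (h.deriv_M t)
    have h2 : HasDerivAt (fun s => ∑ i, J i ^ 2 * P s i i)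
        (diagonal J * diagonal J * (P t * Ω t - Ω t * P t)).trace t := by
      have e : (diagonal J * diagonal J * (P t * Ω t - Ω t * P t)).trace
          = ∑ i, J i ^ 2 * (P t * Ω t - Ω t * P t) i i := by
        rw [diagonal_mul_diagonal, trace]
        simp only [diag_apply, diagonal_mul, sq]
      rw [e]
      exact HasDerivAt.fun_sum fun i _ => (h.deriv_P t i i).const_mul _
    refine (h1.add (h2.const_mul 2)).congr_deriv ?_
    rw [h.momentum_skew, neg_mul, trace_neg, mul_sub, trace_sub, trace_mul_commutator, h.momentum]
    generalize diagonal J = D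
    generalize Ω t = O
    generalize P t = Q
    have e1 : (D * O * (Q * D)).trace = (O * Q * D * D).trace := by
      rw [mul_assoc, trace_mul_comm]
      simp only [mul_assoc]
    have e2 : (D * O * (D * Q)).trace = (O * D * (Q * D)).trace := by
      rw [mul_assoc, trace_mul_comm]
      simp only [mul_assoc]
    have e3 : (D * D * (Q * O)).trace = (O * D * (D * Q)).trace := by
      rw [← mul_assoc, trace_mul_comm]
      simp only [mul_assoc]
    have e4 : (D * D * (O * Q)).trace = (O * Q * D * D).trace := by
      rw [trace_mul_comm]
      simp only [mul_assoc]
    simp only [add_mul, mul_sub, trace_add, trace_sub, e1, e2, e3, e4]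
    ring
  exact is_const_of_deriv_eq_zero (fun t => (hd t).differentiableAt) (fun t => (hd t).deriv) t 0

theorem exists_bound_P (h : IsTopSolution J Ω M P) : ∃ C, ∀ t i j, |P t i j| ≤ C := by
  refine ⟨∑ i, ∑ j, P 0 i j ^ 2 + 1, fun t i j => ?_⟩
  have h1 : P t i j ^ 2 ≤ ∑ i, ∑ j, P t i j ^ 2 :=
    (Finset.single_le_sum (f := fun j => P t i j ^ 2) (fun j _ => sq_nonneg _)
      (Finset.mem_univ j)).trans (Finset.single_le_sum (f := fun i => ∑ j, P t i j ^ 2)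
      (fun i _ => Finset.sum_nonneg fun j _ => sq_nonneg _) (Finset.mem_univ i))
  rw [h.sum_sq_P_eq] at h1
  rw [← sq_abs] at h1
  nlinarith [sq_nonneg (|P t i j| - 1)]

theorem exists_bound_M (h : IsTopSolution J Ω M P) : ∃ C, ∀ t i j, |M t i j| ≤ C := by
  obtain ⟨C, hC⟩ := h.exists_bound_P
  refine ⟨∑ i, ∑ j, M 0 i j ^ 2 + 2 * ∑ i, J i ^ 2 * P 0 i i + 2 * ∑ i, J i ^ 2 * C + 1,
    fun t i j => ?_⟩
  have h1 : M t i j ^ 2 ≤ ∑ i, ∑ j, M t i j ^ 2 :=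
    (Finset.single_le_sum (f := fun j => M t i j ^ 2) (fun j _ => sq_nonneg _)
      (Finset.mem_univ j)).trans (Finset.single_le_sum (f := fun i => ∑ j, M t i j ^ 2)
      (fun i _ => Finset.sum_nonneg fun j _ => sq_nonneg _) (Finset.mem_univ i))
  have h2 : -∑ i, J i ^ 2 * P t i i ≤ ∑ i, J i ^ 2 * C := by
    rw [← Finset.sum_neg_distrib]
    refine Finset.sum_le_sum fun i _ => ?_
    rw [← mul_neg]
    exact mul_le_mul_of_nonneg_left ((neg_le_abs _).trans (hC t i i)) (sq_nonneg _)
  have h3 := h.sum_sq_M_eq t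
  rw [← sq_abs] at h1
  nlinarith [sq_nonneg (|M t i j| - 1)]

/-- `Ω` is obtained from `M` by dividing the entries by `J i + J j`. -/
theorem exists_bound_velocity (hJ : ∀ i, 0 < J i) (h : IsTopSolution J Ω M P) :
    ∃ C, ∀ t i j, |Ω t i j| ≤ C := by
  obtain ⟨C, hC⟩ := h.exists_bound_M
  refine ⟨∑ i, ∑ j, C / (J i + J j), fun t i j => ?_⟩
  have hp : ∀ i j, 0 < J i + J j := fun i j => add_pos (hJ i) (hJ j)
  have hC0 : 0 ≤ C := (abs_nonneg _).trans (hC t i j)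
  have h0 : ∀ i j, 0 ≤ C / (J i + J j) := fun i j => div_nonneg hC0 (hp i j).le
  have h1 : |Ω t i j| ≤ C / (J i + J j) := by
    rw [le_div_iff₀ (hp i j), mul_comm, ← abs_of_pos (hp i j), ← abs_mul, ← h.momentum_apply]
    exact hC t i j
  exact h1.trans ((Finset.single_le_sum (f := fun j => C / (J i + J j)) (fun j _ => h0 i j)
      (Finset.mem_univ j)).trans (Finset.single_le_sum (f := fun i => ∑ j, C / (J i + J j))
      (fun i _ => Finset.sum_nonneg fun j _ => h0 i j) (Finset.mem_univ i)))

end IsTopSolution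

end Bogoyavlenskij

namespace Bogoyavlenskij
open Filter Topology Matrix

/-! ### The action of real matrices on `ℂ^d` -/

noncomputable section

variable {d : ℕ}

section Act

theorem act_apply (A : RMat d) (u : Vec d) (i : Fin d) :
    act A u i = ∑ j, (A i j : ℂ) * u j := rfl

theorem act_mul (A B : RMat d) (u : Vec d) : act (A * B) u = act A (act B u) := by
  have e : (A * B).map (fun a : ℝ => (a : ℂ))
      = A.map (fun a : ℝ => (a : ℂ)) * B.map (fun a : ℝ => (a : ℂ)) :=
    Matrix.map_mul (f := Complex.ofRealHom)
  rw [act, e, Matrix.toLpLin_mul_same]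
  rfl

theorem act_add (A B : RMat d) (u : Vec d) : act (A + B) u = act A u + act B u := by
  ext i
  simp [act_apply, add_mul, Finset.sum_add_distrib]

theorem act_neg (A : RMat d) (u : Vec d) : act (-A) u = -act A u := by
  ext i
  simp [act_apply]

theorem act_sub (A B : RMat d) (u : Vec d) : act (A - B) u = act A u - act B u := by
  rw [sub_eq_add_neg, act_add, act_neg, sub_eq_add_neg]

theorem act_diagonal_apply (J : Fin d → ℝ) (u : Vec d) (i : Fin d) :
    act (diagonal J) u i = (J i : ℂ) * u i := by
  rw [act_apply, Finset.sum_eq_single i]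
  · rw [diagonal_apply_eq]
  · intro j _ hj
    rw [diagonal_apply_ne _ hj.symm, Complex.ofReal_zero, zero_mul]
  · simp

theorem act_one (u : Vec d) : act (1 : RMat d) u = u := by
  ext i
  rw [← diagonal_one, act_diagonal_apply]
  simp

theorem inner_act (A : RMat d) (u v : Vec d) :
    inner ℂ (act A u) v = inner ℂ u (act Aᵀ v) := by
  simp only [PiLp.inner_apply, act_apply, RCLike.inner_apply, map_sum, map_mul,
    Complex.conj_ofReal, transpose_apply, Finset.mul_sum, Finset.sum_mul]
  rw [Finset.sum_comm]
  refine Finset.sum_congr rfl fun i _ => Finset.sum_congr rfl fun j _ => ?_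
  ring

theorem act_eq_sum (A : RMat d) (u : Vec d) :
    act A u = ∑ i, ∑ j, A i j • act (Matrix.single i j 1) u := by
  have hs : ∀ (i j k : Fin d), act (Matrix.single i j (1 : ℝ)) u k = if i = k then u j else 0 := by
    intro i j k
    rw [act_apply, Finset.sum_eq_single j]
    · by_cases h : i = k <;> simp [h]
    · intro l _ hl
      simp [hl.symm]
    · simp
  ext k
  simp only [act_apply A, WithLp.ofLp_sum, Finset.sum_apply, WithLp.ofLp_smul, Pi.smul_apply, hs,
    Complex.real_smul, mul_ite, mul_zero]
  rw [Finset.sum_comm]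
  simp

/-- The action of a real matrix on `ℂ^d` as a continuous real-linear map. -/
def actR (A : RMat d) : Vec d →L[ℝ] Vec d :=
  ((act A).restrictScalars ℝ).toContinuousLinearMap

theorem continuous_act {X : Type*} [TopologicalSpace X] {A : X → RMat d} {u : X → Vec d}
    (hA : Continuous A) (hu : Continuous u) : Continuous fun x => act (A x) (u x) := by
  simp_rw [fun x => act_eq_sum (A x) (u x)]
  refine continuous_finsetSum _ fun i _ => continuous_finsetSum _ fun j _ => ?_
  exact (hA.matrix_elem i j).smul ((actR (Matrix.single i j 1)).continuous.comp hu)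

/-- Matrices with bounded entries act as uniformly bounded operators. -/
theorem exists_norm_act_le {X : Type*} {A : X → RMat d} {C : ℝ}
    (hC : ∀ x i j, |A x i j| ≤ C) :
    ∃ D : ℝ, 0 ≤ D ∧ ∀ x u, ‖act (A x) u‖ ≤ D * ‖u‖ := by
  refine ⟨∑ i : Fin d, ∑ j : Fin d, |C| * ‖actR (Matrix.single i j 1)‖, by positivity,
    fun x u => ?_⟩
  rw [act_eq_sum, Finset.sum_mul]
  refine (norm_sum_le _ _).trans (Finset.sum_le_sum fun i _ => ?_)
  rw [Finset.sum_mul]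
  refine (norm_sum_le _ _).trans (Finset.sum_le_sum fun j _ => ?_)
  rw [norm_smul, mul_assoc, Real.norm_eq_abs]
  exact mul_le_mul ((hC x i j).trans (le_abs_self C)) ((actR (Matrix.single i j 1)).le_opNorm u)
    (norm_nonneg _) (abs_nonneg _)

theorem exists_norm_act_const_le (A : RMat d) : ∃ D : ℝ, 0 ≤ D ∧ ∀ u, ‖act A u‖ ≤ D * ‖u‖ :=
  ⟨‖actR A‖, norm_nonneg _, fun u => (actR A).le_opNorm u⟩

theorem IsPrimitive.zero {F : Type*} [NormedAddCommGroup F] [NormedSpace ℝ F] :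
    IsPrimitive (fun _ : ℝ => (0 : F)) fun _ => 0 :=
  ⟨locallyIntegrable_const _, fun a b => by simp⟩

theorem IsPrimitive.sum {F ι : Type*} [NormedAddCommGroup F] [NormedSpace ℝ F] (s : Finset ι)
    {u v : ι → ℝ → F} (h : ∀ i ∈ s, IsPrimitive (u i) (v i)) :
    IsPrimitive (fun x => ∑ i ∈ s, u i x) fun x => ∑ i ∈ s, v i x := by
  classical
  induction s using Finset.induction_on with
  | empty => simpa using IsPrimitive.zero
  | insert i s hi ih =>
    simp_rw [Finset.sum_insert hi]
    exact (h i (Finset.mem_insert_self i s)).add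
      (ih fun j hj => h j (Finset.mem_insert_of_mem hj))

/-- The product rule for a differentiable matrix acting on an indefinite integral. -/
theorem IsPrimitive.matrix_act {A A' : ℝ → RMat d} {u u' : ℝ → Vec d}
    (hA : ∀ t i j, HasDerivAt (fun s => A s i j) (A' t i j) t) (hA' : Continuous A')
    (hu : IsPrimitive u u') :
    IsPrimitive (fun t => act (A t) (u t)) fun t => act (A t) (u' t) + act (A' t) (u t) := by
  refine (IsPrimitive.sum Finset.univ fun i _ => IsPrimitive.sum Finset.univ fun j _ =>
    (IsPrimitive.of_hasDerivAt (fun t => hA t i j) (hA'.matrix_elem i j)).bilin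
      (B := fun (c : ℝ) (x : Vec d) => c • x) isBoundedBilinearMap_smul
      (hu.clm_comp (actR (Matrix.single i j 1)))).congr (fun x => ?_) fun x => ?_
  · rw [act_eq_sum]
    rfl
  · rw [act_eq_sum (A x), act_eq_sum (A' x)]
    simp only [← Finset.sum_add_distrib]
    rfl

theorem IsPrimitive.act_const (A : RMat d) {u u' : ℝ → Vec d} (hu : IsPrimitive u u') :
    IsPrimitive (fun t => act A (u t)) fun t => act A (u' t) :=
  hu.clm_comp (actR A)

theorem IsPrimitive.const_smul (z : ℂ) {u u' : ℝ → Vec d} (hu : IsPrimitive u u') :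
    IsPrimitive (fun t => z • u t) fun t => z • u' t :=
  hu.clm_comp ((z • ContinuousLinearMap.id ℂ (Vec d)).restrictScalars ℝ)

variable {J : Fin d → ℝ}

/-- The inverse of `diag (J₁, …, J_d)`. -/
def diagInv (J : Fin d → ℝ) : RMat d := diagonal fun i => (J i)⁻¹

theorem act_diag_inv (hJ : ∀ i, 0 < J i) (u : Vec d) :
    act (diagonal J) (act (diagInv J) u) = u := by
  rw [← act_mul, diagInv, diagonal_mul_diagonal]
  simp_rw [fun i => mul_inv_cancel₀ (hJ i).ne']
  rw [diagonal_one, act_one]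

theorem act_inv_diag (hJ : ∀ i, 0 < J i) (u : Vec d) :
    act (diagInv J) (act (diagonal J) u) = u := by
  rw [← act_mul, diagInv, diagonal_mul_diagonal]
  simp_rw [fun i => inv_mul_cancel₀ (hJ i).ne']
  rw [diagonal_one, act_one]

theorem inv_diagonal_eq (hJ : ∀ i, 0 < J i) : (diagonal J)⁻¹ = diagInv J := by
  refine Matrix.inv_eq_left_inv ?_
  rw [diagInv, diagonal_mul_diagonal]
  simp_rw [fun i => inv_mul_cancel₀ (hJ i).ne']
  rw [diagonal_one]

theorem inner_act_diagonal (J : Fin d → ℝ) (u : Vec d) :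
    inner ℂ (act (diagonal J) u) u = ((∑ i, J i * ‖u i‖ ^ 2 : ℝ) : ℂ) := by
  rw [PiLp.inner_apply, Complex.ofReal_sum]
  refine Finset.sum_congr rfl fun i _ => ?_
  rw [act_diagonal_apply, RCLike.inner_apply, map_mul, Complex.conj_ofReal, mul_left_comm,
    Complex.mul_conj, Complex.normSq_eq_norm_sq, Complex.ofReal_mul]

/-- The quadratic form of `J` is bounded below. -/
theorem exists_le_inner_act_diagonal (hJ : ∀ i, 0 < J i) :
    ∃ c : ℝ, 0 < c ∧ ∀ u : Vec d, c * ‖u‖ ^ 2 ≤ (inner ℂ (act (diagonal J) u) u).re := by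
  obtain ⟨c, hc, hcJ⟩ : ∃ c : ℝ, 0 < c ∧ ∀ i, c ≤ J i := by
    rcases isEmpty_or_nonempty (Fin d) with hd | hd
    · exact ⟨1, one_pos, fun i => hd.elim i⟩
    · obtain ⟨i, hi⟩ := Finite.exists_min J
      exact ⟨J i, hJ i, hi⟩
  refine ⟨c, hc, fun u => ?_⟩
  rw [inner_act_diagonal, Complex.ofReal_re, EuclideanSpace.norm_sq_eq, Finset.mul_sum]
  exact Finset.sum_le_sum fun i _ => mul_le_mul_of_nonneg_right (hcJ i) (sq_nonneg _)

end Act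

/-! ### The first order system and its Lax equation -/

section Companion

/-- The companion matrix of the quadratic pencil `μ² J² - μ M - P + z`. Its eigenvectors with
eigenvalue `μ` are the vectors `(a, μ a)` with `a` in the kernel of the pencil. -/
def companion (J : Fin d → ℝ) (M P : RMat d) (z : ℂ) : Vec d × Vec d →ₗ[ℂ] Vec d × Vec d :=
  (LinearMap.snd ℂ (Vec d) (Vec d)).prod
    (act (diagInv J) ∘ₗ act (diagInv J) ∘ₗ
      (act M ∘ₗ LinearMap.snd ℂ (Vec d) (Vec d) +
        (act P - z • LinearMap.id) ∘ₗ LinearMap.fst ℂ (Vec d) (Vec d)))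

/-- The coefficient of the first order system `Φ' = (J C - Ω) Φ` satisfied by
`Φ = (ψ, J⁻¹ (D + Ω) ψ)` when `L ψ = z ψ`; here `C` is the companion matrix. -/
def phaseField (J : Fin d → ℝ) (Ω M P : RMat d) (z : ℂ) : Vec d × Vec d →ₗ[ℂ] Vec d × Vec d :=
  (act (diagonal J)).prodMap (act (diagonal J)) ∘ₗ companion J M P z - (act Ω).prodMap (act Ω)

variable (J : Fin d → ℝ) (z : ℂ)

theorem companion_apply (M P : RMat d) (a b : Vec d) : companion J M P z (a, b) =
    (b, act (diagInv J) (act (diagInv J) (act M b + (act P a - z • a)))) := rfl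

theorem phaseField_apply (Ω M P : RMat d) (v : Vec d × Vec d) : phaseField J Ω M P z v =
    (act (diagonal J) (companion J M P z v).1 - act Ω v.1,
      act (diagonal J) (companion J M P z v).2 - act Ω v.2) := rfl

variable {J z} {Ω M P : ℝ → RMat d}

/-- The Lax equation in integrated form: the companion matrix maps solutions of the first order
system with source `Γ` to solutions with source `C Γ`. -/
theorem IsPrimitive.map_companion (hJ : ∀ i, 0 < J i) (h : IsTopSolution J Ω M P)
    {Φ Γ : ℝ → Vec d × Vec d}
    (hΦ : IsPrimitive Φ fun t => phaseField J (Ω t) (M t) (P t) z (Φ t) + Γ t) :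
    IsPrimitive (fun t => companion J (M t) (P t) z (Φ t)) fun t =>
      phaseField J (Ω t) (M t) (P t) z (companion J (M t) (P t) z (Φ t)) +
        companion J (M t) (P t) z (Γ t) := by
  have hM' : Continuous fun t => M t * Ω t - Ω t * M t - (P t * diagonal J - diagonal J * P t) :=
    ((h.continuous_M.matrix_mul (h.continuous_velocity hJ)).sub
      ((h.continuous_velocity hJ).matrix_mul h.continuous_M)).sub
      ((h.continuous_P.matrix_mul continuous_const).sub
        (continuous_const.matrix_mul h.continuous_P))
  have hP' : Continuous fun t => P t * Ω t - Ω t * P t :=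
    (h.continuous_P.matrix_mul (h.continuous_velocity hJ)).sub
      ((h.continuous_velocity hJ).matrix_mul h.continuous_P)
  have ha := hΦ.clm_comp (ContinuousLinearMap.fst ℝ (Vec d) (Vec d))
  have hb := hΦ.clm_comp (ContinuousLinearMap.snd ℝ (Vec d) (Vec d))
  have h1 := ((((IsPrimitive.matrix_act h.deriv_M hM' hb).add
    ((IsPrimitive.matrix_act h.deriv_P hP' ha).sub (ha.const_smul z))).act_const
      (diagInv J)).act_const (diagInv J))
  refine (hb.prodMk h1).congr (fun t => rfl) fun t => ?_
  obtain ⟨a, b⟩ := Φ t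
  obtain ⟨γ₁, γ₂⟩ := Γ t
  simp only [ContinuousLinearMap.coe_fst', ContinuousLinearMap.coe_snd', phaseField_apply,
    companion_apply, Prod.mk_add_mk, Prod.mk.injEq, true_and]
  -- apply `J²` to both sides of the second component
  have hinj : ∀ u v : Vec d, act (diagonal J) (act (diagonal J) u) = v →
      act (diagInv J) (act (diagInv J) v) = u := by
    rintro u _ rfl
    rw [act_inv_diag hJ, act_inv_diag hJ]
  refine hinj _ _ ?_
  set ω := act (diagInv J) (act (diagInv J) (act (M t) b + (act (P t) a - z • a))) with hω
  have eω : act (diagonal J) (act (diagonal J) ω) = act (M t) b + (act (P t) a - z • a) := by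
    rw [hω, act_diag_inv hJ, act_diag_inv hJ]
  have eM : ∀ v, act (M t) v = act (diagonal J) (act (Ω t) v) + act (Ω t) (act (diagonal J) v) :=
    fun v => by rw [h.momentum, act_add, act_mul, act_mul]
  have eΩ := congrArg (act (Ω t)) eω
  have e1 := congrArg (act (diagonal J)) (eM ω)
  have e2 := eM (act (diagonal J) ω)
  simp only [map_add, map_sub, map_smul, act_diag_inv hJ, act_sub, act_mul] at eΩ e1 e2 ⊢
  linear_combination (norm := module) e1 - e2 - eΩ

/-- The passage from a second order equation to the first order system. -/
theorem IsPrimitive.phase (hJ : ∀ i, 0 < J i) (h : IsTopSolution J Ω M P)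
    {ψ χ g : ℝ → Vec d} (hψ : IsPrimitive ψ χ) (hχ : IsPrimitive χ g) :
    IsPrimitive (fun t => (ψ t, act (diagInv J) (χ t + act (Ω t) (ψ t)))) fun t =>
      phaseField J (Ω t) (M t) (P t) z (ψ t, act (diagInv J) (χ t + act (Ω t) (ψ t))) +
        (0, act (diagInv J) (g t - (act (topPotential Ω P t) (ψ t) - z • ψ t))) := by
  have h1 := (hχ.add (IsPrimitive.matrix_act (h.hasDerivAt_velocity hJ)
    (h.continuous_matDeriv hJ) hψ)).act_const (diagInv J)
  refine (hψ.prodMk h1).congr (fun t => rfl) fun t => ?_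
  simp only [phaseField_apply, companion_apply, Prod.mk_add_mk, Prod.mk.injEq, act_diag_inv hJ]
  refine ⟨by abel, ?_⟩
  have hinj : ∀ u v : Vec d, act (diagonal J) u = v → act (diagInv J) v = u := by
    rintro u _ rfl
    rw [act_inv_diag hJ]
  refine hinj _ _ ?_
  set φ := act (diagInv J) (χ t + act (Ω t) (ψ t)) with hφ
  have eφ : act (diagonal J) φ = χ t + act (Ω t) (ψ t) := by rw [hφ, act_diag_inv hJ]
  have eM : ∀ v, act (M t) v = act (diagonal J) (act (Ω t) v) + act (Ω t) (act (diagonal J) v) :=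
    fun v => by rw [h.momentum, act_add, act_mul, act_mul]
  have eΩ := congrArg (act (Ω t)) eφ
  simp only [topPotential, sq, map_add, map_sub, act_diag_inv hJ, act_sub, act_add, act_mul, eM]
    at eΩ ⊢
  linear_combination (norm := module) eΩ

end Companion

end

end Bogoyavlenskij

namespace Bogoyavlenskij
open Filter Topology Matrix

noncomputable section

variable {d : ℕ}

/-! ### Solutions of the first order system -/

section EntryBounds

/-- A matrix-valued function with bounded entries. -/
def EntryBounded (A : ℝ → RMat d) : Prop := ∃ C, ∀ t i j, |A t i j| ≤ C

theorem EntryBounded.add {A B : ℝ → RMat d} (hA : EntryBounded A) (hB : EntryBounded B) :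
    EntryBounded fun t => A t + B t := by
  obtain ⟨a, ha⟩ := hA
  obtain ⟨b, hb⟩ := hB
  exact ⟨a + b, fun t i j => (abs_add_le _ _).trans (add_le_add (ha t i j) (hb t i j))⟩

theorem EntryBounded.sub {A B : ℝ → RMat d} (hA : EntryBounded A) (hB : EntryBounded B) :
    EntryBounded fun t => A t - B t := by
  obtain ⟨a, ha⟩ := hA
  obtain ⟨b, hb⟩ := hB
  exact ⟨a + b, fun t i j => (abs_sub _ _).trans (add_le_add (ha t i j) (hb t i j))⟩

theorem EntryBounded.mul {A B : ℝ → RMat d} (hA : EntryBounded A) (hB : EntryBounded B) :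
    EntryBounded fun t => A t * B t := by
  obtain ⟨a, ha⟩ := hA
  obtain ⟨b, hb⟩ := hB
  refine ⟨∑ _k : Fin d, a * b, fun t i j => ?_⟩
  change |(A t * B t) i j| ≤ _
  rw [Matrix.mul_apply]
  refine (Finset.abs_sum_le_sum_abs _ _).trans (Finset.sum_le_sum fun k _ => ?_)
  rw [abs_mul]
  exact mul_le_mul (ha t i k) (hb t k j) (abs_nonneg _) ((abs_nonneg _).trans (ha t i k))

theorem EntryBounded.const (A : RMat d) : EntryBounded fun _ => A :=
  ⟨∑ i, ∑ j, |A i j|, fun _ i j =>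
    (Finset.single_le_sum (f := fun j => |A i j|) (fun _ _ => abs_nonneg _)
      (Finset.mem_univ j)).trans (Finset.single_le_sum (f := fun i => ∑ j, |A i j|)
      (fun _ _ => Finset.sum_nonneg fun _ _ => abs_nonneg _) (Finset.mem_univ i))⟩

variable {J : Fin d → ℝ} {Ω M P : ℝ → RMat d}

theorem IsTopSolution.entryBounded_topPotential (hJ : ∀ i, 0 < J i)
    (h : IsTopSolution J Ω M P) : EntryBounded (topPotential Ω P) := by
  have hΩ : EntryBounded Ω := h.exists_bound_velocity hJ
  have hM : EntryBounded M := h.exists_bound_M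
  have hP : EntryBounded P := h.exists_bound_P
  obtain ⟨C, hC⟩ := ((hM.mul hΩ).sub (hΩ.mul hM)).sub
    ((hP.mul (EntryBounded.const (diagonal J))).sub ((EntryBounded.const (diagonal J)).mul hP))
  have hΩ' : EntryBounded (matDeriv Ω) := by
    obtain ⟨D, hD⟩ := EntryBounded.const (Matrix.of fun i j => (J i + J j)⁻¹)
    refine ⟨C * D, fun t i j => ?_⟩
    rw [h.matDeriv_apply hJ, div_eq_mul_inv, abs_mul]
    exact mul_le_mul (hC t i j) (hD t i j) (abs_nonneg _) ((abs_nonneg _).trans (hC t i j))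
  have e : topPotential Ω P = fun t => Ω t * Ω t - matDeriv Ω t + P t :=
    funext fun t => by rw [topPotential, sq]
  rw [e]
  exact ((hΩ.mul hΩ).sub hΩ').add hP

end EntryBounds

variable {J : Fin d → ℝ} {Ω M P : ℝ → RMat d} {z : ℂ}

/-- `Φ` solves the first order system associated with `L ψ = z ψ`. -/
def IsFlow (J : Fin d → ℝ) (Ω M P : ℝ → RMat d) (z : ℂ) (Φ : ℝ → Vec d × Vec d) : Prop :=
  ∀ t, HasDerivAt Φ (phaseField J (Ω t) (M t) (P t) z (Φ t)) t

section Bounds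

theorem exists_norm_companion_le (h : IsTopSolution J Ω M P) (z : ℂ) :
    ∃ C : ℝ, 0 ≤ C ∧ ∀ t v, ‖companion J (M t) (P t) z v‖ ≤ C * ‖v‖ := by
  obtain ⟨m, hm⟩ := h.exists_bound_M
  obtain ⟨m', hm0, hm'⟩ := exists_norm_act_le hm
  obtain ⟨p, hp⟩ := h.exists_bound_P
  obtain ⟨p', hp0, hp'⟩ := exists_norm_act_le hp
  obtain ⟨k, hk0, hk⟩ := exists_norm_act_const_le (diagInv J)
  refine ⟨1 + k * (k * (m' + (p' + ‖z‖))), by positivity, fun t v => ?_⟩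
  obtain ⟨a, b⟩ := v
  have ha : ‖a‖ ≤ ‖(a, b)‖ := le_max_left _ _
  have hb : ‖b‖ ≤ ‖(a, b)‖ := le_max_right _ _
  set n := ‖(a, b)‖
  have hn : 0 ≤ n := norm_nonneg _
  have h1 : ‖act (M t) b + (act (P t) a - z • a)‖ ≤ (m' + (p' + ‖z‖)) * n := by
    calc _ ≤ ‖act (M t) b‖ + (‖act (P t) a‖ + ‖z • a‖) :=
          (norm_add_le _ _).trans (add_le_add le_rfl (norm_sub_le _ _))
      _ ≤ m' * n + (p' * n + ‖z‖ * n) := by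
          rw [norm_smul]
          gcongr
          · exact (hm' t b).trans (by gcongr)
          · exact (hp' t a).trans (by gcongr)
      _ = _ := by ring
  rw [companion_apply]
  refine max_le (hb.trans ?_) ?_
  · have : 0 ≤ k * (k * (m' + (p' + ‖z‖))) := by positivity
    nlinarith
  · calc _ ≤ k * (k * ((m' + (p' + ‖z‖)) * n)) :=
          (hk _).trans (mul_le_mul_of_nonneg_left
            ((hk _).trans (mul_le_mul_of_nonneg_left h1 hk0)) hk0)
      _ ≤ (1 + k * (k * (m' + (p' + ‖z‖)))) * n := by nlinarith

theorem exists_norm_phaseField_le (hJ : ∀ i, 0 < J i) (h : IsTopSolution J Ω M P) (z : ℂ) :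
    ∃ C : ℝ, ∀ t v, ‖phaseField J (Ω t) (M t) (P t) z v‖ ≤ C * ‖v‖ := by
  obtain ⟨c, hc0, hc⟩ := exists_norm_companion_le h z
  obtain ⟨w, hw⟩ := h.exists_bound_velocity hJ
  obtain ⟨w', hw0, hw'⟩ := exists_norm_act_le hw
  obtain ⟨k, hk0, hk⟩ := exists_norm_act_const_le (diagonal J)
  refine ⟨k * c + w', fun t v => ?_⟩
  rw [phaseField_apply]
  have h1 : ‖(companion J (M t) (P t) z v).1‖ ≤ c * ‖v‖ := (le_max_left _ _).trans (hc t v)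
  have h2 : ‖(companion J (M t) (P t) z v).2‖ ≤ c * ‖v‖ := (le_max_right _ _).trans (hc t v)
  have ha : ‖v.1‖ ≤ ‖v‖ := le_max_left _ _
  have hb : ‖v.2‖ ≤ ‖v‖ := le_max_right _ _
  have key : ∀ x y : Vec d, ‖x‖ ≤ c * ‖v‖ → ‖y‖ ≤ ‖v‖ →
      ‖act (diagonal J) x - act (Ω t) y‖ ≤ (k * c + w') * ‖v‖ := by
    intro x y hx hy
    calc _ ≤ ‖act (diagonal J) x‖ + ‖act (Ω t) y‖ := norm_sub_le _ _
      _ ≤ k * (c * ‖v‖) + w' * ‖v‖ := add_le_add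
          ((hk x).trans (mul_le_mul_of_nonneg_left hx hk0))
          ((hw' t y).trans (mul_le_mul_of_nonneg_left hy hw0))
      _ = _ := by ring
  exact max_le (key _ _ h1 ha) (key _ _ h2 hb)

theorem continuous_companion (h : IsTopSolution J Ω M P) {Φ : ℝ → Vec d × Vec d}
    (hΦ : Continuous Φ) : Continuous fun t => companion J (M t) (P t) z (Φ t) := by
  have h1 := continuous_act h.continuous_M hΦ.snd
  have h2 := (continuous_act h.continuous_P hΦ.fst).sub (hΦ.fst.const_smul z)
  exact hΦ.snd.prodMk (continuous_act continuous_const (continuous_act continuous_const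
    (h1.add h2)))

theorem continuous_phaseField (hJ : ∀ i, 0 < J i) (h : IsTopSolution J Ω M P)
    {Φ : ℝ → Vec d × Vec d} (hΦ : Continuous Φ) :
    Continuous fun t => phaseField J (Ω t) (M t) (P t) z (Φ t) := by
  have h1 := continuous_companion (z := z) h hΦ
  have h2 := h.continuous_velocity hJ
  exact ((continuous_act continuous_const h1.fst).sub (continuous_act h2 hΦ.fst)).prodMk
    ((continuous_act continuous_const h1.snd).sub (continuous_act h2 hΦ.snd))

end Bounds

namespace IsFlow

protected theorem continuous {Φ : ℝ → Vec d × Vec d} (hΦ : IsFlow J Ω M P z Φ) :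
    Continuous Φ :=
  continuous_iff_continuousAt.2 fun t => (hΦ t).continuousAt

theorem isPrimitive (hJ : ∀ i, 0 < J i) (h : IsTopSolution J Ω M P) {Φ : ℝ → Vec d × Vec d}
    (hΦ : IsFlow J Ω M P z Φ) :
    IsPrimitive Φ fun t => phaseField J (Ω t) (M t) (P t) z (Φ t) :=
  IsPrimitive.of_hasDerivAt hΦ (continuous_phaseField hJ h hΦ.continuous)

theorem of_isPrimitive (hJ : ∀ i, 0 < J i) (h : IsTopSolution J Ω M P) {Φ : ℝ → Vec d × Vec d}
    (hΦ : IsPrimitive Φ fun t => phaseField J (Ω t) (M t) (P t) z (Φ t)) : IsFlow J Ω M P z Φ :=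
  fun t => hΦ.hasDerivAt (continuous_phaseField hJ h hΦ.continuous) t

/-- The companion matrix acts on solutions: this is the operator `A = J⁻¹ (D + Ω)` on the
solutions of `L ψ = z ψ`. -/
theorem map_companion (hJ : ∀ i, 0 < J i) (h : IsTopSolution J Ω M P) {Φ : ℝ → Vec d × Vec d}
    (hΦ : IsFlow J Ω M P z Φ) :
    IsFlow J Ω M P z fun t => companion J (M t) (P t) z (Φ t) := by
  refine of_isPrimitive hJ h ((IsPrimitive.map_companion hJ h (Γ := fun _ => 0)
    ((hΦ.isPrimitive hJ h).congr (fun _ => rfl) fun t => (add_zero _).symm)).congr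
    (fun _ => rfl) fun t => ?_)
  rw [map_zero, add_zero]

theorem add {Φ Ψ : ℝ → Vec d × Vec d} (hΦ : IsFlow J Ω M P z Φ) (hΨ : IsFlow J Ω M P z Ψ) :
    IsFlow J Ω M P z fun t => Φ t + Ψ t := fun t => by
  rw [map_add]
  exact (hΦ t).add (hΨ t)

theorem smul (c : ℂ) {Φ : ℝ → Vec d × Vec d} (hΦ : IsFlow J Ω M P z Φ) :
    IsFlow J Ω M P z fun t => c • Φ t := fun t => by
  rw [map_smul]
  exact (hΦ t).const_smul c

theorem sub {Φ Ψ : ℝ → Vec d × Vec d} (hΦ : IsFlow J Ω M P z Φ) (hΨ : IsFlow J Ω M P z Ψ) :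
    IsFlow J Ω M P z fun t => Φ t - Ψ t := fun t => by
  rw [map_sub]
  exact (hΦ t).sub (hΨ t)

theorem zero : IsFlow J Ω M P z fun _ => 0 := fun t => by
  rw [map_zero]
  exact hasDerivAt_const t 0

end IsFlow

/-- The coefficient of the first order system as a continuous real-linear map. -/
def phaseFieldR (J : Fin d → ℝ) (Ω M P : RMat d) (z : ℂ) : Vec d × Vec d →L[ℝ] Vec d × Vec d :=
  ((phaseField J Ω M P z).restrictScalars ℝ).toContinuousLinearMap

theorem exists_norm_phaseFieldR_le (hJ : ∀ i, 0 < J i) (h : IsTopSolution J Ω M P) (z : ℂ) :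
    ∃ C : ℝ, ∀ t, ‖phaseFieldR J (Ω t) (M t) (P t) z‖ ≤ C := by
  obtain ⟨C, hC⟩ := exists_norm_phaseField_le hJ h z
  refine ⟨|C|, fun t => ContinuousLinearMap.opNorm_le_bound _ (abs_nonneg _) fun v => ?_⟩
  exact (hC t v).trans (mul_le_mul_of_nonneg_right (le_abs_self C) (norm_nonneg _))

theorem exists_flow (hJ : ∀ i, 0 < J i) (h : IsTopSolution J Ω M P) (z : ℂ) (t₀ : ℝ)
    (v : Vec d × Vec d) : ∃ Φ, IsFlow J Ω M P z Φ ∧ Φ t₀ = v := by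
  obtain ⟨C, hC⟩ := exists_norm_phaseFieldR_le hJ h z
  have hc : Continuous fun t => phaseFieldR J (Ω t) (M t) (P t) z :=
    continuous_clm_apply.2 fun v => continuous_phaseField hJ h continuous_const
  obtain ⟨Φ, h0, hΦ⟩ := exists_linear_ode _ hc hC t₀ v
  exact ⟨Φ, hΦ, h0⟩

theorem IsFlow.unique (hJ : ∀ i, 0 < J i) (h : IsTopSolution J Ω M P)
    {Φ Ψ : ℝ → Vec d × Vec d} (hΦ : IsFlow J Ω M P z Φ) (hΨ : IsFlow J Ω M P z Ψ) {t₀ : ℝ}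
    (h0 : Φ t₀ = Ψ t₀) : Φ = Ψ := by
  obtain ⟨C, hC⟩ := exists_norm_phaseFieldR_le hJ h z
  exact linear_ode_unique (fun t => phaseFieldR J (Ω t) (M t) (P t) z) hC hΦ hΨ h0

/-- The vector `(ψ, J⁻¹ (D + Ω) ψ)` of Cauchy data. -/
def phase (J : Fin d → ℝ) (Ω : ℝ → RMat d) (ψ : ℝ → Vec d) (t : ℝ) : Vec d × Vec d :=
  (ψ t, act (diagInv J) (deriv ψ t + act (Ω t) (ψ t)))

theorem IsSolution.isPrimitive_deriv {U : ℝ → RMat d} (hU : Continuous U) {ψ : ℝ → Vec d}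
    (hψ : IsSolution U z ψ) :
    IsPrimitive ψ (deriv ψ) ∧ IsPrimitive (deriv ψ) fun t => act (U t) (ψ t) - z • ψ t := by
  have e : ∀ t, deriv (deriv ψ) t = act (U t) (ψ t) - z • ψ t := fun t => by
    rw [← hψ.2.2 t]
    abel
  refine ⟨IsPrimitive.of_hasDerivAt (fun t => (hψ.1 t).hasDerivAt) hψ.2.1.continuous,
    IsPrimitive.of_hasDerivAt (fun t => ?_) ?_⟩
  · rw [← e]
    exact (hψ.2.1 t).hasDerivAt
  · exact (continuous_act hU hψ.1.continuous).sub (hψ.1.continuous.const_smul z)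

/-- Solutions of the second order equation are the first components of solutions of the first
order system. -/
theorem IsSolution.isFlow_phase (hJ : ∀ i, 0 < J i) (h : IsTopSolution J Ω M P) {ψ : ℝ → Vec d}
    (hψ : IsSolution (topPotential Ω P) z ψ) : IsFlow J Ω M P z (phase J Ω ψ) := by
  obtain ⟨h1, h2⟩ := hψ.isPrimitive_deriv (h.continuous_topPotential hJ)
  refine IsFlow.of_isPrimitive hJ h ((IsPrimitive.phase (z := z) hJ h h1 h2).congr
    (fun _ => rfl) fun t => ?_)
  rw [sub_self, map_zero]
  exact add_zero _

theorem IsFlow.hasDerivAt_fst {Φ : ℝ → Vec d × Vec d} (hΦ : IsFlow J Ω M P z Φ) (t : ℝ) :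
    HasDerivAt (fun t => (Φ t).1) (act (diagonal J) (Φ t).2 - act (Ω t) (Φ t).1) t :=
  (ContinuousLinearMap.fst ℝ (Vec d) (Vec d)).hasFDerivAt.comp_hasDerivAt t (hΦ t)

theorem IsFlow.hasDerivAt_snd {Φ : ℝ → Vec d × Vec d} (hΦ : IsFlow J Ω M P z Φ) (t : ℝ) :
    HasDerivAt (fun t => (Φ t).2)
      (act (diagonal J) (companion J (M t) (P t) z (Φ t)).2 - act (Ω t) (Φ t).2) t :=
  (ContinuousLinearMap.snd ℝ (Vec d) (Vec d)).hasFDerivAt.comp_hasDerivAt t (hΦ t)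

theorem IsFlow.phase_fst (hJ : ∀ i, 0 < J i) {Φ : ℝ → Vec d × Vec d}
    (hΦ : IsFlow J Ω M P z Φ) : phase J Ω (fun t => (Φ t).1) = Φ := by
  funext t
  rw [phase, (hΦ.hasDerivAt_fst t).deriv, sub_add_cancel, act_inv_diag hJ]

theorem IsFlow.isSolution_fst (hJ : ∀ i, 0 < J i) (h : IsTopSolution J Ω M P)
    {Φ : ℝ → Vec d × Vec d} (hΦ : IsFlow J Ω M P z Φ) :
    IsSolution (topPotential Ω P) z fun t => (Φ t).1 := by
  have e : deriv (fun t => (Φ t).1) = fun t => act (diagonal J) (Φ t).2 - act (Ω t) (Φ t).1 :=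
    funext fun t => (hΦ.hasDerivAt_fst t).deriv
  have hc := hΦ.continuous
  have ha := IsPrimitive.of_hasDerivAt hΦ.hasDerivAt_fst
    ((continuous_act continuous_const hc.snd).sub
      (continuous_act (h.continuous_velocity hJ) hc.fst))
  have hb := IsPrimitive.of_hasDerivAt hΦ.hasDerivAt_snd
    ((continuous_act continuous_const (continuous_companion h hc).snd).sub
      (continuous_act (h.continuous_velocity hJ) hc.snd))
  have hd := (hb.act_const (diagonal J)).sub
    (IsPrimitive.matrix_act (h.hasDerivAt_velocity hJ) (h.continuous_matDeriv hJ) ha)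
  have hd' := hd.hasDerivAt (by
    have h1 := h.continuous_velocity hJ
    have h2 := h.continuous_matDeriv hJ
    exact (continuous_act continuous_const ((continuous_act continuous_const
      (continuous_companion h hc).snd).sub (continuous_act h1 hc.snd))).sub
      ((continuous_act h1 ((continuous_act continuous_const hc.snd).sub
        (continuous_act h1 hc.fst))).add (continuous_act h2 hc.fst)))
  refine ⟨fun t => (hΦ.hasDerivAt_fst t).differentiableAt, ?_, fun t => ?_⟩
  · rw [e]
    exact fun t => (hd' t).differentiableAt
  · rw [e, (hd' t).deriv]
    beta_reduce
    obtain ⟨a, b⟩ := Φ t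
    have eM : ∀ v, act (M t) v
        = act (diagonal J) (act (Ω t) v) + act (Ω t) (act (diagonal J) v) :=
      fun v => by rw [h.momentum, act_add, act_mul, act_mul]
    simp only [companion_apply, act_diag_inv hJ, map_sub, topPotential, sq, act_add, act_sub,
      act_mul, eM]
    module

/-- A bounded solution of the second order equation has bounded Cauchy data. -/
theorem exists_norm_phase_le (hJ : ∀ i, 0 < J i) (h : IsTopSolution J Ω M P) {ψ : ℝ → Vec d}
    (hψ : IsSolution (topPotential Ω P) z ψ) (hb : IsBoundedFun ψ) :
    ∃ C, ∀ t, ‖phase J Ω ψ t‖ ≤ C := by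
  obtain ⟨C, hC⟩ := hb
  obtain ⟨u, hu⟩ := h.entryBounded_topPotential hJ
  obtain ⟨u', hu0, hu'⟩ := exists_norm_act_le hu
  obtain ⟨w, hw⟩ := h.exists_bound_velocity hJ
  obtain ⟨w', hw0, hw'⟩ := exists_norm_act_le hw
  obtain ⟨k, hk0, hk⟩ := exists_norm_act_const_le (diagInv J)
  obtain ⟨h1, h2⟩ := hψ.isPrimitive_deriv (h.continuous_topPotential hJ)
  have h3 : ∀ t, ‖act (topPotential Ω P t) (ψ t) - z • ψ t‖ ≤ u' * C + ‖z‖ * C := fun t => by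
    refine (norm_sub_le _ _).trans (add_le_add ((hu' t _).trans ?_) ?_)
    · exact mul_le_mul_of_nonneg_left (hC t) hu0
    · rw [norm_smul]
      exact mul_le_mul_of_nonneg_left (hC t) (norm_nonneg _)
  have h4 := norm_deriv_le_of_bounded (fun t => (hψ.1 t).hasDerivAt) h2 hC h3
  refine ⟨max C (k * (C + C + (u' * C + ‖z‖ * C) + w' * C)), fun t =>
    max_le_max (hC t) ((hk _).trans (mul_le_mul_of_nonneg_left ?_ hk0))⟩
  exact (norm_add_le _ _).trans (add_le_add (h4 t)
    ((hw' t _).trans (mul_le_mul_of_nonneg_left (hC t) hw0)))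

end

end Bogoyavlenskij

namespace Bogoyavlenskij
open Filter Topology Matrix

noncomputable section

/-! ### Invariant subspaces without Jordan blocks -/

section LinearAlgebra

variable {V : Type*} [AddCommGroup V] [Module ℂ V] [FiniteDimensional ℂ V]

/-- An endomorphism without Jordan blocks of size two is diagonalizable. -/
theorem iSup_eigenspace_eq_top_of_no_jordan (g : Module.End ℂ V)
    (hg : ∀ (μ : ℂ) (v : V), g (g v - μ • v) = μ • (g v - μ • v) → g v = μ • v) :
    ⨆ μ, g.eigenspace μ = ⊤ := by
  rw [eq_top_iff, ← Module.End.iSup_maxGenEigenspace_eq_top g]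
  refine iSup_mono fun μ v hv => ?_
  rw [Module.End.mem_maxGenEigenspace] at hv
  obtain ⟨k, hk⟩ := hv
  rw [Module.End.mem_eigenspace_iff]
  set n : Module.End ℂ V := g - μ • 1 with hn
  have hnv : ∀ v, n v = g v - μ • v := fun v => by
    simp [hn]
  have step : ∀ w, n (n w) = 0 → n w = 0 := fun w hw => by
    have h1 := hg μ w
    rw [hnv, hnv, sub_eq_zero] at hw
    rw [hnv, h1 hw, sub_self]
  have all : ∀ k w, (n ^ (k + 1)) w = 0 → n w = 0 := by
    intro k
    induction k with
    | zero => intro w hw; simpa using hw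
    | succ k ih =>
      intro w hw
      refine step w (ih (n w) ?_)
      rwa [pow_succ, Module.End.mul_apply] at hw
  have h0 : n v = 0 := all k v (by rw [pow_succ', Module.End.mul_apply, hk, map_zero])
  rwa [hnv, sub_eq_zero] at h0

/-- The dimension of an invariant subspace without Jordan blocks that contains exactly the
eigenvectors with eigenvalue in `S`. -/
theorem finrank_eq_finsum_eigenspace (f : Module.End ℂ V) (K : Submodule ℂ V) (S : Set ℂ)
    (hK : ∀ v ∈ K, f v ∈ K) (hS : ∀ μ ∈ S, f.eigenspace μ ≤ K)
    (hKS : ∀ μ : ℂ, ∀ v ∈ K, v ≠ 0 → f v = μ • v → μ ∈ S)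
    (hJ : ∀ μ : ℂ, ∀ v ∈ K, f (f v - μ • v) = μ • (f v - μ • v) → f v = μ • v) :
    Module.finrank ℂ K = ∑ᶠ μ ∈ S, Module.finrank ℂ (f.eigenspace μ) := by
  classical
  set g : Module.End ℂ K := f.restrict hK with hgdef
  have hg : ∀ v : K, ((g v : K) : V) = f v := fun v => rfl
  have htop : ⨆ μ, g.eigenspace μ = ⊤ := by
    refine iSup_eigenspace_eq_top_of_no_jordan g fun μ v hv => ?_
    apply Subtype.ext
    have := congrArg (Subtype.val) hv
    exact hJ μ v v.2 this
  have heig : ∀ μ ∈ S, Module.finrank ℂ (g.eigenspace μ) = Module.finrank ℂ (f.eigenspace μ) := by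
    intro μ hμ
    have e : (g.eigenspace μ).map K.subtype = f.eigenspace μ := by
      ext v
      constructor
      · rintro ⟨w, hw, rfl⟩
        have hw' := Module.End.mem_eigenspace_iff.1 hw
        exact Module.End.mem_eigenspace_iff.2 (congrArg Subtype.val hw')
      · intro hv
        refine ⟨⟨v, hS μ hμ hv⟩, ?_, rfl⟩
        exact Module.End.mem_eigenspace_iff.2 (Subtype.ext (Module.End.mem_eigenspace_iff.1 hv))
    rw [← e]
    exact (LinearEquiv.finrank_eq (Submodule.equivMapOfInjective K.subtype
      K.injective_subtype _))
  have hbot : ∀ μ, μ ∉ S → g.eigenspace μ = ⊥ := by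
    intro μ hμ
    rw [eq_bot_iff]
    intro v hv
    by_contra hne
    refine hμ (hKS μ v v.2 (fun h => hne ?_) ?_)
    · exact (Submodule.mem_bot ℂ).2 (Subtype.ext h)
    · exact congrArg Subtype.val (Module.End.mem_eigenspace_iff.1 hv)
  have hint : DirectSum.IsInternal fun μ : g.Eigenvalues => g.eigenspace μ := by
    refine DirectSum.isInternal_submodule_of_iSupIndep_of_iSup_eq_top
      (g.eigenspaces_iSupIndep.comp Subtype.val_injective) ?_
    rw [eq_top_iff, ← htop]
    refine iSup_le fun μ => ?_
    by_cases hμ : g.HasEigenvalue μ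
    · exact le_iSup (fun μ : g.Eigenvalues => g.eigenspace μ) ⟨μ, hμ⟩
    · rw [Module.End.hasEigenvalue_iff, not_not] at hμ
      rw [hμ]
      exact bot_le
  have hsum : Module.finrank ℂ K = ∑ μ : g.Eigenvalues, Module.finrank ℂ (g.eigenspace μ) := by
    rw [← (LinearEquiv.ofBijective (DirectSum.coeLinearMap fun μ : g.Eigenvalues =>
      g.eigenspace μ) hint).finrank_eq, Module.finrank_directSum]
  have hmem : ∀ μ : g.Eigenvalues, (μ : ℂ) ∈ S := fun μ => by
    by_contra h
    exact (Module.End.hasEigenvalue_iff.1 μ.2) (hbot _ h)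
  let ev : g.Eigenvalues → ℂ := Subtype.val
  have hinj : Function.Injective ev := Subtype.val_injective
  rw [hsum, finsum_mem_eq_sum_of_inter_support_eq
    (t := Finset.univ.image ev) _ ?_]
  · rw [Finset.sum_image fun μ _ ν _ h => hinj h]
    exact Finset.sum_congr rfl fun μ _ => heig μ (hmem μ)
  · ext μ
    simp only [Set.mem_inter_iff, Function.mem_support, Finset.coe_image, Finset.coe_univ,
      Set.image_univ, Set.mem_range]
    refine and_congr_left fun hne => ⟨fun hμ => ?_, ?_⟩
    · have hev : g.HasEigenvalue μ := by
        rw [Module.End.hasEigenvalue_iff]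
        intro h
        rw [← heig μ hμ, h, finrank_bot] at hne
        exact hne rfl
      exact ⟨⟨μ, hev⟩, rfl⟩
    · rintro ⟨ν, rfl⟩
      exact hmem ν

end LinearAlgebra

/-! ### The quadratic pencil -/

section Pencil

variable {d : ℕ} {J : Fin d → ℝ} {M P : RMat d} {μ z : ℂ}

/-- The action of the pencil `μ² J² - μ M - P + z` on `ℂ^d`. -/
def pencilAct (J : Fin d → ℝ) (M P : RMat d) (μ z : ℂ) (v : Vec d) : Vec d :=
  μ ^ 2 • act (diagonal J) (act (diagonal J) v) - μ • act M v - act P v + z • v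

theorem toLin'_pencil (v : Vec d) :
    Matrix.toLin' (pencil J M P μ z) v.ofLp = (pencilAct J M P μ z v).ofLp := by
  have e : ∀ A : RMat d, (A.map fun a : ℝ => (a : ℂ)).mulVec v.ofLp = (act A v).ofLp :=
    fun A => rfl
  rw [pencilAct, ← act_mul, ← sq, pencil, Matrix.toLin'_apply]
  simp only [Matrix.add_mulVec, Matrix.sub_mulVec, Matrix.smul_mulVec, e, Matrix.one_mulVec,
    WithLp.ofLp_add, WithLp.ofLp_sub, WithLp.ofLp_smul]

theorem det_pencil_eq_zero_iff :
    (pencil J M P μ z).det = 0 ↔ ∃ v : Vec d, v ≠ 0 ∧ pencilAct J M P μ z v = 0 := by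
  rw [← Matrix.exists_mulVec_eq_zero_iff]
  constructor
  · rintro ⟨v, hv, h⟩
    refine ⟨WithLp.toLp 2 v, fun h0 => hv (congrArg WithLp.ofLp h0), ?_⟩
    apply WithLp.ofLp_injective
    rw [← toLin'_pencil]
    exact h
  · rintro ⟨v, hv, h⟩
    refine ⟨v.ofLp, fun h0 => hv (WithLp.ofLp_injective _ h0), ?_⟩
    rw [← Matrix.toLin'_apply, toLin'_pencil, h]
    rfl

/-- Eigenvectors of the companion matrix. -/
theorem companion_eq_smul_iff (hJ : ∀ i, 0 < J i) (v : Vec d × Vec d) :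
    companion J M P z v = μ • v ↔ v.2 = μ • v.1 ∧ pencilAct J M P μ z v.1 = 0 := by
  obtain ⟨a, b⟩ := v
  rw [companion_apply, Prod.smul_mk, Prod.mk.injEq]
  refine and_congr_right fun hb => ?_
  subst hb
  rw [pencilAct]
  constructor
  · intro h
    have h1 := congrArg (fun u => act (diagonal J) (act (diagonal J) u)) h
    simp only [act_diag_inv hJ, map_smul] at h1
    linear_combination (norm := module) -h1
  · intro h
    have h1 : act M (μ • a) + (act P a - z • a)
        = act (diagonal J) (act (diagonal J) (μ • μ • a)) := by
      simp only [map_smul]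
      linear_combination (norm := module) -h
    rw [h1, act_inv_diag hJ, act_inv_diag hJ]

theorem finrank_eigenspace_companion (hJ : ∀ i, 0 < J i) :
    Module.finrank ℂ (Module.End.eigenspace (companion J M P z) μ) =
      Module.finrank ℂ (LinearMap.ker (Matrix.toLin' (pencil J M P μ z))) := by
  have hk : ∀ v : Vec d, v.ofLp ∈ LinearMap.ker (Matrix.toLin' (pencil J M P μ z)) ↔
      pencilAct J M P μ z v = 0 := fun v => by
    rw [LinearMap.mem_ker, toLin'_pencil]
    exact ⟨fun h => WithLp.ofLp_injective _ h, fun h => by rw [h]; rfl⟩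
  have hm : ∀ v, v ∈ Module.End.eigenspace (companion J M P z) μ ↔
      v.2 = μ • v.1 ∧ pencilAct J M P μ z v.1 = 0 := fun v => by
    rw [Module.End.mem_eigenspace_iff, companion_eq_smul_iff hJ]
  let e : Module.End.eigenspace (companion J M P z) μ ≃ₗ[ℂ]
      LinearMap.ker (Matrix.toLin' (pencil J M P μ z)) :=
    { toFun := fun v => ⟨v.1.1.ofLp, (hk _).2 ((hm _).1 v.2).2⟩
      map_add' := fun _ _ => rfl
      map_smul' := fun _ _ => rfl
      invFun := fun w => ⟨(WithLp.toLp 2 w.1, μ • WithLp.toLp 2 w.1),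
        (hm _).2 ⟨rfl, (hk _).1 w.2⟩⟩
      left_inv := fun v => Subtype.ext (Prod.ext rfl ((hm _).1 v.2).1.symm)
      right_inv := fun _ => rfl }
  exact e.finrank_eq

theorem inner_act_of_skew {A : RMat d} (hA : Aᵀ = -A) (v : Vec d) :
    (inner ℂ v (act A v)).re = 0 := by
  have h := congrArg Complex.re (inner_act A v v)
  have h2 := congrArg Complex.re (inner_conj_symm (𝕜 := ℂ) (act A v) v)
  rw [hA, act_neg, inner_neg_right, Complex.neg_re] at h
  rw [Complex.conj_re] at h2
  linarith

theorem inner_act_of_symm {A : RMat d} (hA : Aᵀ = A) (v : Vec d) :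
    (inner ℂ v (act A v)).im = 0 := by
  have h := congrArg Complex.im (inner_act A v v)
  have h2 := congrArg Complex.im (inner_conj_symm (𝕜 := ℂ) (act A v) v)
  rw [hA] at h
  rw [Complex.conj_im] at h2
  linarith

theorem inner_sq_diagonal (v : Vec d) :
    inner ℂ v (act (diagonal J) (act (diagonal J) v)) = ((‖act (diagonal J) v‖ ^ 2 : ℝ) : ℂ) := by
  have h := inner_act (diagonal J) v (act (diagonal J) v)
  rw [diagonal_transpose] at h
  rw [← h, inner_self_eq_norm_sq_to_K]
  norm_cast

/-- Pairing the pencil with a vector gives a quadratic polynomial in `μ` whose coefficients are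
real up to the factor `i` of the linear one. -/
theorem exists_inner_pencilAct (hM : Mᵀ = -M) (hP : Pᵀ = P) (v : Vec d) :
    ∃ b : ℝ, inner ℂ v (act M v) = b * Complex.I ∧ ∀ μ z : ℂ,
      inner ℂ v (pencilAct J M P μ z v) = μ ^ 2 * (‖act (diagonal J) v‖ ^ 2 : ℝ)
        - μ * (b * Complex.I) - ((inner ℂ v (act P v)).re : ℝ) + z * (‖v‖ ^ 2 : ℝ) := by
  have e1 : inner ℂ v (act M v) = (inner ℂ v (act M v)).im * Complex.I := by
    apply Complex.ext <;> simp [inner_act_of_skew hM]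
  have e2 : inner ℂ v (act P v) = ((inner ℂ v (act P v)).re : ℝ) := by
    apply Complex.ext <;> simp [inner_act_of_symm hP]
  refine ⟨_, e1, fun μ z => ?_⟩
  rw [← e1, ← e2, pencilAct, inner_add_right, inner_sub_right, inner_sub_right, inner_smul_right,
    inner_smul_right, inner_smul_right, inner_sq_diagonal, inner_self_eq_norm_sq_to_K]
  norm_cast

/-- On the real curve the reality of `z` follows from `μ` being imaginary. -/
theorem im_eq_zero_of_pencilAct (hM : Mᵀ = -M) (hP : Pᵀ = P) (hμ : μ.re = 0) {v : Vec d}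
    (hv : v ≠ 0) (h : pencilAct J M P μ z v = 0) : z.im = 0 := by
  obtain ⟨b, -, hb⟩ := exists_inner_pencilAct (J := J) hM hP v
  have h1 := hb μ z
  rw [h, inner_zero_right] at h1
  have h2 := congrArg Complex.im h1
  simp only [Complex.zero_im, sq μ, Complex.add_im, Complex.sub_im, Complex.mul_im,
    Complex.mul_re, Complex.ofReal_re, Complex.ofReal_im, Complex.I_re, Complex.I_im, hμ] at h2
  have h3 : z.im * ‖v‖ ^ 2 = 0 := by linarith
  exact (mul_eq_zero.1 h3).resolve_right (pow_ne_zero _ (norm_ne_zero_iff.2 hv))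

theorem act_diagonal_ne_zero (hJ : ∀ i, 0 < J i) {v : Vec d} (hv : v ≠ 0) :
    act (diagonal J) v ≠ 0 := fun h => hv (by
  rw [← act_inv_diag hJ v, h, map_zero])

/-- Above the spectrum of `P` the pencil is hyperbolic: its eigenvalues are imaginary. -/
theorem re_eq_zero_of_pencilAct (hJ : ∀ i, 0 < J i) (hM : Mᵀ = -M) (hP : Pᵀ = P) {lam : ℝ}
    (hlam : ∀ v : Vec d, v ≠ 0 → (inner ℂ v (act P v)).re < lam * ‖v‖ ^ 2) {v : Vec d}
    (hv : v ≠ 0) (h : pencilAct J M P μ lam v = 0) : μ.re = 0 := by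
  obtain ⟨b, -, hb⟩ := exists_inner_pencilAct (J := J) hM hP v
  have h1 := hb μ lam
  rw [h, inner_zero_right] at h1
  have h2 := congrArg Complex.im h1
  have h3 := congrArg Complex.re h1
  simp only [Complex.zero_im, Complex.zero_re, sq μ, Complex.add_im, Complex.sub_im,
    Complex.mul_im, Complex.add_re, Complex.sub_re,
    Complex.mul_re, Complex.ofReal_re, Complex.ofReal_im, Complex.I_re, Complex.I_im] at h2 h3
  have ha : 0 < ‖act (diagonal J) v‖ ^ 2 := by
    have := norm_pos_iff.2 (act_diagonal_ne_zero hJ hv)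
    positivity
  have hc := hlam v hv
  set a := ‖act (diagonal J) v‖ ^ 2
  set p := (inner ℂ v (act P v)).re
  set n := ‖v‖ ^ 2
  have h4 : μ.re * (2 * a * μ.im - b) = 0 := by linarith
  rcases mul_eq_zero.1 h4 with h5 | h5
  · exact h5
  · exfalso
    have h6 : b = 2 * a * μ.im := by linarith
    rw [h6] at h3
    nlinarith [mul_nonneg ha.le (sq_nonneg μ.re), mul_nonneg ha.le (sq_nonneg μ.im)]

/-- For imaginary `μ` and real `lam` the pencil is Hermitian. -/
theorem inner_pencilAct_swap (hM : Mᵀ = -M) (hP : Pᵀ = P) (hμ : μ.re = 0) (lam : ℝ)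
    (v w : Vec d) :
    inner ℂ w (pencilAct J M P μ lam v) = inner ℂ (pencilAct J M P μ lam w) v := by
  have hμc : (starRingEnd ℂ) μ = -μ := by
    apply Complex.ext <;> simp [hμ]
  have h1 := inner_act M w v
  have h2 := inner_act P w v
  have h3 := inner_act (diagonal J) (act (diagonal J) w) v
  have h4 := inner_act (diagonal J) w (act (diagonal J) v)
  rw [diagonal_transpose] at h3 h4
  rw [hM, act_neg, inner_neg_right] at h1
  rw [hP] at h2
  simp only [pencilAct, inner_add_right, inner_sub_right, inner_smul_right, inner_add_left,
    inner_sub_left, inner_smul_left, map_pow, hμc, h1, h2, h3, h4, Complex.conj_ofReal]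
  ring

/-- Above the spectrum of `P` the companion matrix has no Jordan blocks. -/
theorem companion_no_jordan (hJ : ∀ i, 0 < J i) (hM : Mᵀ = -M) (hP : Pᵀ = P) {lam : ℝ}
    (hlam : ∀ v : Vec d, v ≠ 0 → (inner ℂ v (act P v)).re < lam * ‖v‖ ^ 2)
    (μ : ℂ) (v : Vec d × Vec d)
    (h : companion J M P lam (companion J M P lam v - μ • v) =
      μ • (companion J M P lam v - μ • v)) : companion J M P lam v = μ • v := by
  obtain ⟨a, b⟩ := v
  have hw := (companion_eq_smul_iff hJ _).1 h
  simp only [companion_apply, Prod.smul_mk, Prod.mk_sub_mk] at hw ⊢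
  obtain ⟨h1, h2⟩ := hw
  by_cases hne : b - μ • a = 0
  · rw [hne, smul_zero] at h1
    rw [sub_eq_zero] at h1 hne
    rw [Prod.mk.injEq]
    exact ⟨hne, h1⟩
  exfalso
  have hμ := re_eq_zero_of_pencilAct hJ hM hP hlam hne h2
  set w := b - μ • a with hw
  have hb : b = μ • a + w := by rw [hw]; abel
  have h4 : act M b + (act P a - (lam : ℂ) • a)
      = act (diagonal J) (act (diagonal J) (μ • b + μ • w)) := by
    have := congrArg (fun u => act (diagonal J) (act (diagonal J) (u + μ • b))) h1
    simp only [sub_add_cancel, act_diag_inv hJ] at this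
    rw [this, add_comm]
  have h5 : pencilAct J M P μ lam a
      + ((2 * μ) • act (diagonal J) (act (diagonal J) w) - act M w) = 0 := by
    rw [hb] at h4
    simp only [map_add, map_smul, smul_add] at h4
    rw [pencilAct]
    linear_combination (norm := module) -h4
  obtain ⟨c, hc1, hc⟩ := exists_inner_pencilAct (J := J) hM hP w
  have h6 := congrArg (inner ℂ w) h5
  rw [inner_add_right, inner_pencilAct_swap hM hP hμ, h2, inner_zero_left, zero_add,
    inner_sub_right, inner_smul_right, inner_sq_diagonal, hc1, inner_zero_right] at h6
  have h7 := hc μ lam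
  rw [h2, inner_zero_right] at h7
  have h8 := congrArg Complex.im h6
  have h9 := congrArg Complex.re h7
  simp only [Complex.zero_im, Complex.zero_re, sq μ, Complex.sub_im,
    Complex.mul_im, Complex.add_re, Complex.sub_re, Complex.re_ofNat, Complex.im_ofNat,
    Complex.mul_re, Complex.ofReal_re, Complex.ofReal_im, Complex.I_re, Complex.I_im, hμ]
    at h8 h9
  have hlt := hlam w hne
  have ha : 0 ≤ ‖act (diagonal J) w‖ ^ 2 := sq_nonneg _
  set A := ‖act (diagonal J) w‖ ^ 2
  have hcA : c = 2 * μ.im * A := by linarith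
  rw [hcA] at h9
  nlinarith [mul_nonneg ha (sq_nonneg μ.im)]

/-- A real number above the eigenvalues of the symmetric matrix `P` bounds its quadratic form on
`ℂ^d`. -/
theorem inner_act_lt_of_spectrum_lt (hP : Pᵀ = P) {lam : ℝ} (hlam : ∀ ν ∈ spectrum ℝ P, ν < lam)
    {v : Vec d} (hv : v ≠ 0) : (inner ℂ v (act P v)).re < lam * ‖v‖ ^ 2 := by
  have hPh : P.IsHermitian := by
    rw [Matrix.IsHermitian, conjTranspose_eq_transpose_of_trivial, hP]
  have hAh : (algebraMap ℝ (RMat d) lam - P).IsHermitian := by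
    rw [Matrix.IsHermitian, conjTranspose_eq_transpose_of_trivial, transpose_sub, hP,
      Matrix.algebraMap_eq_diagonal, diagonal_transpose]
  have hpos : (algebraMap ℝ (RMat d) lam - P).PosDef := by
    rw [hAh.posDef_iff_eigenvalues_pos]
    intro i
    have hi := hAh.eigenvalues_mem_spectrum_real i
    have : lam - hAh.eigenvalues i ∈ spectrum ℝ P := by
      rw [spectrum.mem_iff] at hi ⊢
      have e : algebraMap ℝ (RMat d) (lam - hAh.eigenvalues i) - P =
          -(algebraMap ℝ (RMat d) (hAh.eigenvalues i) - (algebraMap ℝ (RMat d) lam - P)) := by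
        rw [map_sub]
        abel
      rwa [e, IsUnit.neg_iff]
    linarith [hlam _ this]
  -- split `v` into its real and imaginary parts
  set x : Fin d → ℝ := fun i => (v i).re with hx
  set y : Fin d → ℝ := fun i => (v i).im with hy
  have hq : ∀ A : RMat d, (inner ℂ v (act A v)).re = x ⬝ᵥ (A *ᵥ x) + y ⬝ᵥ (A *ᵥ y) := by
    intro A
    simp only [PiLp.inner_apply, act_apply, RCLike.inner_apply, Complex.re_sum, dotProduct,
      mulVec, Finset.mul_sum, Finset.sum_mul, ← Finset.sum_add_distrib]
    refine Finset.sum_congr rfl fun i _ => Finset.sum_congr rfl fun j _ => ?_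
    simp only [Complex.mul_re, Complex.mul_im, Complex.ofReal_re, Complex.ofReal_im,
      Complex.conj_re, Complex.conj_im, hx, hy]
    ring
  have h0 : 0 < (inner ℂ v (act (algebraMap ℝ (RMat d) lam - P) v)).re := by
    rw [hq]
    by_cases hx0 : x = 0
    · have hy0 : y ≠ 0 := fun hy0 => hv (by
        ext i
        exact Complex.ext (congrFun hx0 i) (congrFun hy0 i))
      rw [hx0, zero_dotProduct, zero_add]
      simpa using hpos.dotProduct_mulVec_pos hy0
    · have h1 := hpos.dotProduct_mulVec_pos hx0
      have h2 := hpos.posSemidef.dotProduct_mulVec_nonneg y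
      simp only [star_trivial] at h1 h2
      linarith
  have e : act (algebraMap ℝ (RMat d) lam) v = (lam : ℂ) • v := by
    ext i
    rw [Matrix.algebraMap_eq_diagonal, act_diagonal_apply]
    rfl
  rw [act_sub, inner_sub_right, e, inner_smul_right, inner_self_eq_norm_sq_to_K,
    Complex.sub_re] at h0
  have e2 : ((lam : ℂ) * ((‖v‖ : ℝ) : ℂ) ^ 2).re = lam * ‖v‖ ^ 2 := by
    norm_cast
  have e3 := h0
  simp only [Complex.coe_algebraMap] at e3
  rw [e2] at e3
  linarith

end Pencil

end

end Bogoyavlenskij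

namespace Bogoyavlenskij
open Filter Topology Matrix

noncomputable section

variable {d : ℕ}

/-! ### Growth of joint eigenfunctions -/

section Growth

variable {J : Fin d → ℝ} {μ : ℂ}

theorem not_bounded_of_deriv_ge {f f' : ℝ → ℝ} (hf : ∀ t, HasDerivAt f (f' t) t) {t₀ k C : ℝ}
    (hk : 0 < k) (h : ∀ t, t₀ ≤ t → k ≤ f' t) (hC : ∀ t, f t ≤ C) : False := by
  have hd : Differentiable ℝ f := fun t => (hf t).differentiableAt
  obtain ⟨T, hT⟩ : ∃ T : ℝ, C - f t₀ < k * T := by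
    refine ⟨(C - f t₀) / k + 1, ?_⟩
    rw [mul_add, mul_div_cancel₀ _ hk.ne']
    linarith
  have hT0 : 0 ≤ T := by
    by_contra hneg
    have := hC t₀
    nlinarith [not_le.1 hneg]
  have := (convex_Ici t₀).mul_sub_le_image_sub_of_le_deriv (f := f) hd.continuous.continuousOn
    hd.differentiableOn (C := k) (fun t ht => by
      rw [(hf t).deriv]
      exact h t (interior_subset ht)) t₀ (Set.mem_Ici.2 le_rfl) (t₀ + T)
      (Set.mem_Ici.2 (by linarith)) (by linarith)
  have h2 := hC (t₀ + T)
  rw [add_sub_cancel_left] at this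
  linarith

/-- The inner product of two solutions of `u' = (μ J - Ω) u`, with a source in one of them. -/
theorem hasDerivAt_inner_of_eigen {O : RMat d} (hO : Oᵀ = -O) {a g : ℝ → Vec d} {r : Vec d} {t : ℝ}
    (ha : HasDerivAt a (μ • act (diagonal J) (a t) + r - act O (a t)) t)
    (hg : HasDerivAt g (μ • act (diagonal J) (g t) - act O (g t)) t) :
    HasDerivAt (fun s => inner ℂ (a s) (g s))
      (2 * μ.re * inner ℂ (act (diagonal J) (a t)) (g t) + inner ℂ r (g t)) t := by
  refine (ha.inner ℂ hg).congr_deriv ?_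
  have h1 := inner_act O (a t) (g t)
  have h2 := inner_act (diagonal J) (a t) (g t)
  have h3 : (starRingEnd ℂ) μ + μ = 2 * μ.re := by
    rw [add_comm, Complex.add_conj]
    push_cast
    ring
  rw [hO, act_neg, inner_neg_right] at h1
  rw [diagonal_transpose] at h2
  simp only [inner_sub_right, inner_sub_left, inner_add_left, inner_smul_left, inner_smul_right,
    h1, ← h2, ← h3]
  ring

theorem hasDerivAt_norm_sq_of_eigen {O : RMat d} (hO : Oᵀ = -O) {a : ℝ → Vec d} {t : ℝ}
    (ha : HasDerivAt a (μ • act (diagonal J) (a t) - act O (a t)) t) :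
    HasDerivAt (fun s => ‖a s‖ ^ 2)
      (2 * μ.re * (inner ℂ (act (diagonal J) (a t)) (a t)).re) t := by
  have h := hasDerivAt_inner_of_eigen (r := 0) hO (by rwa [add_zero]) ha
  have h2 := (Complex.reCLM.hasFDerivAt.comp_hasDerivAt t h)
  have e : (Complex.reCLM ∘ fun s => inner ℂ (a s) (a s)) = fun s => ‖a s‖ ^ 2 := by
    funext s
    simp only [Function.comp, Complex.reCLM_apply]
    rw [inner_self_eq_norm_sq_to_K]
    norm_cast
  rw [e] at h2
  refine h2.congr_deriv ?_
  rw [inner_zero_left, add_zero, inner_act_diagonal, Complex.reCLM_apply]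
  norm_cast

variable {Ω : ℝ → RMat d}

theorem norm_eq_of_re_eq_zero (hΩ : ∀ t, (Ω t)ᵀ = -Ω t) {a : ℝ → Vec d}
    (ha : ∀ t, HasDerivAt a (μ • act (diagonal J) (a t) - act (Ω t) (a t)) t) (hμ : μ.re = 0)
    (s t : ℝ) : ‖a s‖ = ‖a t‖ := by
  have h : ∀ t, HasDerivAt (fun s => ‖a s‖ ^ 2) 0 t := fun t => by
    simpa [hμ] using hasDerivAt_norm_sq_of_eigen (hΩ t) (ha t)
  have := is_const_of_deriv_eq_zero (fun t => (h t).differentiableAt) (fun t => (h t).deriv) s t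
  exact (pow_left_inj₀ (norm_nonneg _) (norm_nonneg _) two_ne_zero).1 this

theorem monotone_norm_sq (hJ : ∀ i, 0 < J i) (hΩ : ∀ t, (Ω t)ᵀ = -Ω t) {a : ℝ → Vec d}
    (ha : ∀ t, HasDerivAt a (μ • act (diagonal J) (a t) - act (Ω t) (a t)) t) (hμ : 0 ≤ μ.re) :
    Monotone fun s => ‖a s‖ ^ 2 := by
  obtain ⟨c, hc, hcJ⟩ := exists_le_inner_act_diagonal hJ
  have h := fun t => hasDerivAt_norm_sq_of_eigen (hΩ t) (ha t)
  refine monotone_of_deriv_nonneg (fun t => (h t).differentiableAt) fun t => ?_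
  rw [(h t).deriv]
  have := (mul_nonneg hc.le (sq_nonneg _)).trans (hcJ (a t))
  positivity

/-- Reflection of the line exchanges `μ` and `-μ`. -/
theorem hasDerivAt_reflect {a : ℝ → Vec d}
    (ha : ∀ t, HasDerivAt a (μ • act (diagonal J) (a t) - act (Ω t) (a t)) t) (t : ℝ) :
    HasDerivAt (fun s => a (-s))
      ((-μ) • act (diagonal J) (a (-t)) - act (-Ω (-t)) (a (-t))) t := by
  have h := (ha (-t)).scomp t (hasDerivAt_neg t)
  refine h.congr_deriv ?_
  rw [act_neg]
  module

theorem re_nonpos_of_bounded (hJ : ∀ i, 0 < J i) (hΩ : ∀ t, (Ω t)ᵀ = -Ω t) {a : ℝ → Vec d}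
    (ha : ∀ t, HasDerivAt a (μ • act (diagonal J) (a t) - act (Ω t) (a t)) t)
    (hb : IsBoundedFun a) {t₀ : ℝ} (h0 : a t₀ ≠ 0) : μ.re ≤ 0 := by
  by_contra! hμ
  obtain ⟨c, hc, hcJ⟩ := exists_le_inner_act_diagonal hJ
  obtain ⟨C, hC⟩ := hb
  have hn : 0 < ‖a t₀‖ := norm_pos_iff.2 h0
  refine not_bounded_of_deriv_ge (fun t => hasDerivAt_norm_sq_of_eigen (hΩ t) (ha t))
    (t₀ := t₀) (k := 2 * μ.re * (c * ‖a t₀‖ ^ 2)) (C := C ^ 2) (by positivity) (fun t ht => ?_)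
    fun t => pow_le_pow_left₀ (norm_nonneg _) (hC t) 2
  have hm := monotone_norm_sq hJ hΩ ha hμ.le ht
  exact mul_le_mul_of_nonneg_left ((mul_le_mul_of_nonneg_left hm hc.le).trans (hcJ _))
    (by positivity)

/-- A bounded solution of `u' = (μ J - Ω) u` has imaginary `μ`. -/
theorem re_eq_zero_of_bounded (hJ : ∀ i, 0 < J i) (hΩ : ∀ t, (Ω t)ᵀ = -Ω t) {a : ℝ → Vec d}
    (ha : ∀ t, HasDerivAt a (μ • act (diagonal J) (a t) - act (Ω t) (a t)) t)
    (hb : IsBoundedFun a) {t₀ : ℝ} (h0 : a t₀ ≠ 0) : μ.re = 0 := by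
  refine le_antisymm (re_nonpos_of_bounded hJ hΩ ha hb h0) ?_
  have h := re_nonpos_of_bounded (μ := -μ) (Ω := fun s => -Ω (-s)) (a := fun s => a (-s)) hJ
    (fun t => by rw [transpose_neg, hΩ]) (hasDerivAt_reflect ha)
    (by obtain ⟨C, hC⟩ := hb; exact ⟨C, fun t => hC _⟩) (t₀ := -t₀) (by rwa [neg_neg])
  rw [Complex.neg_re] at h
  linarith

theorem eq_zero_of_integrable_of_re_nonneg (hJ : ∀ i, 0 < J i) (hΩ : ∀ t, (Ω t)ᵀ = -Ω t)
    {a : ℝ → Vec d}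
    (ha : ∀ t, HasDerivAt a (μ • act (diagonal J) (a t) - act (Ω t) (a t)) t)
    (hi : Integrable (fun t => ‖a t‖ ^ 2) volume) (hμ : 0 ≤ μ.re) (t₀ : ℝ) : a t₀ = 0 := by
  by_contra h0
  have hm := monotone_norm_sq hJ hΩ ha hμ
  have h1 : IntegrableOn (fun _ : ℝ => ‖a t₀‖ ^ 2) (Set.Ici t₀) volume := by
    refine Integrable.mono' hi.integrableOn aestronglyMeasurable_const ?_
    refine (ae_restrict_iff' measurableSet_Ici).2 (Eventually.of_forall fun t ht => ?_)
    rw [Real.norm_of_nonneg (sq_nonneg _)]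
    exact hm ht
  rw [integrableOn_const_iff] at h1
  simp [h0] at h1

/-- No nonzero solution of `u' = (μ J - Ω) u` is square integrable. -/
theorem eq_zero_of_integrable (hJ : ∀ i, 0 < J i) (hΩ : ∀ t, (Ω t)ᵀ = -Ω t) {a : ℝ → Vec d}
    (ha : ∀ t, HasDerivAt a (μ • act (diagonal J) (a t) - act (Ω t) (a t)) t)
    (hi : Integrable (fun t => ‖a t‖ ^ 2) volume) (t₀ : ℝ) : a t₀ = 0 := by
  rcases le_total 0 μ.re with hμ | hμ
  · exact eq_zero_of_integrable_of_re_nonneg hJ hΩ ha hi hμ t₀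
  · have h := eq_zero_of_integrable_of_re_nonneg (μ := -μ) (Ω := fun s => -Ω (-s))
      (a := fun s => a (-s)) hJ (fun t => by rw [transpose_neg, hΩ]) (hasDerivAt_reflect ha)
      hi.comp_neg (by rw [Complex.neg_re]; linarith) (-t₀)
    rwa [neg_neg] at h

/-- A Jordan block of size two produces linear growth. -/
theorem eq_zero_of_jordan_of_bounded (hJ : ∀ i, 0 < J i) (hΩ : ∀ t, (Ω t)ᵀ = -Ω t)
    {a g : ℝ → Vec d}
    (ha : ∀ t, HasDerivAt a
      (μ • act (diagonal J) (a t) + act (diagonal J) (g t) - act (Ω t) (a t)) t)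
    (hg : ∀ t, HasDerivAt g (μ • act (diagonal J) (g t) - act (Ω t) (g t)) t)
    (hab : IsBoundedFun a) (hgb : IsBoundedFun g) (t₀ : ℝ) : g t₀ = 0 := by
  by_contra h0
  have hμ := re_eq_zero_of_bounded hJ hΩ hg hgb h0
  obtain ⟨c, hc, hcJ⟩ := exists_le_inner_act_diagonal hJ
  obtain ⟨A, hA⟩ := hab
  have hn := norm_eq_of_re_eq_zero hΩ hg hμ
  have hpos : 0 < ‖g t₀‖ := norm_pos_iff.2 h0
  have hd : ∀ t, HasDerivAt (fun s => (inner ℂ (a s) (g s)).re)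
      (inner ℂ (act (diagonal J) (g t)) (g t)).re t := fun t => by
    have h := Complex.reCLM.hasFDerivAt.comp_hasDerivAt t
      (hasDerivAt_inner_of_eigen (hΩ t) (ha t) (hg t))
    refine h.congr_deriv ?_
    rw [hμ, Complex.reCLM_apply]
    simp
  refine not_bounded_of_deriv_ge hd (t₀ := 0) (k := c * ‖g t₀‖ ^ 2) (C := A * ‖g t₀‖)
    (by positivity) (fun t _ => ?_) fun t => ?_
  · rw [← hn t t₀]
    exact hcJ _
  · refine (Complex.re_le_norm _).trans ((norm_inner_le_norm _ _).trans ?_)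
    rw [hn t t₀]
    exact mul_le_mul_of_nonneg_right (hA t) (norm_nonneg _)

end Growth

end

end Bogoyavlenskij

namespace Bogoyavlenskij
open Filter Topology Matrix

noncomputable section

variable {d : ℕ}

/-! ### Joint eigenfunctions and bounded solutions -/

section BoundedSolutions

variable {J : Fin d → ℝ} {Ω M P : ℝ → RMat d} {μ z : ℂ}

/-- The eigenvalue equation for the companion matrix propagates along the first order system. -/
theorem IsFlow.companion_eq_smul (hJ : ∀ i, 0 < J i) (h : IsTopSolution J Ω M P)
    {Φ : ℝ → Vec d × Vec d} (hΦ : IsFlow J Ω M P z Φ) {t₀ : ℝ}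
    (h0 : companion J (M t₀) (P t₀) z (Φ t₀) = μ • Φ t₀) (t : ℝ) :
    companion J (M t) (P t) z (Φ t) = μ • Φ t :=
  congrFun ((hΦ.map_companion hJ h).unique hJ h (hΦ.smul μ) h0) t

theorem IsFlow.hasDerivAt_fst_of_eigen {Φ : ℝ → Vec d × Vec d} (hΦ : IsFlow J Ω M P z Φ)
    (he : ∀ t, companion J (M t) (P t) z (Φ t) = μ • Φ t) (t : ℝ) :
    HasDerivAt (fun t => (Φ t).1) (μ • act (diagonal J) (Φ t).1 - act (Ω t) (Φ t).1) t := by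
  have h := hΦ.hasDerivAt_fst t
  have e : (Φ t).2 = μ • (Φ t).1 := congrArg Prod.fst (he t)
  rwa [e, map_smul] at h

theorem IsFlow.fst_ne_zero (hJ : ∀ i, 0 < J i) (h : IsTopSolution J Ω M P)
    {Φ : ℝ → Vec d × Vec d} (hΦ : IsFlow J Ω M P z Φ)
    (he : ∀ t, companion J (M t) (P t) z (Φ t) = μ • Φ t) {t₀ : ℝ} (h0 : Φ t₀ ≠ 0) (t : ℝ) :
    (Φ t).1 ≠ 0 := by
  intro h1
  have e : (Φ t).2 = μ • (Φ t).1 := congrArg Prod.fst (he t)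
  have h2 : Φ t = 0 := Prod.ext h1 (by rw [e, h1, smul_zero]; rfl)
  exact h0 (congrFun (hΦ.unique hJ h IsFlow.zero h2) t₀)

/-- Joint eigenfunctions are the first components of solutions of the first order system that are
eigenvectors of the companion matrix. -/
theorem isJointEigenfunction_iff (hJ : ∀ i, 0 < J i) (h : IsTopSolution J Ω M P)
    {ψ : ℝ → Vec d} :
    IsJointEigenfunction J Ω P μ z ψ ↔ ψ ≠ 0 ∧ IsSolution (topPotential Ω P) z ψ ∧
      ∀ t, companion J (M t) (P t) z (phase J Ω ψ t) = μ • phase J Ω ψ t := by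
  rw [IsJointEigenfunction]
  refine and_congr_right fun _ => and_congr_right fun hψ => ?_
  rw [inv_diagonal_eq hJ]
  have hΦ := hψ.isFlow_phase hJ h
  constructor
  · intro hA t
    have h1 := hΦ.map_companion hJ h
    have e1 : (fun t => (companion J (M t) (P t) z (phase J Ω ψ t)).1)
        = fun t => (μ • phase J Ω ψ t).1 := funext fun t => hA t
    have h2 := h1.phase_fst hJ
    rw [e1, (hΦ.smul μ).phase_fst hJ] at h2
    exact (congrFun h2 t).symm
  · intro hA t
    exact congrArg Prod.fst (hA t)

theorem mem_spectralCurve_iff (hJ : ∀ i, 0 < J i) (x : ℝ) :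
    (μ, z) ∈ spectralCurve J (M x) (P x) ↔
      ∃ v : Vec d × Vec d, v ≠ 0 ∧ companion J (M x) (P x) z v = μ • v := by
  change (pencil J (M x) (P x) μ z).det = 0 ↔ _
  rw [det_pencil_eq_zero_iff]
  constructor
  · rintro ⟨a, ha, hp⟩
    exact ⟨(a, μ • a), fun h0 => ha (congrArg Prod.fst h0),
      (companion_eq_smul_iff hJ _).2 ⟨rfl, hp⟩⟩
  · rintro ⟨v, hv, he⟩
    obtain ⟨h1, h2⟩ := (companion_eq_smul_iff hJ _).1 he
    refine ⟨v.1, fun h0 => hv (Prod.ext h0 ?_), h2⟩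
    rw [h1, h0, smul_zero]
    rfl

theorem mem_realCurve_iff (h : IsTopSolution J Ω M P) (x : ℝ) :
    (μ, z) ∈ realCurve J (M x) (P x) ↔ (μ, z) ∈ spectralCurve J (M x) (P x) ∧ μ.re = 0 := by
  have hstar : star μ = -μ ↔ μ.re = 0 := by
    constructor
    · intro h1
      have := congrArg Complex.re h1
      simp only [Complex.star_def, Complex.conj_re, Complex.neg_re] at this
      linarith
    · intro h1
      apply Complex.ext <;> simp [h1]
  constructor
  · rintro ⟨h1, h2, -⟩
    exact ⟨h1, hstar.1 h2⟩
  · rintro ⟨h1, h2⟩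
    refine ⟨h1, hstar.2 h2, ?_⟩
    obtain ⟨v, hv, hp⟩ := det_pencil_eq_zero_iff.1 h1
    have := im_eq_zero_of_pencilAct (h.momentum_skew x) (h.symm x) h2 hv hp
    exact Complex.conj_eq_iff_im.2 this

/-- An eigenvector of the companion matrix at one point extends to a joint eigenfunction. -/
theorem exists_isJointEigenfunction (hJ : ∀ i, 0 < J i) (h : IsTopSolution J Ω M P) {x : ℝ}
    {v : Vec d × Vec d} (hv : v ≠ 0) (he : companion J (M x) (P x) z v = μ • v) :
    ∃ Φ, IsFlow J Ω M P z Φ ∧ Φ x = v ∧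
      (∀ t, companion J (M t) (P t) z (Φ t) = μ • Φ t) ∧
      IsJointEigenfunction J Ω P μ z fun t => (Φ t).1 := by
  obtain ⟨Φ, hΦ, h0⟩ := exists_flow hJ h z x v
  have he' := hΦ.companion_eq_smul hJ h (t₀ := x) (μ := μ) (by rw [h0, he])
  refine ⟨Φ, hΦ, h0, he', (isJointEigenfunction_iff hJ h).2 ⟨fun hz => ?_,
    hΦ.isSolution_fst hJ h, fun t => ?_⟩⟩
  · exact hΦ.fst_ne_zero hJ h he' (t₀ := x) (by rwa [h0]) x (congrFun hz x)
  · rw [hΦ.phase_fst hJ]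
    exact he' t

/-- The Cauchy data of a joint eigenfunction are an eigenvector of the companion matrix. -/
theorem IsJointEigenfunction.phase_ne_zero (hJ : ∀ i, 0 < J i) (h : IsTopSolution J Ω M P)
    {ψ : ℝ → Vec d} (hψ : IsJointEigenfunction J Ω P μ z ψ) (x : ℝ) : phase J Ω ψ x ≠ 0 := by
  intro h0
  have := (hψ.2.1.isFlow_phase hJ h).unique hJ h IsFlow.zero h0
  exact hψ.1 (funext fun t => congrArg Prod.fst (congrFun this t))

theorem mem_spectralCurve_iff_exists (hJ : ∀ i, 0 < J i) (h : IsTopSolution J Ω M P) (x : ℝ) :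
    (μ, z) ∈ spectralCurve J (M x) (P x) ↔ ∃ ψ, IsJointEigenfunction J Ω P μ z ψ := by
  rw [mem_spectralCurve_iff hJ]
  constructor
  · rintro ⟨v, hv, he⟩
    obtain ⟨Φ, -, -, -, hψ⟩ := exists_isJointEigenfunction hJ h hv he
    exact ⟨_, hψ⟩
  · rintro ⟨ψ, hψ⟩
    exact ⟨_, hψ.phase_ne_zero hJ h x, ((isJointEigenfunction_iff hJ h).1 hψ).2.2 x⟩

/-- A joint eigenfunction is bounded exactly when `μ` is imaginary. -/
theorem IsJointEigenfunction.isBoundedFun_iff (hJ : ∀ i, 0 < J i) (h : IsTopSolution J Ω M P)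
    {ψ : ℝ → Vec d} (hψ : IsJointEigenfunction J Ω P μ z ψ) : IsBoundedFun ψ ↔ μ.re = 0 := by
  have he := ((isJointEigenfunction_iff hJ h).1 hψ).2.2
  have hΦ := hψ.2.1.isFlow_phase hJ h
  have hd := hΦ.hasDerivAt_fst_of_eigen he
  constructor
  · intro hb
    exact re_eq_zero_of_bounded hJ h.skew hd hb
      (hΦ.fst_ne_zero hJ h he (hψ.phase_ne_zero hJ h 0) 0)
  · intro hμ
    exact ⟨‖ψ 0‖, fun t => (norm_eq_of_re_eq_zero h.skew hd hμ t 0).le⟩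

theorem mem_realCurve_iff_exists (hJ : ∀ i, 0 < J i) (h : IsTopSolution J Ω M P) (x : ℝ) :
    (μ, z) ∈ realCurve J (M x) (P x) ↔
      ∃ ψ, IsJointEigenfunction J Ω P μ z ψ ∧ IsBoundedFun ψ := by
  rw [mem_realCurve_iff h, mem_spectralCurve_iff_exists hJ h]
  constructor
  · rintro ⟨⟨ψ, hψ⟩, hμ⟩
    exact ⟨ψ, hψ, (hψ.isBoundedFun_iff hJ h).2 hμ⟩
  · rintro ⟨ψ, hψ, hb⟩
    exact ⟨⟨ψ, hψ⟩, (hψ.isBoundedFun_iff hJ h).1 hb⟩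

variable (J Ω M P z) in
/-- The Cauchy data at `x` of the bounded solutions. -/
def boundedData (x : ℝ) : Submodule ℂ (Vec d × Vec d) where
  carrier := {v | ∃ Φ, IsFlow J Ω M P z Φ ∧ Φ x = v ∧ IsBoundedFun fun t => (Φ t).1}
  zero_mem' := ⟨fun _ => 0, IsFlow.zero, rfl, 0, fun t => by simp⟩
  add_mem' := by
    rintro _ _ ⟨Φ, hΦ, rfl, C, hC⟩ ⟨Ψ, hΨ, rfl, D, hD⟩
    exact ⟨_, hΦ.add hΨ, rfl, C + D, fun t => (norm_add_le _ _).trans (add_le_add (hC t) (hD t))⟩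
  smul_mem' := by
    rintro c _ ⟨Φ, hΦ, rfl, C, hC⟩
    refine ⟨_, hΦ.smul c, rfl, ‖c‖ * C, fun t => ?_⟩
    change ‖c • (Φ t).1‖ ≤ _
    rw [norm_smul]
    exact mul_le_mul_of_nonneg_left (hC t) (norm_nonneg c)

theorem IsFlow.isBoundedFun_snd (hJ : ∀ i, 0 < J i) (h : IsTopSolution J Ω M P)
    {Φ : ℝ → Vec d × Vec d} (hΦ : IsFlow J Ω M P z Φ) (hb : IsBoundedFun fun t => (Φ t).1) :
    IsBoundedFun fun t => (Φ t).2 := by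
  obtain ⟨C, hC⟩ := exists_norm_phase_le hJ h (hΦ.isSolution_fst hJ h) hb
  rw [hΦ.phase_fst hJ] at hC
  exact ⟨C, fun t => (le_max_right _ _).trans (hC t)⟩

theorem companion_mem_boundedData (hJ : ∀ i, 0 < J i) (h : IsTopSolution J Ω M P) (x : ℝ) :
    ∀ v ∈ boundedData J Ω M P z x, companion J (M x) (P x) z v ∈ boundedData J Ω M P z x := by
  rintro _ ⟨Φ, hΦ, rfl, hb⟩
  exact ⟨_, hΦ.map_companion hJ h, rfl, hΦ.isBoundedFun_snd hJ h hb⟩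

/-- Evaluation of Cauchy data on bounded solutions. -/
def evalData (J : Fin d → ℝ) (Ω P : ℝ → RMat d) (z : ℂ) (x : ℝ) :
    boundedSolutions (topPotential Ω P) z →ₗ[ℂ] Vec d × Vec d where
  toFun ψ := phase J Ω ψ.1 x
  map_add' := by
    rintro ⟨ψ, hψ⟩ ⟨φ, hφ⟩
    have e : deriv (ψ + φ) x = deriv ψ x + deriv φ x := deriv_add (hψ.1.1 x) (hφ.1.1 x)
    simp only [phase, Submodule.coe_add, e, Pi.add_apply, map_add, Prod.mk_add_mk, Prod.mk.injEq,
      true_and]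
    abel
  map_smul' := by
    rintro c ⟨ψ, hψ⟩
    have e : deriv (c • ψ) x = c • deriv ψ x := deriv_const_smul c (hψ.1.1 x)
    simp only [phase, Submodule.coe_smul, e, Pi.smul_apply, map_smul, map_add, Prod.smul_mk,
      RingHom.id_apply, smul_add]

theorem evalData_injective (hJ : ∀ i, 0 < J i) (h : IsTopSolution J Ω M P) (x : ℝ) :
    Function.Injective (evalData J Ω P z x) := by
  rintro ⟨ψ, hψ⟩ ⟨φ, hφ⟩ he
  have := (hψ.1.isFlow_phase hJ h).unique hJ h (hφ.1.isFlow_phase hJ h) he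
  exact Subtype.ext (funext fun t => congrArg Prod.fst (congrFun this t))

theorem range_evalData (hJ : ∀ i, 0 < J i) (h : IsTopSolution J Ω M P) (x : ℝ) :
    LinearMap.range (evalData J Ω P z x) = boundedData J Ω M P z x := by
  ext v
  constructor
  · rintro ⟨⟨ψ, hψ⟩, rfl⟩
    exact ⟨_, hψ.1.isFlow_phase hJ h, rfl, hψ.2⟩
  · rintro ⟨Φ, hΦ, rfl, hb⟩
    exact ⟨⟨_, hΦ.isSolution_fst hJ h, hb⟩, congrFun (hΦ.phase_fst hJ) x⟩

theorem spectralMultiplicity_eq_finrank (hJ : ∀ i, 0 < J i) (h : IsTopSolution J Ω M P) (x : ℝ) :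
    spectralMultiplicity (topPotential Ω P) z =
      Module.finrank ℂ (boundedData J Ω M P z x) := by
  rw [spectralMultiplicity, ← range_evalData hJ h x]
  exact (LinearEquiv.ofInjective _ (evalData_injective hJ h x)).finrank_eq

/-- Bounded solutions carry no Jordan blocks. -/
theorem boundedData_no_jordan (hJ : ∀ i, 0 < J i) (h : IsTopSolution J Ω M P) (x : ℝ) (μ : ℂ) :
    ∀ v ∈ boundedData J Ω M P z x,
      companion J (M x) (P x) z (companion J (M x) (P x) z v - μ • v) =
        μ • (companion J (M x) (P x) z v - μ • v) → companion J (M x) (P x) z v = μ • v := by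
  rintro _ ⟨Φ, hΦ, rfl, hb⟩ he
  set Ψ : ℝ → Vec d × Vec d := fun t => companion J (M t) (P t) z (Φ t) - μ • Φ t with hΨdef
  have hΨ : IsFlow J Ω M P z Ψ := (hΦ.map_companion hJ h).sub (hΦ.smul μ)
  have he' := hΨ.companion_eq_smul hJ h (t₀ := x) he
  have hΨb : IsBoundedFun fun t => (Ψ t).1 := by
    obtain ⟨C, hC⟩ := hΦ.isBoundedFun_snd hJ h hb
    obtain ⟨D, hD⟩ := hb
    refine ⟨C + ‖μ‖ * D, fun t => (norm_sub_le _ _).trans (add_le_add (hC t) ?_)⟩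
    rw [Prod.smul_fst, norm_smul]
    exact mul_le_mul_of_nonneg_left (hD t) (norm_nonneg μ)
  have hd : ∀ t, HasDerivAt (fun t => (Φ t).1)
      (μ • act (diagonal J) (Φ t).1 + act (diagonal J) (Ψ t).1 - act (Ω t) (Φ t).1) t := by
    intro t
    refine (hΦ.hasDerivAt_fst t).congr_deriv ?_
    have e : (Φ t).2 = (Ψ t).1 + μ • (Φ t).1 := (sub_add_cancel _ _).symm
    rw [e, map_add, map_smul, add_comm (act (diagonal J) (Ψ t).1)]
  have h0 := eq_zero_of_jordan_of_bounded hJ h.skew hd (hΨ.hasDerivAt_fst_of_eigen he') hb hΨb x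
  by_contra hne
  exact hΨ.fst_ne_zero hJ h he' (t₀ := x) (sub_ne_zero.2 hne) x h0

theorem eigenspace_le_boundedData (hJ : ∀ i, 0 < J i) (h : IsTopSolution J Ω M P) (x : ℝ)
    (hμ : μ.re = 0) :
    Module.End.eigenspace (companion J (M x) (P x) z) μ ≤ boundedData J Ω M P z x := by
  intro v hv
  rw [Module.End.mem_eigenspace_iff] at hv
  obtain ⟨Φ, hΦ, rfl⟩ := exists_flow hJ h z x v
  have he := hΦ.companion_eq_smul hJ h hv
  exact ⟨Φ, hΦ, rfl, ‖(Φ 0).1‖, fun t =>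
    (norm_eq_of_re_eq_zero h.skew (hΦ.hasDerivAt_fst_of_eigen he) hμ t 0).le⟩

theorem re_eq_zero_of_mem_boundedData (hJ : ∀ i, 0 < J i) (h : IsTopSolution J Ω M P) (x : ℝ) :
    ∀ v ∈ boundedData J Ω M P z x, v ≠ 0 → companion J (M x) (P x) z v = μ • v → μ.re = 0 := by
  rintro _ ⟨Φ, hΦ, rfl, hb⟩ hne he
  have he' := hΦ.companion_eq_smul hJ h he
  exact re_eq_zero_of_bounded hJ h.skew (hΦ.hasDerivAt_fst_of_eigen he') hb
    (hΦ.fst_ne_zero hJ h he' hne x)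

theorem spectralMultiplicity_eq_finsum (hJ : ∀ i, 0 < J i) (h : IsTopSolution J Ω M P) (x : ℝ)
    (z : ℂ) : spectralMultiplicity (topPotential Ω P) z =
      ∑ᶠ p ∈ {p ∈ realCurve J (M x) (P x) | p.2 = z},
        Module.finrank ℂ (LinearMap.ker (Matrix.toLin' (pencil J (M x) (P x) p.1 p.2))) := by
  have e : {p ∈ realCurve J (M x) (P x) | p.2 = z} =
      (fun μ : ℂ => (μ, z)) '' {μ | (μ, z) ∈ realCurve J (M x) (P x)} := by
    ext ⟨μ, w⟩
    constructor
    · rintro ⟨h1, rfl⟩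
      exact ⟨μ, h1, rfl⟩
    · rintro ⟨ν, h1, h2⟩
      obtain ⟨rfl, rfl⟩ := Prod.mk.inj h2
      exact ⟨h1, rfl⟩
  rw [e, finsum_mem_image fun a _ b _ hab => congrArg Prod.fst hab,
    spectralMultiplicity_eq_finrank hJ h x,
    finrank_eq_finsum_eigenspace (companion J (M x) (P x) z) (boundedData J Ω M P z x)
      {μ | (μ, z) ∈ realCurve J (M x) (P x)} (companion_mem_boundedData hJ h x)
      (fun μ hμ => eigenspace_le_boundedData hJ h x ((mem_realCurve_iff h x).1 hμ).2)
      (fun μ v hv hne he => (mem_realCurve_iff h x).2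
        ⟨(mem_spectralCurve_iff hJ x).2 ⟨v, hne, he⟩,
          re_eq_zero_of_mem_boundedData hJ h x v hv hne he⟩)
      (boundedData_no_jordan hJ h x)]
  simp_rw [finrank_eigenspace_companion hJ]

theorem boundedSpectrum_eq (hJ : ∀ i, 0 < J i) (h : IsTopSolution J Ω M P) (x : ℝ) :
    boundedSpectrum (topPotential Ω P) = Prod.snd '' realCurve J (M x) (P x) := by
  ext z
  constructor
  · rintro ⟨ψ, hne, hψ, hb⟩
    by_contra hz
    have e : {p ∈ realCurve J (M x) (P x) | p.2 = z} = ∅ :=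
      Set.eq_empty_of_forall_notMem fun p hp => hz ⟨p, hp.1, hp.2⟩
    have h0 := spectralMultiplicity_eq_finsum hJ h x z
    rw [e, finsum_mem_empty] at h0
    have : FiniteDimensional ℂ (boundedSolutions (topPotential Ω P) z) :=
      FiniteDimensional.of_injective _ (evalData_injective hJ h x)
    have hbot := Submodule.finrank_eq_zero.1 h0
    have hmem : ψ ∈ boundedSolutions (topPotential Ω P) z := ⟨hψ, hb⟩
    rw [hbot] at hmem
    exact hne ((Submodule.mem_bot ℂ).1 hmem)
  · rintro ⟨⟨μ, w⟩, hp, rfl⟩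
    obtain ⟨ψ, hψ, hb⟩ := (mem_realCurve_iff_exists hJ h x).1 hp
    exact ⟨ψ, hψ.1, hψ.2.1, hb⟩

/-- Above the spectrum of `P` all solutions are bounded. -/
theorem boundedData_eq_top (hJ : ∀ i, 0 < J i) (h : IsTopSolution J Ω M P) {x lam : ℝ}
    (hlam : ∀ ν ∈ spectrum ℝ (P x), ν < lam) : boundedData J Ω M P lam x = ⊤ := by
  have hq : ∀ v : Vec d, v ≠ 0 → (inner ℂ v (act (P x) v)).re < lam * ‖v‖ ^ 2 :=
    fun v hv => inner_act_lt_of_spectrum_lt (h.symm x) hlam hv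
  rw [eq_top_iff, ← iSup_eigenspace_eq_top_of_no_jordan (companion J (M x) (P x) lam)
    (companion_no_jordan hJ (h.momentum_skew x) (h.symm x) hq)]
  refine iSup_le fun μ => ?_
  by_cases hμ : μ.re = 0
  · exact eigenspace_le_boundedData hJ h x hμ
  · intro v hv
    rw [Module.End.mem_eigenspace_iff] at hv
    obtain ⟨h1, h2⟩ := (companion_eq_smul_iff hJ _).1 hv
    have h3 : v.1 = 0 := by
      by_contra hne
      exact hμ (re_eq_zero_of_pencilAct hJ (h.momentum_skew x) (h.symm x) hq hne h2)
    have h4 : v = 0 := Prod.ext h3 (by rw [h1, h3, smul_zero]; rfl)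
    rw [h4]
    exact zero_mem _

theorem spectralMultiplicity_eq_of_lt (hJ : ∀ i, 0 < J i) (h : IsTopSolution J Ω M P) {x lam : ℝ}
    (hlam : ∀ ν ∈ spectrum ℝ (P x), ν < lam) :
    spectralMultiplicity (topPotential Ω P) (lam : ℂ) = 2 * d := by
  rw [spectralMultiplicity_eq_finrank hJ h x, boundedData_eq_top hJ h hlam, finrank_top,
    Module.finrank_prod, finrank_euclideanSpace, Fintype.card_fin, two_mul]

theorem isMaximallyFiniteGap (hJ : ∀ i, 0 < J i) (h : IsTopSolution J Ω M P) :
    IsMaximallyFiniteGap (topPotential Ω P) := by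
  obtain ⟨lam₀, h0⟩ := (Matrix.finite_real_spectrum (A := P 0)).bddAbove
  refine ⟨lam₀, fun lam hlam ψ hψ => ?_⟩
  have hΦ := hψ.isFlow_phase hJ h
  have hmem : phase J Ω ψ 0 ∈ boundedData J Ω M P lam 0 := by
    rw [boundedData_eq_top hJ h fun ν hν => (h0 hν).trans_lt hlam]
    trivial
  obtain ⟨Ψ, hΨ, he, hb⟩ := hmem
  rw [hΨ.unique hJ h hΦ he] at hb
  exact hb

end BoundedSolutions

end

end Bogoyavlenskij

namespace Bogoyavlenskij
open Filter Topology Matrix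
open scoped ContDiff

noncomputable section

variable {d : ℕ}

/-! ### The Schrödinger operator in `L²` and its adjoint -/

section Graph

variable {U : ℝ → RMat d}

theorem schrodinger_graph (U : ℝ → RMat d) : (schrodinger U).graph = schrodingerGraph U :=
  Submodule.toLinearPMap_graph_eq _ (schrodingerGraph_single_valued U)

theorem continuous_act_uncurry (hU : Continuous U) :
    Continuous fun p : ℝ × Vec d => act (U p.1) p.2 :=
  continuous_act (hU.comp continuous_fst) continuous_snd

theorem aestronglyMeasurable_act (hU : Continuous U) {ψ : ℝ → Vec d}
    (hψ : AEStronglyMeasurable ψ volume) :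
    AEStronglyMeasurable (fun x => act (U x) (ψ x)) volume := by
  have hm : AEStronglyMeasurable (fun x : ℝ => (x, ψ x)) (volume : Measure ℝ) :=
    continuous_id.aestronglyMeasurable.prodMk hψ
  have := (continuous_act_uncurry hU).comp_aestronglyMeasurable hm
  exact this

theorem memLp_act (hU : Continuous U) (hb : EntryBounded U) {ψ : ℝ → Vec d}
    (hψ : MemLp ψ 2 volume) : MemLp (fun x => act (U x) (ψ x)) 2 volume := by
  obtain ⟨C, hC⟩ := hb
  obtain ⟨D, -, hD⟩ := exists_norm_act_le hC
  exact hψ.of_le_mul (aestronglyMeasurable_act hU hψ.1) (Eventually.of_forall fun x => hD x (ψ x))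

/-- The regularity carried by a pair in the graph. -/
theorem exists_of_mem_schrodingerGraph {p : L2 d × L2 d} (hp : p ∈ schrodingerGraph U) :
    ∃ ψ χ h : ℝ → Vec d, (p.1 : ℝ → Vec d) =ᵐ[volume] ψ ∧ (∀ x, HasDerivAt ψ (χ x) x) ∧
      IsPrimitive χ h ∧ MemLp ψ 2 volume ∧ MemLp χ 2 volume ∧ MemLp h 2 volume ∧
      (p.2 : ℝ → Vec d) =ᵐ[volume] fun x => -h x + act (U x) (ψ x) := by
  obtain ⟨ψ, χ, h, h1, h2, h3, h4, h5⟩ := hp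
  have hχ : IsPrimitive χ h := ⟨h3.locallyIntegrable (by norm_num), h4⟩
  have hψ : MemLp ψ 2 volume := (memLp_congr_ae h1).1 (Lp.memLp p.1)
  exact ⟨ψ, χ, h, h1, h2, hχ, hψ, memLp_deriv h2 hχ hψ h3, h3, h5⟩

theorem exists_mem_schrodingerGraph (hU : Continuous U) (hb : EntryBounded U)
    {ψ χ h : ℝ → Vec d} (hψ : ∀ x, HasDerivAt ψ (χ x) x) (hχ : IsPrimitive χ h)
    (mψ : MemLp ψ 2 volume) (mh : MemLp h 2 volume) :
    ∃ p ∈ schrodingerGraph U, (p.1 : ℝ → Vec d) =ᵐ[volume] ψ ∧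
      (p.2 : ℝ → Vec d) =ᵐ[volume] fun x => -h x + act (U x) (ψ x) := by
  have mg : MemLp (fun x => -h x + act (U x) (ψ x)) 2 volume := mh.neg.add (memLp_act hU hb mψ)
  exact ⟨(mψ.toLp ψ, mg.toLp _), ⟨ψ, χ, h, mψ.coeFn_toLp, hψ, mh, hχ.sub_eq, mg.coeFn_toLp⟩,
    mψ.coeFn_toLp, mg.coeFn_toLp⟩

theorem integrable_inner_of_memLp {u v : ℝ → Vec d} (hu : MemLp u 2 volume)
    (hv : MemLp v 2 volume) : Integrable (fun x => inner ℂ (u x) (v x)) volume := by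
  refine (L2.integrable_inner (𝕜 := ℂ) (hu.toLp u) (hv.toLp v)).congr ?_
  filter_upwards [hu.coeFn_toLp, hv.coeFn_toLp] with x h1 h2
  rw [h1, h2]

theorem inner_eq_integral {f g : L2 d} {u v : ℝ → Vec d} (hu : f =ᵐ[volume] u)
    (hv : g =ᵐ[volume] v) : inner ℂ f g = ∫ x, inner ℂ (u x) (v x) := by
  rw [L2.inner_def]
  refine integral_congr_ae ?_
  filter_upwards [hu, hv] with x h1 h2
  rw [h1, h2]

/-- Green's formula on the line. -/
theorem inner_eq_of_mem_graph (hU : Continuous U) (hb : EntryBounded U) {p q : L2 d × L2 d}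
    (hp : p ∈ schrodingerGraph U) (hq : q ∈ schrodingerGraph fun x => (U x)ᵀ) :
    inner ℂ p.2 q.1 = inner ℂ p.1 q.2 := by
  have hU' : Continuous fun x => (U x)ᵀ := hU.matrix_transpose
  have hb' : EntryBounded fun x => (U x)ᵀ := by
    obtain ⟨C, hC⟩ := hb
    exact ⟨C, fun t i j => hC t j i⟩
  obtain ⟨ψ, χ, h, p1, p2, p3, mψ, mχ, mh, p4⟩ := exists_of_mem_schrodingerGraph hp
  obtain ⟨φ, η, k, q1, q2, q3, mφ, mη, mk, q4⟩ := exists_of_mem_schrodingerGraph hq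
  have hB := isBoundedBilinearMap_inner (𝕜 := ℂ) (E := Vec d)
  have hψ := IsPrimitive.of_hasDerivAt p2 p3.continuous
  have hφ := IsPrimitive.of_hasDerivAt q2 q3.continuous
  have hw := (IsPrimitive.bilin (B := fun a b => inner ℂ a b) hB hψ q3).sub
    (IsPrimitive.bilin (B := fun a b => inner ℂ a b) hB p3 hφ)
  have h0 := hw.integral_eq_zero
    ((integrable_inner_of_memLp mψ mη).sub (integrable_inner_of_memLp mχ mφ))
    (((integrable_inner_of_memLp mψ mk).add (integrable_inner_of_memLp mχ mη)).sub
      ((integrable_inner_of_memLp mχ mη).add (integrable_inner_of_memLp mh mφ)))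
  rw [inner_eq_integral p4 q1, inner_eq_integral p1 q4, ← sub_eq_zero, ← integral_sub, ← h0]
  · refine integral_congr_ae (Eventually.of_forall fun x => ?_)
    simp only [inner_add_left, inner_add_right, inner_neg_left, inner_neg_right, inner_act]
    ring
  · exact integrable_inner_of_memLp (mh.neg.add (memLp_act hU hb mψ)) mφ
  · exact integrable_inner_of_memLp mψ (mk.neg.add (memLp_act hU' hb' mφ))

/-- The adjoint of `-D² + U` on `H²` is `-D² + Uᵀ` on `H²`. Only test functions are needed to
recognize an element of the adjoint: it has a weak second derivative in `L²`. -/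
theorem adjoint_schrodingerGraph (hU : Continuous U) (hb : EntryBounded U) :
    (schrodingerGraph U).adjoint = schrodingerGraph fun x => (U x)ᵀ := by
  ext ⟨y, w⟩
  rw [Submodule.mem_adjoint_iff]
  refine ⟨fun H => ?_, fun hq a b hp => sub_eq_zero.2 (inner_eq_of_mem_graph hU hb hp hq)⟩
  have hU' : Continuous fun x => (U x)ᵀ := hU.matrix_transpose
  have hb' : EntryBounded fun x => (U x)ᵀ := by
    obtain ⟨C, hC⟩ := hb
    exact ⟨C, fun t i j => hC t j i⟩
  set k : ℝ → Vec d := fun x => act (U x)ᵀ (y x) - w x with hk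
  have my : MemLp (y : ℝ → Vec d) 2 volume := Lp.memLp y
  have mk : MemLp k 2 volume := (memLp_act hU' hb' my).sub (Lp.memLp w)
  have key : ∀ φ : ℝ → ℝ, ContDiff ℝ ∞ φ → HasCompactSupport φ →
      ∫ x, deriv (deriv φ) x • y x = ∫ x, φ x • k x := by
    intro φ hφ cφ
    have hφ1 : ContDiff ℝ ∞ (deriv φ) := (contDiff_infty_iff_deriv.1 hφ).2
    have hφ2 : Continuous (deriv (deriv φ)) := hφ1.continuous_deriv (by simp)
    have iy := (my.locallyIntegrable (by norm_num)).integrable_smul_left_of_hasCompactSupport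
      hφ2 cφ.deriv.deriv
    have ik := (mk.locallyIntegrable (by norm_num)).integrable_smul_left_of_hasCompactSupport
      hφ.continuous cφ
    refine ext_inner_left ℂ fun e => ?_
    rw [← integral_inner iy, ← integral_inner ik]
    have d0 : ∀ x, HasDerivAt (fun x => φ x • e) (deriv φ x • e) x := fun x =>
      ((hφ.differentiable (by simp)) x).hasDerivAt.smul_const e
    have d1 : ∀ x, HasDerivAt (fun x => deriv φ x • e) (deriv (deriv φ) x • e) x := fun x =>
      ((hφ1.differentiable (by simp)) x).hasDerivAt.smul_const e
    have m0 : MemLp (fun x => φ x • e) 2 volume :=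
      (hφ.continuous.smul continuous_const).memLp_of_hasCompactSupport cφ.smul_right
    have m2 : MemLp (fun x => deriv (deriv φ) x • e) 2 volume :=
      (hφ2.smul continuous_const).memLp_of_hasCompactSupport cφ.deriv.deriv.smul_right
    obtain ⟨⟨a, b⟩, hp, p1, p2⟩ := exists_mem_schrodingerGraph hU hb d0
      (IsPrimitive.of_hasDerivAt d1 (hφ2.smul continuous_const)) m0 m2
    have h0 := H a b hp
    have ew : (w : ℝ → Vec d) =ᵐ[volume] fun x => act (U x)ᵀ (y x) - k x :=
      Eventually.of_forall fun x => by simp [hk]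
    simp only at p1 p2
    rw [inner_eq_integral p2 (ae_eq_refl _), inner_eq_integral p1 ew, ← integral_sub] at h0
    · rw [← sub_eq_zero, ← integral_sub, ← neg_eq_zero, ← integral_neg, ← h0]
      · refine integral_congr_ae (Eventually.of_forall fun x => ?_)
        simp only [inner_add_left, inner_sub_right, inner_neg_left, inner_act,
          inner_smul_left_eq_smul, inner_smul_right_eq_smul]
        module
      · exact iy.const_inner e
      · exact ik.const_inner e
    · exact integrable_inner_of_memLp (m2.neg.add (memLp_act hU hb m0)) my
    · exact integrable_inner_of_memLp m0 ((memLp_act hU' hb' my).sub mk)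
  obtain ⟨ψ, χ, hy, hψ, hχ⟩ := exists_primitives_of_weak_second_deriv
    (my.locallyIntegrable (by norm_num)) (mk.locallyIntegrable (by norm_num)) key
  refine ⟨ψ, χ, k, hy, hψ, mk, hχ.sub_eq, ?_⟩
  filter_upwards [hy] with x hx
  rw [← hx]
  simp only [hk]
  rw [neg_sub, sub_add_cancel]

theorem dense_schrodinger_domain (hU : Continuous U) (hb : EntryBounded U) :
    Dense ((schrodinger U).domain : Set (L2 d)) := by
  rw [Submodule.dense_iff_topologicalClosure_eq_top, Submodule.topologicalClosure_eq_top_iff,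
    Submodule.eq_bot_iff]
  intro w hw
  refine schrodingerGraph_single_valued (fun x => (U x)ᵀ) (0, w) ?_ rfl
  rw [← adjoint_schrodingerGraph hU hb, Submodule.mem_adjoint_iff]
  intro a b hp
  rw [inner_zero_right, zero_sub, neg_eq_zero]
  exact hw a ⟨(a, b), hp, rfl⟩

theorem isSelfAdjoint_schrodinger (hU : Continuous U) (hb : EntryBounded U)
    (hs : ∀ x, (U x)ᵀ = U x) : IsSelfAdjoint (schrodinger U) := by
  rw [LinearPMap.isSelfAdjoint_def]
  refine LinearPMap.eq_of_eq_graph ?_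
  rw [LinearPMap.adjoint_graph_eq_graph_adjoint (dense_schrodinger_domain hU hb),
    schrodinger_graph, adjoint_schrodingerGraph hU hb, funext hs]

theorem isClosed_schrodingerGraph (hU : Continuous U) (hb : EntryBounded U) :
    IsClosed (schrodingerGraph U : Set (L2 d × L2 d)) := by
  have hb' : EntryBounded fun x => (U x)ᵀ := by
    obtain ⟨C, hC⟩ := hb
    exact ⟨C, fun t i j => hC t j i⟩
  have e := adjoint_schrodingerGraph hU.matrix_transpose hb'
  simp only [transpose_transpose] at e
  have hc : (schrodingerGraph U : Set (L2 d × L2 d)) =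
      ⋂ p ∈ schrodingerGraph fun x => (U x)ᵀ,
        {q : L2 d × L2 d | inner ℂ p.2 q.1 - inner ℂ p.1 q.2 = 0} := by
    rw [← e]
    ext q
    simp only [SetLike.mem_coe, Submodule.mem_adjoint_iff, Set.mem_iInter, Set.mem_ofPred_eq,
      Prod.forall]
  rw [hc]
  refine isClosed_biInter fun p _ => isClosed_eq ?_ continuous_const
  exact (continuous_const.inner continuous_fst).sub (continuous_const.inner continuous_snd)

end Graph

end

end Bogoyavlenskij

namespace Bogoyavlenskij
open Filter Topology Matrix

noncomputable section

variable {d : ℕ}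

/-! ### Square-integrable solutions of the first order system -/

section SquareIntegrable

theorem integral_norm_sq_le_of_le {F G : Type*} [NormedAddCommGroup F] [NormedAddCommGroup G]
    {u : ℝ → F} {v : ℝ → G} {D : ℝ} (hv : MemLp v 2 volume) (h : ∀ x, ‖u x‖ ≤ D * ‖v x‖) :
    ∫ x, ‖u x‖ ^ 2 ≤ D ^ 2 * ∫ x, ‖v x‖ ^ 2 := by
  rw [← integral_const_mul]
  refine integral_mono_of_nonneg (Eventually.of_forall fun x => sq_nonneg _)
    ((hv.integrable_norm_pow (by norm_num)).const_mul _) (Eventually.of_forall fun x => ?_)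
  change ‖u x‖ ^ 2 ≤ D ^ 2 * ‖v x‖ ^ 2
  rw [← mul_pow]
  exact pow_le_pow_left₀ (norm_nonneg _) (h x) 2

theorem integral_norm_sq_add_le {F : Type*} [NormedAddCommGroup F] {u v : ℝ → F}
    (hu : MemLp u 2 volume) (hv : MemLp v 2 volume) :
    ∫ x, ‖u x + v x‖ ^ 2 ≤ 2 * (∫ x, ‖u x‖ ^ 2) + 2 * ∫ x, ‖v x‖ ^ 2 := by
  have iu : Integrable (fun x => 2 * ‖u x‖ ^ 2) volume :=
    (hu.integrable_norm_pow (by norm_num)).const_mul 2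
  have iv : Integrable (fun x => 2 * ‖v x‖ ^ 2) volume :=
    (hv.integrable_norm_pow (by norm_num)).const_mul 2
  rw [← integral_const_mul, ← integral_const_mul, ← integral_add iu iv]
  refine integral_mono_of_nonneg (Eventually.of_forall fun x => sq_nonneg _) (iu.add iv)
    (Eventually.of_forall fun x => ?_)
  change ‖u x + v x‖ ^ 2 ≤ 2 * ‖u x‖ ^ 2 + 2 * ‖v x‖ ^ 2
  have h1 := pow_le_pow_left₀ (norm_nonneg _) (norm_add_le (u x) (v x)) 2
  nlinarith [sq_nonneg (‖u x‖ - ‖v x‖)]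

variable {J : Fin d → ℝ} {Ω M P : ℝ → RMat d} {μ z : ℂ}

/-- If `μ` is off the imaginary axis, then `D - μ J + Ω` is bounded below in `L²`: integrate
the derivative of `‖u‖²`. -/
theorem exists_integral_norm_sq_le (hJ : ∀ i, 0 < J i) (hΩ : ∀ t, (Ω t)ᵀ = -Ω t)
    (hμ : μ.re ≠ 0) :
    ∃ K, 0 ≤ K ∧ ∀ u r : ℝ → Vec d,
      IsPrimitive u (fun t => μ • act (diagonal J) (u t) - act (Ω t) (u t) + r t) →
      MemLp u 2 volume → MemLp r 2 volume → ∫ t, ‖u t‖ ^ 2 ≤ K * ∫ t, ‖r t‖ ^ 2 := by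
  obtain ⟨c, hc, hcJ⟩ := exists_le_inner_act_diagonal hJ
  obtain ⟨σ, hσ, hpos⟩ : ∃ σ : ℝ, |σ| = 1 ∧ 0 < σ * μ.re := by
    rcases lt_or_gt_of_ne hμ with h | h
    · exact ⟨-1, by simp, by linarith⟩
    · exact ⟨1, by simp, by linarith⟩
  set a := σ * μ.re * c with ha
  have hapos : 0 < a := mul_pos hpos hc
  refine ⟨(a ^ 2)⁻¹, by positivity, fun u r hu mu mr => ?_⟩
  have mJ : MemLp (fun t => act (diagonal J) (u t)) 2 volume :=
    memLp_act continuous_const (EntryBounded.const _) mu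
  have iJ := (integrable_inner_of_memLp mJ mu).re
  have ir := (integrable_inner_of_memLp mu mr).re
  have hw := IsPrimitive.bilin (B := fun a b => inner ℂ a b)
    (isBoundedBilinearMap_inner (𝕜 := ℂ) (E := Vec d)) hu hu
  have e : ∀ t, inner ℂ (u t) (μ • act (diagonal J) (u t) - act (Ω t) (u t) + r t) +
      inner ℂ (μ • act (diagonal J) (u t) - act (Ω t) (u t) + r t) (u t) =
      ((2 * (μ.re * (inner ℂ (act (diagonal J) (u t)) (u t)).re
        + (inner ℂ (u t) (r t)).re) : ℝ) : ℂ) := by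
    intro t
    have e1 : inner ℂ (u t) (act (diagonal J) (u t)) = inner ℂ (act (diagonal J) (u t)) (u t) := by
      rw [inner_act, diagonal_transpose]
    have e2 : inner ℂ (u t) (act (Ω t) (u t)) = -inner ℂ (act (Ω t) (u t)) (u t) := by
      rw [inner_act, hΩ, act_neg, inner_neg_right, neg_neg]
    have e3 : inner ℂ (r t) (u t) = starRingEnd ℂ (inner ℂ (u t) (r t)) :=
      (inner_conj_symm _ _).symm
    have e4 : inner ℂ (act (diagonal J) (u t)) (u t) =
        ((inner ℂ (act (diagonal J) (u t)) (u t)).re : ℂ) := by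
      rw [inner_act_diagonal, Complex.ofReal_re]
    simp only [inner_add_left, inner_add_right, inner_sub_left, inner_sub_right,
      inner_smul_left, inner_smul_right, e1, e2, e3]
    push_cast
    rw [← e4]
    have h1 := Complex.add_conj μ
    have h2 := Complex.add_conj (inner ℂ (u t) (r t))
    push_cast at h1 h2
    linear_combination (inner ℂ (act (diagonal J) (u t)) (u t)) * h1 + h2
  have i0 : Integrable (fun t => 2 * (μ.re * (inner ℂ (act (diagonal J) (u t)) (u t)).re
      + (inner ℂ (u t) (r t)).re)) volume := ((iJ.const_mul μ.re).add ir).const_mul 2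
  have h0 := (hw.congr (fun _ => rfl) e).integral_eq_zero (integrable_inner_of_memLp mu mu)
    i0.ofReal
  replace h0 : ∫ t, 2 * (μ.re * (inner ℂ (act (diagonal J) (u t)) (u t)).re
      + (inner ℂ (u t) (r t)).re) = 0 := Complex.ofReal_eq_zero.1 (integral_ofReal.symm.trans h0)
  have iu : Integrable (fun t => ‖u t‖ ^ 2) volume := mu.integrable_norm_pow (by norm_num)
  have ir' : Integrable (fun t => ‖r t‖ ^ 2) volume := mr.integrable_norm_pow (by norm_num)
  have hle : ∫ t, (a * ‖u t‖ ^ 2 - a⁻¹ * ‖r t‖ ^ 2) ≤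
      ∫ t, σ * (2 * (μ.re * (inner ℂ (act (diagonal J) (u t)) (u t)).re
        + (inner ℂ (u t) (r t)).re)) := by
    refine integral_mono ((iu.const_mul a).sub (ir'.const_mul a⁻¹)) (i0.const_mul σ) fun t => ?_
    change a * ‖u t‖ ^ 2 - a⁻¹ * ‖r t‖ ^ 2 ≤ σ * (2 * (μ.re *
      (inner ℂ (act (diagonal J) (u t)) (u t)).re + (inner ℂ (u t) (r t)).re))
    have h1 := mul_le_mul_of_nonneg_left (hcJ (u t)) hpos.le
    have h2 : -(‖u t‖ * ‖r t‖) ≤ σ * (inner ℂ (u t) (r t)).re := by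
      have h3 : |σ * (inner ℂ (u t) (r t)).re| ≤ ‖u t‖ * ‖r t‖ := by
        rw [abs_mul, hσ, one_mul]
        exact (Complex.abs_re_le_norm _).trans (norm_inner_le_norm _ _)
      exact (abs_le.1 h3).1
    -- Young's inequality
    have h4 : 2 * (‖u t‖ * ‖r t‖) ≤ a * ‖u t‖ ^ 2 + a⁻¹ * ‖r t‖ ^ 2 := by
      have h5 : 0 ≤ a⁻¹ * (a * ‖u t‖ - ‖r t‖) ^ 2 := by positivity
      have h6 : a⁻¹ * (a * ‖u t‖ - ‖r t‖) ^ 2 =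
          a * ‖u t‖ ^ 2 + a⁻¹ * ‖r t‖ ^ 2 - 2 * (‖u t‖ * ‖r t‖) := by
        field_simp
        ring
      linarith
    have h7 : σ * μ.re * (c * ‖u t‖ ^ 2) = a * ‖u t‖ ^ 2 := by rw [ha]; ring
    nlinarith
  rw [integral_const_mul, h0, mul_zero, integral_sub (iu.const_mul a) (ir'.const_mul a⁻¹),
    integral_const_mul, integral_const_mul] at hle
  have h8 := mul_le_mul_of_nonneg_left hle (inv_pos.2 hapos).le
  have h9 : a⁻¹ * (a * (∫ t, ‖u t‖ ^ 2) - a⁻¹ * ∫ t, ‖r t‖ ^ 2) =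
      (∫ t, ‖u t‖ ^ 2) - (a ^ 2)⁻¹ * ∫ t, ‖r t‖ ^ 2 := by
    field_simp
  linarith

/-- Successive application of the factors `C - μ` for `μ` in a list. -/
def applyFactors (C : Vec d × Vec d →ₗ[ℂ] Vec d × Vec d) (l : List ℂ) (v : Vec d × Vec d) :
    Vec d × Vec d :=
  l.foldl (fun w μ => C w - μ • w) v

theorem applyFactors_eq_aeval (C : Vec d × Vec d →ₗ[ℂ] Vec d × Vec d) (l : List ℂ)
    (v : Vec d × Vec d) : applyFactors C l v =
      Polynomial.aeval C (l.map fun μ => Polynomial.X - Polynomial.C μ).prod v := by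
  induction l generalizing v with
  | nil => simp [applyFactors]
  | cons μ l ih =>
    rw [List.map_cons, List.prod_cons, mul_comm, map_mul, Module.End.mul_apply, ← ih]
    simp [applyFactors]

theorem IsFlow.applyFactors (hJ : ∀ i, 0 < J i) (h : IsTopSolution J Ω M P) (l : List ℂ)
    {Φ : ℝ → Vec d × Vec d} (hΦ : IsFlow J Ω M P z Φ) :
    IsFlow J Ω M P z fun t => applyFactors (companion J (M t) (P t) z) l (Φ t) := by
  induction l generalizing Φ with
  | nil => exact hΦ
  | cons μ l ih => exact ih ((hΦ.map_companion hJ h).sub (hΦ.smul μ))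

/-- The factorization of the characteristic polynomial of the companion matrix at one point
annihilates the companion matrix at every point. Its roots lie on the spectral curve. -/
theorem exists_annihilating_list (hJ : ∀ i, 0 < J i) (h : IsTopSolution J Ω M P) (x : ℝ) (z : ℂ) :
    ∃ l : List ℂ, (∀ μ ∈ l, (μ, z) ∈ spectralCurve J (M x) (P x)) ∧
      ∀ t v, applyFactors (companion J (M t) (P t) z) l v = 0 := by
  set C := companion J (M x) (P x) z with hC
  refine ⟨C.charpoly.roots.toList, fun μ hμ => ?_, fun t v => ?_⟩
  · have hr := (Polynomial.mem_roots'.1 (Multiset.mem_toList.1 hμ)).2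
    rw [← Module.End.hasEigenvalue_iff_isRoot_charpoly] at hr
    obtain ⟨v, hv⟩ := hr.exists_hasEigenvector
    exact (mem_spectralCurve_iff hJ x).2 ⟨v, hv.2, hv.apply_eq_smul⟩
  · obtain ⟨Φ, hΦ, h0⟩ := exists_flow hJ h z t v
    have hx : applyFactors C C.charpoly.roots.toList (Φ x) = 0 := by
      have e : (C.charpoly.roots.toList.map fun μ => Polynomial.X - Polynomial.C μ).prod
          = C.charpoly := by
        rw [← Multiset.prod_coe, ← Multiset.map_coe, Multiset.coe_toList]
        exact ((IsAlgClosed.splits C.charpoly).eq_prod_roots_of_monic C.charpoly_monic).symm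
      rw [applyFactors_eq_aeval, e, LinearMap.aeval_self_charpoly, LinearMap.zero_apply]
    have := congrFun ((hΦ.applyFactors hJ h C.charpoly.roots.toList).unique hJ h IsFlow.zero hx) t
    rwa [h0] at this

theorem memLp_companion (h : IsTopSolution J Ω M P) (z : ℂ) {Φ : ℝ → Vec d × Vec d}
    (hΦ : MemLp Φ 2 volume) : MemLp (fun t => companion J (M t) (P t) z (Φ t)) 2 volume := by
  obtain ⟨C, -, hC⟩ := exists_norm_companion_le h z
  have h1 := continuous_fst.comp_aestronglyMeasurable hΦ.1
  have h2 := continuous_snd.comp_aestronglyMeasurable hΦ.1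
  have h3 := (aestronglyMeasurable_act h.continuous_M h2).add
    ((aestronglyMeasurable_act h.continuous_P h1).sub (h1.const_smul z))
  have hm : AEStronglyMeasurable (fun t => companion J (M t) (P t) z (Φ t)) volume :=
    h2.prodMk (aestronglyMeasurable_act continuous_const
      (aestronglyMeasurable_act continuous_const h3))
  exact hΦ.of_le_mul hm (Eventually.of_forall fun t => hC t (Φ t))

/-- Off the projection of the real part of the curve, a square-integrable solution of the first
order system with a source is controlled by the source: the factors `C - μ` of an annihilating
polynomial are removed one after the other, each by `exists_integral_norm_sq_le`. -/
theorem exists_integral_norm_sq_le_of_factors (hJ : ∀ i, 0 < J i) (h : IsTopSolution J Ω M P)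
    (z : ℂ) (l : List ℂ) (hl : ∀ μ ∈ l, μ.re ≠ 0) :
    ∃ K, 0 ≤ K ∧ ∀ Φ Γ : ℝ → Vec d × Vec d,
      IsPrimitive Φ (fun t => phaseField J (Ω t) (M t) (P t) z (Φ t) + Γ t) →
      MemLp Φ 2 volume → MemLp Γ 2 volume →
      (∀ t, Bogoyavlenskij.applyFactors (companion J (M t) (P t) z) l (Φ t) = 0) →
      ∫ t, ‖Φ t‖ ^ 2 ≤ K * ∫ t, ‖Γ t‖ ^ 2 := by
  induction l with
  | nil =>
    refine ⟨0, le_rfl, fun Φ Γ _ _ _ h0 => ?_⟩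
    have e : ∀ t, Φ t = 0 := h0
    simp [e]
  | cons μ l ih =>
    obtain ⟨K, hK, ih⟩ := ih fun ν hν => hl ν (List.mem_cons_of_mem _ hν)
    obtain ⟨N, hN, hE⟩ := exists_integral_norm_sq_le hJ h.skew (hl μ List.mem_cons_self)
    obtain ⟨c, hc, hcC⟩ := exists_norm_companion_le (J := J) h z
    obtain ⟨k, hk, hkJ⟩ := exists_norm_act_const_le (diagonal J)
    refine ⟨2 * N * (2 * (k ^ 2 * (K * (c + ‖μ‖) ^ 2)) + 2), by positivity,
      fun Φ Γ hΦ mΦ mΓ h0 => ?_⟩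
    set Ψ : ℝ → Vec d × Vec d := fun t => companion J (M t) (P t) z (Φ t) - μ • Φ t with hΨ
    have mΨ : MemLp Ψ 2 volume := (memLp_companion h z mΦ).sub (mΦ.const_smul μ)
    have mΔ : MemLp (fun t => companion J (M t) (P t) z (Γ t) - μ • Γ t) 2 volume :=
      (memLp_companion h z mΓ).sub (mΓ.const_smul μ)
    have pΨ : IsPrimitive Ψ fun t => phaseField J (Ω t) (M t) (P t) z (Ψ t) +
        (companion J (M t) (P t) z (Γ t) - μ • Γ t) := by
      have hs : IsPrimitive (fun t => μ • Φ t) fun t =>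
          μ • (phaseField J (Ω t) (M t) (P t) z (Φ t) + Γ t) :=
        hΦ.clm_comp ((μ • ContinuousLinearMap.id ℂ (Vec d × Vec d)).restrictScalars ℝ)
      refine ((IsPrimitive.map_companion hJ h hΦ).sub hs).congr (fun _ => rfl) fun t => ?_
      simp only [hΨ, map_sub, map_smul]
      module
    have hΨΓ := ih Ψ _ pΨ mΨ mΔ h0
    have hΔ : ∫ t, ‖companion J (M t) (P t) z (Γ t) - μ • Γ t‖ ^ 2 ≤
        (c + ‖μ‖) ^ 2 * ∫ t, ‖Γ t‖ ^ 2 :=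
      integral_norm_sq_le_of_le mΓ fun t => by
        refine (norm_sub_le _ _).trans ?_
        rw [add_mul, norm_smul]
        exact add_le_add_left (hcC t _) _
    have comp : ∀ π : Vec d × Vec d →L[ℝ] Vec d, (∀ v, ‖π v‖ ≤ ‖v‖) →
        (∀ t, π (phaseField J (Ω t) (M t) (P t) z (Φ t)) =
          act (diagonal J) (π (companion J (M t) (P t) z (Φ t))) - act (Ω t) (π (Φ t))) →
        (∀ v, π (μ • v) = μ • π v) →
        ∫ t, ‖π (Φ t)‖ ^ 2 ≤
          N * (2 * (k ^ 2 * ∫ t, ‖Ψ t‖ ^ 2) + 2 * ∫ t, ‖Γ t‖ ^ 2) := by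
      intro π hπ hf hs
      have mπΨ : MemLp (fun t => act (diagonal J) (π (Ψ t))) 2 volume :=
        memLp_act continuous_const (EntryBounded.const _) (π.comp_memLp' mΨ)
      have mπΓ : MemLp (fun t => π (Γ t)) 2 volume := π.comp_memLp' mΓ
      have h1 := hE (fun t => π (Φ t)) (fun t => act (diagonal J) (π (Ψ t)) + π (Γ t))
        ((hΦ.clm_comp π).congr (fun _ => rfl) fun t => by
          simp only [hΨ, map_add, map_sub, hf, hs, map_smul]
          module) (π.comp_memLp' mΦ) (mπΨ.add mπΓ)
      have h2 := integral_norm_sq_add_le mπΨ mπΓ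
      have h3 : ∫ t, ‖act (diagonal J) (π (Ψ t))‖ ^ 2 ≤ k ^ 2 * ∫ t, ‖Ψ t‖ ^ 2 :=
        integral_norm_sq_le_of_le mΨ fun t =>
          (hkJ _).trans (mul_le_mul_of_nonneg_left (hπ _) hk)
      have h4 : ∫ t, ‖π (Γ t)‖ ^ 2 ≤ 1 ^ 2 * ∫ t, ‖Γ t‖ ^ 2 :=
        integral_norm_sq_le_of_le mΓ fun t => by rw [one_mul]; exact hπ _
      rw [one_pow, one_mul] at h4
      exact h1.trans (mul_le_mul_of_nonneg_left (by linarith) hN)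
    have h1 := comp (ContinuousLinearMap.fst ℝ _ _) norm_fst_le (fun _ => rfl) fun _ => rfl
    have h2 := comp (ContinuousLinearMap.snd ℝ _ _) norm_snd_le (fun _ => rfl) fun _ => rfl
    have mfst : MemLp (fun t => (Φ t).1) 2 volume :=
      (ContinuousLinearMap.fst ℝ (Vec d) (Vec d)).comp_memLp' mΦ
    have msnd : MemLp (fun t => (Φ t).2) 2 volume :=
      (ContinuousLinearMap.snd ℝ (Vec d) (Vec d)).comp_memLp' mΦ
    have i1 : Integrable (fun t => ‖(Φ t).1‖ ^ 2) volume :=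
      mfst.integrable_norm_pow (by norm_num)
    have i2 : Integrable (fun t => ‖(Φ t).2‖ ^ 2) volume :=
      msnd.integrable_norm_pow (by norm_num)
    have h3 : ∫ t, ‖Φ t‖ ^ 2 ≤ (∫ t, ‖(Φ t).1‖ ^ 2) + ∫ t, ‖(Φ t).2‖ ^ 2 := by
      rw [← integral_add i1 i2]
      refine integral_mono_of_nonneg (Eventually.of_forall fun t => sq_nonneg _) (i1.add i2)
        (Eventually.of_forall fun t => ?_)
      change ‖Φ t‖ ^ 2 ≤ ‖(Φ t).1‖ ^ 2 + ‖(Φ t).2‖ ^ 2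
      rw [Prod.norm_def]
      rcases max_choice ‖(Φ t).1‖ ‖(Φ t).2‖ with e | e <;> rw [e] <;>
        linarith [sq_nonneg ‖(Φ t).1‖, sq_nonneg ‖(Φ t).2‖]
    have h4 := hΨΓ.trans (mul_le_mul_of_nonneg_left hΔ hK)
    have h5 : N * (2 * (k ^ 2 * ∫ t, ‖Ψ t‖ ^ 2) + 2 * ∫ t, ‖Γ t‖ ^ 2) ≤
        N * (2 * (k ^ 2 * (K * ((c + ‖μ‖) ^ 2 * ∫ t, ‖Γ t‖ ^ 2))) + 2 * ∫ t, ‖Γ t‖ ^ 2) := by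
      gcongr
    simp only [ContinuousLinearMap.coe_fst', ContinuousLinearMap.coe_snd'] at h1 h2
    calc ∫ t, ‖Φ t‖ ^ 2 ≤ _ := h3
      _ ≤ _ := add_le_add (h1.trans h5) (h2.trans h5)
      _ = _ := by ring

/-- The first order system has no nonzero square-integrable solutions. -/
theorem IsFlow.eq_zero_of_memLp (hJ : ∀ i, 0 < J i) (h : IsTopSolution J Ω M P)
    {Φ : ℝ → Vec d × Vec d} (hΦ : IsFlow J Ω M P z Φ) (mΦ : MemLp Φ 2 volume) : Φ = 0 := by
  obtain ⟨l, -, hl⟩ := exists_annihilating_list hJ h 0 z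
  have key : ∀ (l : List ℂ) (Φ : ℝ → Vec d × Vec d), IsFlow J Ω M P z Φ → MemLp Φ 2 volume →
      (∀ t, Bogoyavlenskij.applyFactors (companion J (M t) (P t) z) l (Φ t) = 0) → Φ = 0 := by
    intro l
    induction l with
    | nil => exact fun Φ _ _ h0 => funext h0
    | cons μ l ih =>
      intro Φ hΦ mΦ h0
      have h1 := ih _ ((hΦ.map_companion hJ h).sub (hΦ.smul μ))
        ((memLp_companion h z mΦ).sub (mΦ.const_smul μ)) h0
      have he : ∀ t, companion J (M t) (P t) z (Φ t) = μ • Φ t := fun t =>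
        sub_eq_zero.1 (congrFun h1 t)
      have mfst : MemLp (fun t => (Φ t).1) 2 volume :=
        (ContinuousLinearMap.fst ℝ (Vec d) (Vec d)).comp_memLp' mΦ
      have h2 := eq_zero_of_integrable hJ h.skew (hΦ.hasDerivAt_fst_of_eigen he)
        (mfst.integrable_norm_pow (by norm_num)) 0
      by_contra hne
      obtain ⟨t, ht⟩ := Function.ne_iff.1 hne
      exact hΦ.fst_ne_zero hJ h he ht 0 h2
  exact key l Φ hΦ mΦ fun t => hl t _

end SquareIntegrable

end

end Bogoyavlenskij

namespace Bogoyavlenskij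
open Filter Topology Matrix
open scoped ContDiff

noncomputable section

variable {d : ℕ}

/-! ### The resolvent of the operator -/

section Resolvent

theorem norm_sq_eq_integral {f : L2 d} {u : ℝ → Vec d} (hu : f =ᵐ[volume] u) :
    ‖f‖ ^ 2 = ∫ x, ‖u x‖ ^ 2 := by
  have h1 := inner_eq_integral hu hu
  simp only [inner_self_eq_norm_sq_to_K] at h1
  have h2 : ((∫ x, ‖u x‖ ^ 2 : ℝ) : ℂ) = ∫ x, ((‖u x‖ : ℝ) : ℂ) ^ 2 := by
    rw [← integral_complex_ofReal]
    simp only [Complex.ofReal_pow]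
  have h3 : ((‖f‖ ^ 2 : ℝ) : ℂ) = ((∫ x, ‖u x‖ ^ 2 : ℝ) : ℂ) := by
    rw [h2, Complex.ofReal_pow]
    exact h1
  exact Complex.ofReal_injective h3

/-- A closed operator that is bounded below and has dense range has a bounded inverse. -/
theorem exists_bounded_inverse {E : Type*} [NormedAddCommGroup E] [NormedSpace ℂ E]
    [CompleteSpace E] {T : E →ₗ.[ℂ] E} {z : ℂ} {c : ℝ} (hT : IsClosed (T.graph : Set (E × E)))
    (hb : ∀ p ∈ T.graph, ‖p.1‖ ≤ c * ‖p.2 - z • p.1‖)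
    (hd : DenseRange fun f : T.domain => T f - z • (f : E)) :
    ∃ R : E →L[ℂ] E, (∀ g : E, ∃ hg : R g ∈ T.domain, T ⟨R g, hg⟩ - z • R g = g) ∧
      ∀ f : T.domain, R (T f - z • (f : E)) = f := by
  have : CompleteSpace T.graph := hT.completeSpace_coe
  let A : T.graph →L[ℂ] E :=
    (ContinuousLinearMap.snd ℂ E E - z • ContinuousLinearMap.fst ℂ E E) ∘L
      T.graph.subtypeL
  have hA : ∀ p : T.graph, A p = p.1.2 - z • p.1.1 := fun _ => rfl
  have hlow : ∀ p : T.graph, ‖p‖ ≤ (1 + (1 + ‖z‖) * |c|).toNNReal * ‖A p‖ := by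
    rintro ⟨⟨f, g⟩, hp⟩
    rw [Real.coe_toNNReal _ (by positivity)]
    have h1 : ‖f‖ ≤ c * ‖g - z • f‖ := hb _ hp
    have h2 : ‖g‖ ≤ ‖g - z • f‖ + ‖z‖ * ‖f‖ := by
      rw [← norm_smul]
      simpa using norm_add_le (g - z • f) (z • f)
    have h3 : c * ‖g - z • f‖ ≤ |c| * ‖g - z • f‖ :=
      mul_le_mul_of_nonneg_right (le_abs_self c) (norm_nonneg _)
    have h4 := mul_le_mul_of_nonneg_left (h1.trans h3) (norm_nonneg z)
    have h5 : 0 ≤ ‖z‖ * (|c| * ‖g - z • f‖) := by positivity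
    have h6 : 0 ≤ |c| * ‖g - z • f‖ := by positivity
    change max ‖f‖ ‖g‖ ≤ (1 + (1 + ‖z‖) * |c|) * ‖g - z • f‖
    refine max_le ?_ ?_ <;> nlinarith [norm_nonneg (g - z • f)]
  have hanti := A.antilipschitz_of_bound hlow
  have hclosed : IsClosed (Set.range A) := hanti.isClosed_range A.uniformContinuous
  have hrange : Set.range A = Set.univ := by
    rw [← hclosed.closure_eq, ← dense_iff_closure_eq]
    refine hd.mono ?_
    rintro _ ⟨f, rfl⟩
    exact ⟨⟨(f, T f), T.mem_graph f⟩, rfl⟩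
  let e := ContinuousLinearEquiv.ofBijective A (LinearMap.ker_eq_bot.2 hanti.injective)
    (LinearMap.range_eq_top.2 (Set.range_eq_univ.1 hrange))
  have heA : ∀ p, e p = A p := fun _ => rfl
  refine ⟨ContinuousLinearMap.fst ℂ E E ∘L T.graph.subtypeL ∘L
    (e.symm : E →L[ℂ] T.graph), fun g => ?_, fun f => ?_⟩
  · obtain ⟨y, hy, hTy⟩ := (LinearPMap.mem_graph_iff T).1 (e.symm g).2
    have hm : (e.symm g).1.1 ∈ T.domain := hy ▸ y.2
    refine ⟨hm, ?_⟩
    have ey : (⟨(e.symm g).1.1, hm⟩ : T.domain) = y := Subtype.ext hy.symm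
    have h1 : A (e.symm g) = g := by rw [← heA, e.apply_symm_apply]
    change T ⟨(e.symm g).1.1, hm⟩ - z • (e.symm g).1.1 = g
    rw [ey, hTy, ← hA, h1]
  · have h1 : e.symm (T f - z • (f : E)) = ⟨(f, T f), T.mem_graph f⟩ := by
      rw [ContinuousLinearEquiv.symm_apply_eq]
      rfl
    change (e.symm (T f - z • (f : E))).1.1 = f
    rw [h1]

variable {J : Fin d → ℝ} {Ω M P : ℝ → RMat d} {z : ℂ}

/-- The first order system with source attached to a pair in the graph. -/
theorem exists_phase_of_mem_graph (hJ : ∀ i, 0 < J i) (h : IsTopSolution J Ω M P) (z : ℂ)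
    {p : L2 d × L2 d} (hp : p ∈ schrodingerGraph (topPotential Ω P)) :
    ∃ (Φ : ℝ → Vec d × Vec d) (r : ℝ → Vec d),
      IsPrimitive Φ (fun t => phaseField J (Ω t) (M t) (P t) z (Φ t) +
        (0, act (diagInv J) (r t))) ∧ MemLp Φ 2 volume ∧
      (p.1 : ℝ → Vec d) =ᵐ[volume] (fun t => (Φ t).1) ∧
      ((z • p.1 - p.2 : L2 d) : ℝ → Vec d) =ᵐ[volume] r := by
  obtain ⟨ψ, χ, k, p1, p2, p3, mψ, mχ, mk, p4⟩ := exists_of_mem_schrodingerGraph hp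
  have hψ := IsPrimitive.of_hasDerivAt p2 p3.continuous
  refine ⟨_, _, IsPrimitive.phase (z := z) hJ h hψ p3, ?_, p1, ?_⟩
  · exact memLp_prod_iff.2 ⟨mψ, memLp_act continuous_const (EntryBounded.const _)
      (mχ.add (memLp_act (h.continuous_velocity hJ) (h.exists_bound_velocity hJ) mψ))⟩
  · filter_upwards [p1, p4, Lp.coeFn_sub (z • p.1) p.2, Lp.coeFn_smul z p.1] with t e1 e2 e3 e4
    rw [e3, Pi.sub_apply, e4, Pi.smul_apply, e1, e2]
    module

/-- `L` has no square-integrable eigenfunctions. -/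
theorem eq_zero_of_mem_graph (hJ : ∀ i, 0 < J i) (h : IsTopSolution J Ω M P)
    {p : L2 d × L2 d} (hp : p ∈ schrodingerGraph (topPotential Ω P)) (he : p.2 = z • p.1) :
    p.1 = 0 := by
  obtain ⟨Φ, r, hΦ, mΦ, h1, h2⟩ := exists_phase_of_mem_graph hJ h z hp
  rw [he, sub_self] at h2
  have h3 : IsFlow J Ω M P z Φ := by
    refine IsFlow.of_isPrimitive hJ h (hΦ.congr_ae ?_)
    filter_upwards [h2, Lp.coeFn_zero (Vec d) 2 (volume : Measure ℝ)] with t e1 e2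
    have e3 : r t = 0 := by rw [← e1, e2]; rfl
    rw [e3, map_zero, Prod.mk_zero_zero, add_zero]
  have h4 := h3.eq_zero_of_memLp hJ h mΦ
  refine Lp.eq_zero_iff_ae_eq_zero.2 (h1.trans ?_)
  rw [h4]
  rfl

/-- Off the projection of the real part of the curve, `L - z` is bounded below. -/
theorem exists_norm_le_of_notMem (hJ : ∀ i, 0 < J i) (h : IsTopSolution J Ω M P) {x : ℝ}
    (hz : z ∉ Prod.snd '' realCurve J (M x) (P x)) :
    ∃ c : ℝ, ∀ p ∈ schrodingerGraph (topPotential Ω P), ‖p.1‖ ≤ c * ‖p.2 - z • p.1‖ := by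
  obtain ⟨l, hl, hann⟩ := exists_annihilating_list hJ h x z
  obtain ⟨K, hK, hest⟩ := exists_integral_norm_sq_le_of_factors hJ h z l fun μ hμ hre =>
    hz ⟨(μ, z), (mem_realCurve_iff h x).2 ⟨hl μ hμ, hre⟩, rfl⟩
  obtain ⟨k, hk, hkJ⟩ := exists_norm_act_const_le (diagInv J)
  refine ⟨√(K * k ^ 2), fun p hp => ?_⟩
  obtain ⟨Φ, r, hΦ, mΦ, h1, h2⟩ := exists_phase_of_mem_graph hJ h z hp
  have mr : MemLp r 2 volume := (memLp_congr_ae h2).1 (Lp.memLp _)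
  have mΓ : MemLp (fun t => ((0 : Vec d), act (diagInv J) (r t))) 2 volume :=
    memLp_prod_iff.2 ⟨MemLp.zero, memLp_act continuous_const (EntryBounded.const _) mr⟩
  have h3 := hest Φ _ hΦ mΦ mΓ fun t => hann t _
  have h4 : ∫ t, ‖((0 : Vec d), act (diagInv J) (r t))‖ ^ 2 ≤ k ^ 2 * ∫ t, ‖r t‖ ^ 2 :=
    integral_norm_sq_le_of_le mr fun t => by
      rw [Prod.norm_def, norm_zero, max_eq_right (norm_nonneg _)]
      exact hkJ _
  have h5 : ∫ t, ‖(Φ t).1‖ ^ 2 ≤ 1 ^ 2 * ∫ t, ‖Φ t‖ ^ 2 :=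
    integral_norm_sq_le_of_le mΦ fun t => by rw [one_mul]; exact norm_fst_le _
  have h6 := mul_le_mul_of_nonneg_left h4 hK
  rw [one_pow, one_mul, ← norm_sq_eq_integral h1] at h5
  rw [← norm_sq_eq_integral h2, norm_sub_rev] at h6
  refine (pow_le_pow_iff_left₀ (norm_nonneg _) (by positivity) two_ne_zero).1 ?_
  rw [mul_pow, Real.sq_sqrt (by positivity)]
  linarith

/-- Elements orthogonal to the range of `L - z` are `J` times eigenfunctions of `L` for the
conjugate of `z`, because `J U = Uᵀ J`. -/
theorem exists_mem_graph_of_orthogonal (hJ : ∀ i, 0 < J i) (h : IsTopSolution J Ω M P)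
    {w : L2 d} (hw : ∀ p ∈ schrodingerGraph (topPotential Ω P), inner ℂ (p.2 - z • p.1) w = 0) :
    ∃ q ∈ schrodingerGraph (topPotential Ω P), q.2 = starRingEnd ℂ z • q.1 ∧
      (q.1 = 0 → w = 0) := by
  have hU := h.continuous_topPotential hJ
  have hb := h.entryBounded_topPotential hJ
  have hadj : (w, starRingEnd ℂ z • w) ∈ schrodingerGraph fun x => (topPotential Ω P x)ᵀ := by
    rw [← adjoint_schrodingerGraph hU hb, Submodule.mem_adjoint_iff]
    intro a b hp
    have := hw _ hp
    rw [inner_sub_left, inner_smul_left] at this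
    rwa [inner_smul_right]
  obtain ⟨ψ, χ, k, p1, p2, p3, mψ, mχ, mk, p4⟩ := exists_of_mem_schrodingerGraph hadj
  obtain ⟨q, hq, q1, q2⟩ := exists_mem_schrodingerGraph hU hb
    (fun x => (actR (diagInv J)).hasFDerivAt.comp_hasDerivAt x (p2 x)) (p3.act_const (diagInv J))
    (memLp_act continuous_const (EntryBounded.const _) mψ)
    (memLp_act continuous_const (EntryBounded.const _) mk)
  refine ⟨q, hq, ?_, fun h0 => ?_⟩
  · refine Lp.ext ?_
    filter_upwards [q1, q2, p1, p4, Lp.coeFn_smul (starRingEnd ℂ z) q.1,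
      Lp.coeFn_smul (starRingEnd ℂ z) w] with x e1 e2 e3 e4 e5 e6
    have hcomm : act (topPotential Ω P x) (act (diagInv J) (ψ x)) =
        act (diagInv J) (act (topPotential Ω P x)ᵀ (ψ x)) := by
      have e := congrArg (fun A => act A (act (diagInv J) (ψ x)))
        (h.diagonal_mul_topPotential hJ x)
      simp only [act_mul, act_diag_inv hJ] at e
      rw [← e, act_inv_diag hJ]
    have e7 : starRingEnd ℂ z • ψ x = -k x + act (topPotential Ω P x)ᵀ (ψ x) := by
      rw [← e4, e6, Pi.smul_apply, e3]
    rw [e5, Pi.smul_apply, e1, e2]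
    change -act (diagInv J) (k x) + act (topPotential Ω P x) (act (diagInv J) (ψ x)) =
      starRingEnd ℂ z • act (diagInv J) (ψ x)
    rw [hcomm, ← map_smul, e7, map_add, map_neg]
  · refine Lp.eq_zero_iff_ae_eq_zero.2 ?_
    have h1 := Lp.eq_zero_iff_ae_eq_zero.1 h0
    filter_upwards [h1, q1, p1] with x e1 e2 e3
    have e4 : act (diagInv J) (ψ x) = 0 := e2.symm.trans e1
    rw [e3, ← act_diag_inv hJ (ψ x), e4, map_zero]
    rfl

theorem denseRange_schrodinger_sub (hJ : ∀ i, 0 < J i) (h : IsTopSolution J Ω M P) (z : ℂ) :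
    DenseRange fun f : (schrodinger (topPotential Ω P)).domain =>
      schrodinger (topPotential Ω P) f - z • (f : L2 d) := by
  set T := schrodinger (topPotential Ω P) with hT
  let A : T.domain →ₗ[ℂ] L2 d := T.toFun - z • T.domain.subtype
  have hr : Dense ((LinearMap.range A : Submodule ℂ (L2 d)) : Set (L2 d)) := by
    rw [Submodule.dense_iff_topologicalClosure_eq_top, Submodule.topologicalClosure_eq_top_iff,
      Submodule.eq_bot_iff]
    intro w hw
    obtain ⟨q, hq, hq2, hq0⟩ := exists_mem_graph_of_orthogonal (z := z) hJ h (w := w) fun p hp => by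
      rw [← schrodinger_graph, LinearPMap.mem_graph_iff] at hp
      obtain ⟨y, hy, hTy⟩ := hp
      rw [← hy, ← hTy]
      exact hw _ ⟨y, rfl⟩
    exact hq0 (eq_zero_of_mem_graph hJ h hq hq2)
  rw [LinearMap.coe_range] at hr
  exact hr

theorem injective_schrodinger_sub (hJ : ∀ i, 0 < J i) (h : IsTopSolution J Ω M P) (z : ℂ) :
    Function.Injective fun f : (schrodinger (topPotential Ω P)).domain =>
      schrodinger (topPotential Ω P) f - z • (f : L2 d) := by
  set T := schrodinger (topPotential Ω P) with hT
  let A : T.domain →ₗ[ℂ] L2 d := T.toFun - z • T.domain.subtype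
  refine (injective_iff_map_eq_zero A).2 fun f hf => ?_
  have hm : ((f : L2 d), T f) ∈ schrodingerGraph (topPotential Ω P) := by
    rw [← schrodinger_graph]
    exact T.mem_graph f
  exact Subtype.ext (eq_zero_of_mem_graph (z := z) hJ h hm (sub_eq_zero.1 hf))

theorem opSpectrum_subset (hJ : ∀ i, 0 < J i) (h : IsTopSolution J Ω M P) (x : ℝ) :
    opSpectrum (schrodinger (topPotential Ω P)) ⊆ Prod.snd '' realCurve J (M x) (P x) := by
  intro z hz
  by_contra hn
  obtain ⟨c, hc⟩ := exists_norm_le_of_notMem hJ h hn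
  refine hz (exists_bounded_inverse (c := c) ?_ ?_ (denseRange_schrodinger_sub hJ h z))
  · rw [schrodinger_graph]
    exact isClosed_schrodingerGraph (h.continuous_topPotential hJ) (h.entryBounded_topPotential hJ)
  · rwa [schrodinger_graph]

end Resolvent

end

end Bogoyavlenskij

namespace Bogoyavlenskij
open Filter Topology Matrix
open scoped ContDiff

noncomputable section

variable {d : ℕ}

/-! ### Approximate eigenfunctions and the spectrum in `L²` -/

section Weyl

variable {U : ℝ → RMat d} {z : ℂ}

/-- The commutator of `L` with a cutoff `φ`. -/
theorem exists_mem_graph_truncation (hU : Continuous U) (hb : EntryBounded U)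
    {ψ : ℝ → Vec d} (hψ : IsSolution U z ψ) {φ φ₁ φ₂ : ℝ → ℝ} (cφ : HasCompactSupport φ)
    (d0 : ∀ x, HasDerivAt φ (φ₁ x) x) (d1 : ∀ x, HasDerivAt φ₁ (φ₂ x) x) (c2 : Continuous φ₂) :
    ∃ p ∈ schrodingerGraph U, (p.1 : ℝ → Vec d) =ᵐ[volume] (fun x => φ x • ψ x) ∧
      ((p.2 - z • p.1 : L2 d) : ℝ → Vec d) =ᵐ[volume] fun x =>
        -(φ₂ x • ψ x + (2 * φ₁ x) • deriv ψ x) := by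
  have e1 : deriv φ = φ₁ := funext fun x => (d0 x).deriv
  have e2 : deriv φ₁ = φ₂ := funext fun x => (d1 x).deriv
  have cφ1 : HasCompactSupport φ₁ := e1 ▸ cφ.deriv
  have cφ2 : HasCompactSupport φ₂ := e2 ▸ cφ1.deriv
  have c0 : Continuous φ := continuous_iff_continuousAt.2 fun x => (d0 x).continuousAt
  have c1 : Continuous φ₁ := continuous_iff_continuousAt.2 fun x => (d1 x).continuousAt
  have hψc : Continuous ψ := hψ.1.continuous
  have hψc' : Continuous (deriv ψ) := hψ.2.1.continuous
  have hgc : Continuous fun x => act (U x) (ψ x) - z • ψ x :=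
    (continuous_act hU hψc).sub (hψc.const_smul z)
  have h1 := fun x => (hψ.1 x).hasDerivAt
  have h2 := (hψ.isPrimitive_deriv hU).2.hasDerivAt hgc
  have ck : Continuous fun x => φ x • (act (U x) (ψ x) - z • ψ x) + φ₁ x • deriv ψ x +
      (φ₁ x • deriv ψ x + φ₂ x • ψ x) :=
    ((c0.smul hgc).add (c1.smul hψc')).add ((c1.smul hψc').add (c2.smul hψc))
  obtain ⟨p, hp, p1, p2⟩ := exists_mem_schrodingerGraph hU hb
    (fun x => (d0 x).smul (h1 x))
    (IsPrimitive.of_hasDerivAt (fun x => ((d0 x).smul (h2 x)).add ((d1 x).smul (h1 x))) ck)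
    ((c0.smul hψc).memLp_of_hasCompactSupport cφ.smul_right)
    (ck.memLp_of_hasCompactSupport ((cφ.smul_right.add cφ1.smul_right).add
      (cφ1.smul_right.add cφ2.smul_right)))
  refine ⟨p, hp, p1, ?_⟩
  filter_upwards [p1, p2, Lp.coeFn_sub p.2 (z • p.1), Lp.coeFn_smul z p.1] with x f1 f2 f3 f4
  have f5 : act (U x) (φ x • ψ x) = φ x • act (U x) (ψ x) := (actR (U x)).map_smul _ _
  rw [f3, Pi.sub_apply, f4, Pi.smul_apply, f1, f2, Pi.smul_apply', f5]
  module

theorem mul_integral_comp_mul_left {ε : ℝ} (hε : 0 < ε) (f : ℝ → ℝ) :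
    ε * ∫ x, f (ε * x) = ∫ y, f y := by
  rw [Measure.integral_comp_mul_left, abs_of_pos (inv_pos.2 hε), smul_eq_mul,
    mul_inv_cancel_left₀ hε.ne']

theorem exists_cutoff : ∃ η : ℝ → ℝ, ContDiff ℝ ∞ η ∧ HasCompactSupport η ∧ 0 < ∫ y, η y ^ 2 := by
  obtain ⟨η, hη, cη, iη⟩ := exists_test_integral_eq_one
  obtain ⟨y, hy⟩ : ∃ y, η y ≠ 0 := by
    by_contra! h0
    simp [h0] at iη
  exact ⟨η, hη, cη, (hη.continuous.pow 2).integral_pos_of_hasCompactSupport_nonneg_nonzero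
    (cη.comp_left (g := fun t : ℝ => t ^ 2) (by simp)) (fun y => sq_nonneg _) (x := y)
    (pow_ne_zero 2 hy)⟩

theorem exists_norm_deriv_le (hU : Continuous U) (hb : EntryBounded U)
    {ψ : ℝ → Vec d} {m : ℝ} (hψ : IsSolution U z ψ) (hm : ∀ x, ‖ψ x‖ = m) :
    ∃ D, ∀ x, ‖deriv ψ x‖ ≤ D := by
  obtain ⟨C, hC⟩ := hb
  obtain ⟨c, hc, hcU⟩ := exists_norm_act_le hC
  have h1 : ∀ x, ‖act (U x) (ψ x) - z • ψ x‖ ≤ c * m + ‖z‖ * m := fun x => by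
    refine (norm_sub_le _ _).trans (add_le_add ?_ ?_)
    · rw [← hm x]
      exact hcU x _
    · rw [norm_smul, hm x]
  exact ⟨_, norm_deriv_le_of_bounded (fun x => (hψ.1 x).hasDerivAt)
    (hψ.isPrimitive_deriv hU).2 (fun x => (hm x).le) h1⟩

/-- A truncation of a solution of constant norm is an approximate eigenfunction: stretching the
cutoff `η` by `1 / ε` makes `(L - z) (η ψ)` smaller than `η ψ` by a factor of order `ε`. -/
theorem exists_approximate_eigenfunction (hU : Continuous U) (hb : EntryBounded U)
    {ψ : ℝ → Vec d} {m : ℝ} (hψ : IsSolution U z ψ) (hm : ∀ x, ‖ψ x‖ = m) :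
    ∃ a b : ℝ, 0 < a ∧ ∀ ε : ℝ, 0 < ε → ε ≤ 1 → ∃ p ∈ schrodingerGraph U,
      m ^ 2 * a ≤ ε * ‖p.1‖ ^ 2 ∧ ε * ‖p.2 - z • p.1‖ ^ 2 ≤ ε ^ 2 * b := by
  obtain ⟨η, hη, cη, pη⟩ := exists_cutoff
  have hη1 : ContDiff ℝ ∞ (deriv η) := (contDiff_infty_iff_deriv.1 hη).2
  have hη2 : Continuous (deriv (deriv η)) := hη1.continuous_deriv (by simp)
  have hm0 : 0 ≤ m := hm 0 ▸ norm_nonneg _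
  obtain ⟨D, hD⟩ := exists_norm_deriv_le hU hb hψ hm
  -- the size of the commutator of `L` with the cutoff, up to the factor `ε`
  set q : ℝ → ℝ := fun y => |deriv (deriv η) y| * m + 2 * |deriv η y| * D with hq
  have cq : Continuous q := by
    exact (hη2.abs.mul_const m).add ((hη1.continuous.abs.const_mul 2).mul_const D)
  have hqc : HasCompactSupport q :=
    (cη.deriv.deriv.norm.mul_right).add (cη.deriv.norm.mul_left.mul_right)
  have mq : ∀ ε : ℝ, 0 < ε → MemLp (fun x => q (ε * x)) 2 volume := fun ε hε => by
    have h1 : Continuous fun x => q (ε * x) := cq.comp (continuous_const.mul continuous_id)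
    have h2 : HasCompactSupport fun x => q (ε * x) :=
      hqc.comp_homeomorph (Homeomorph.mulLeft₀ ε hε.ne')
    exact h1.memLp_of_hasCompactSupport h2
  refine ⟨∫ y, η y ^ 2, ∫ y, q y ^ 2, pη, fun ε hε hε1 => ?_⟩
  have d0 : ∀ x, HasDerivAt (fun x => η (ε * x)) (ε * deriv η (ε * x)) x := fun x => by
    have := ((hη.differentiable (by simp)) (ε * x)).hasDerivAt.comp x
      ((hasDerivAt_id x).const_mul ε)
    simpa [mul_comm] using! this
  have d1 : ∀ x, HasDerivAt (fun x => ε * deriv η (ε * x))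
      (ε * (ε * deriv (deriv η) (ε * x))) x := fun x => by
    have := ((hη1.differentiable (by simp)) (ε * x)).hasDerivAt.comp x
      ((hasDerivAt_id x).const_mul ε)
    have h2 := this.const_mul ε
    simpa [mul_comm] using! h2
  have c2 : Continuous fun x => ε * (ε * deriv (deriv η) (ε * x)) := by fun_prop
  obtain ⟨p, hp, p1, p2⟩ := exists_mem_graph_truncation hU hb hψ
    (cη.comp_homeomorph (Homeomorph.mulLeft₀ ε hε.ne')) d0 d1 c2
  refine ⟨p, hp, ?_, ?_⟩
  · rw [norm_sq_eq_integral p1]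
    have e : ∀ x, ‖η (ε * x) • ψ x‖ ^ 2 = m ^ 2 * η (ε * x) ^ 2 := fun x => by
      rw [norm_smul, mul_pow, hm, Real.norm_eq_abs, sq_abs, mul_comm]
    have e' : ∫ x, ‖(η ∘ Homeomorph.mulLeft₀ ε hε.ne') x • ψ x‖ ^ 2 =
        ∫ x, m ^ 2 * η (ε * x) ^ 2 := integral_congr_ae (Eventually.of_forall e)
    rw [e', integral_const_mul, mul_left_comm, mul_integral_comp_mul_left hε fun y => η y ^ 2]
  · rw [norm_sq_eq_integral p2]
    have hle := integral_norm_sq_le_of_le (D := ε) (mq ε hε)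
      (u := fun x => -((ε * (ε * deriv (deriv η) (ε * x))) • ψ x +
        (2 * (ε * deriv η (ε * x))) • deriv ψ x)) fun x => by
      have hq0 : 0 ≤ q (ε * x) := by
        have : 0 ≤ D := (norm_nonneg _).trans (hD 0)
        positivity
      rw [norm_neg, Real.norm_of_nonneg hq0]
      refine (norm_add_le _ _).trans ?_
      rw [norm_smul, norm_smul, hm, Real.norm_eq_abs, Real.norm_eq_abs, abs_mul, abs_mul, abs_mul,
        abs_mul, abs_of_pos hε, abs_two]
      have h1 : ε * |deriv (deriv η) (ε * x)| * m ≤ |deriv (deriv η) (ε * x)| * m :=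
        mul_le_mul_of_nonneg_right (mul_le_of_le_one_left (abs_nonneg _) hε1) hm0
      have h2 := mul_le_mul_of_nonneg_left (hD x) (abs_nonneg (deriv η (ε * x)))
      have h3 : ε * (ε * |deriv (deriv η) (ε * x)|) * m +
          2 * (ε * |deriv η (ε * x)|) * ‖deriv ψ x‖ =
          ε * (ε * |deriv (deriv η) (ε * x)| * m + 2 * (|deriv η (ε * x)| * ‖deriv ψ x‖)) := by
        ring
      rw [h3]
      refine mul_le_mul_of_nonneg_left ?_ hε.le
      change _ ≤ |deriv (deriv η) (ε * x)| * m + 2 * |deriv η (ε * x)| * D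
      linarith
    simp only [Real.norm_eq_abs, sq_abs] at hle
    have := mul_le_mul_of_nonneg_left hle hε.le
    rwa [mul_left_comm, mul_integral_comp_mul_left hε fun y => q y ^ 2] at this

theorem mem_opSpectrum_of_norm_eq (hU : Continuous U) (hb : EntryBounded U)
    {ψ : ℝ → Vec d} {m : ℝ} (hψ : IsSolution U z ψ) (hm0 : 0 < m) (hm : ∀ x, ‖ψ x‖ = m) :
    z ∈ opSpectrum (schrodinger U) := by
  rintro ⟨R, -, hR⟩
  obtain ⟨a, b, ha, H⟩ := exists_approximate_eigenfunction hU hb hψ hm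
  have key : ∀ n : ℕ, m ^ 2 * a ≤ ‖R‖ ^ 2 * ((1 / ((n : ℝ) + 1)) ^ 2 * b) := by
    intro n
    have hε : 0 < 1 / ((n : ℝ) + 1) := by positivity
    obtain ⟨p, hp, h1, h2⟩ := H (1 / ((n : ℝ) + 1)) hε
      ((div_le_one (by positivity)).2 (by linarith [n.cast_nonneg (α := ℝ)]))
    rw [← schrodinger_graph, LinearPMap.mem_graph_iff] at hp
    obtain ⟨y, hy, hTy⟩ := hp
    have h3 : ‖p.1‖ ≤ ‖R‖ * ‖p.2 - z • p.1‖ := by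
      have := hR y
      rw [hy, hTy] at this
      conv_lhs => rw [← this]
      exact R.le_opNorm _
    have h4 := pow_le_pow_left₀ (norm_nonneg _) h3 2
    rw [mul_pow] at h4
    calc m ^ 2 * a ≤ 1 / ((n : ℝ) + 1) * ‖p.1‖ ^ 2 := h1
      _ ≤ 1 / ((n : ℝ) + 1) * (‖R‖ ^ 2 * ‖p.2 - z • p.1‖ ^ 2) :=
        mul_le_mul_of_nonneg_left h4 hε.le
      _ = ‖R‖ ^ 2 * (1 / ((n : ℝ) + 1) * ‖p.2 - z • p.1‖ ^ 2) := by ring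
      _ ≤ _ := mul_le_mul_of_nonneg_left h2 (sq_nonneg _)
  have hlim := ((tendsto_one_div_add_atTop_nhds_zero_nat (𝕜 := ℝ)).pow 2).mul_const b
    |>.const_mul (‖R‖ ^ 2)
  have h0 := ge_of_tendsto' hlim key
  have : 0 < m ^ 2 * a := by positivity
  simp at h0
  linarith

end Weyl

section Spectrum

variable {J : Fin d → ℝ} {Ω M P : ℝ → RMat d} {z : ℂ}

theorem opSpectrum_eq (hJ : ∀ i, 0 < J i) (h : IsTopSolution J Ω M P) (x : ℝ) :
    opSpectrum (schrodinger (topPotential Ω P)) = Prod.snd '' realCurve J (M x) (P x) := by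
  refine (opSpectrum_subset hJ h x).antisymm ?_
  rintro _ ⟨⟨μ, z⟩, hp, rfl⟩
  obtain ⟨hc, hμ⟩ := (mem_realCurve_iff h x).1 hp
  obtain ⟨v, hv, he⟩ := (mem_spectralCurve_iff hJ x).1 hc
  obtain ⟨Φ, hΦ, h0, hE, hψ⟩ := exists_isJointEigenfunction hJ h hv he
  refine mem_opSpectrum_of_norm_eq (h.continuous_topPotential hJ) (h.entryBounded_topPotential hJ)
    hψ.2.1 (m := ‖(Φ x).1‖) ?_ fun t => norm_eq_of_re_eq_zero h.skew
      (hΦ.hasDerivAt_fst_of_eigen hE) hμ t x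
  exact norm_pos_iff.2 (hΦ.fst_ne_zero hJ h hE (h0 ▸ hv) x)

/-- The whole spectrum is continuous. -/
theorem contSpectrum_eq (hJ : ∀ i, 0 < J i) (h : IsTopSolution J Ω M P) :
    contSpectrum (schrodinger (topPotential Ω P)) = opSpectrum (schrodinger (topPotential Ω P)) :=
  Set.Subset.antisymm (fun _ hz => hz.1) fun z hz =>
    ⟨hz, injective_schrodinger_sub hJ h z, denseRange_schrodinger_sub hJ h z⟩

theorem mem_boundedSpectrum_of_lt (hJ : ∀ i, 0 < J i) (h : IsTopSolution J Ω M P) (hd : 0 < d)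
    {x lam : ℝ} (hlam : ∀ ν ∈ spectrum ℝ (P x), ν < lam) :
    (lam : ℂ) ∈ boundedSpectrum (topPotential Ω P) := by
  have hfin := spectralMultiplicity_eq_of_lt hJ h hlam
  have hpos : 0 < Module.finrank ℂ (boundedSolutions (topPotential Ω P) (lam : ℂ)) := by
    rw [spectralMultiplicity] at hfin
    omega
  have := Module.nontrivial_of_finrank_pos hpos
  obtain ⟨ψ, hψ⟩ := exists_ne (0 : boundedSolutions (topPotential Ω P) (lam : ℂ))
  exact ⟨ψ.1, fun h0 => hψ (Subtype.ext h0), ψ.2⟩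

theorem isSelfAdjoint_schrodinger_conjPotential (hJ : ∀ i, 0 < J i) (h : IsTopSolution J Ω M P) :
    IsSelfAdjoint (schrodinger (conjPotential J (topPotential Ω P))) :=
  isSelfAdjoint_schrodinger
    ((continuous_const.matrix_mul (h.continuous_topPotential hJ)).matrix_mul continuous_const)
    (((EntryBounded.const _).mul (h.entryBounded_topPotential hJ)).mul (EntryBounded.const _))
    (h.conjPotential_transpose hJ)

end Spectrum

end

end Bogoyavlenskij

theorem theorem4 (d : ℕ) (hd : 0 < d) (J : Fin d → ℝ) (hJ : ∀ i, 0 < J i)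
    (Ω M P : ℝ → RMat d) (h : IsTopSolution J Ω M P) :
    -- self-adjointness after conjugation by the square root of `J`
    (∀ x, (conjPotential J (topPotential Ω P) x).transpose =
      conjPotential J (topPotential Ω P) x) ∧
    IsSelfAdjoint (schrodinger
      (conjPotential J (topPotential Ω P))) ∧
    -- all solutions are bounded for all large energies
    IsMaximallyFiniteGap (topPotential Ω P) ∧
    -- the curve parametrizes the common eigenfunctions, its real part the bounded ones
    (∀ (x : ℝ) (μ z : ℂ), (μ, z) ∈ spectralCurve J (M x) (P x) ↔
      ∃ ψ, IsJointEigenfunction J Ω P μ z ψ) ∧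
    (∀ (x : ℝ) (μ z : ℂ), (μ, z) ∈ realCurve J (M x) (P x) ↔
      ∃ ψ, IsJointEigenfunction J Ω P μ z ψ ∧ IsBoundedFun ψ) ∧
    -- the spectrum, in both senses, is the projection of the real part of the curve
    (∀ x : ℝ, boundedSpectrum (topPotential Ω P) =
      Prod.snd '' realCurve J (M x) (P x)) ∧
    (∀ x : ℝ, opSpectrum
        (schrodinger (topPotential Ω P)) =
      Prod.snd '' realCurve J (M x) (P x)) ∧
    -- the multiplicity counts the preimages on the real part of the curve
    (∀ (x : ℝ) (z : ℂ),
      spectralMultiplicity (topPotential Ω P) z =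
      ∑ᶠ p ∈ {p ∈ realCurve J (M x) (P x) | p.2 = z},
        Module.finrank ℂ
          (LinearMap.ker (Matrix.toLin' (pencil J (M x) (P x) p.1 p.2)))) ∧
    -- above the largest eigenvalue of `P`
    (∀ (x lam : ℝ), (∀ ν ∈ spectrum ℝ (P x), ν < lam) →
      (lam : ℂ) ∈ boundedSpectrum (topPotential Ω P) ∧
      (lam : ℂ) ∈ contSpectrum
        (schrodinger (topPotential Ω P)) ∧
      spectralMultiplicity (topPotential Ω P) (lam : ℂ)
        = 2 * d) := by
  refine ⟨h.conjPotential_transpose hJ, isSelfAdjoint_schrodinger_conjPotential hJ h,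
    isMaximallyFiniteGap hJ h, fun x μ z => mem_spectralCurve_iff_exists hJ h x,
    fun x μ z => mem_realCurve_iff_exists hJ h x, boundedSpectrum_eq hJ h, opSpectrum_eq hJ h,
    fun x z => spectralMultiplicity_eq_finsum hJ h x z, fun x lam hlam => ?_⟩
  have hmem := mem_boundedSpectrum_of_lt hJ h hd hlam
  refine ⟨hmem, ?_, spectralMultiplicity_eq_of_lt hJ h hlam⟩
  rwa [contSpectrum_eq hJ h, opSpectrum_eq hJ h x, ← boundedSpectrum_eq hJ h x]
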